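/- Let $(W_i)_{i\ge 1}$ be i.i.d. copies of a random variable $W$ with $\mathbb P(W>0)=1$ and $\sup\{x\in\mathbb R:\mathbb P(W\le x)<1\}=1$, and set $\theta:=1+\mathbb E[W]$. The weighted recursive tree is the sequence of directed trees $(G_n)_{n\ge 1}$ in which $G_1$ is the single vertex $1$ and, for $n\ge 1$, $G_{n+1}$ is obtained from $G_n$ by adding the vertex $n+1$ and one edge directed from $n+1$ to a vertex of $\{1,\dots,n\}$, which, conditionally on $G_n$ and on all the weights, equals $i$ with probability $W_i/\sum_{j=1}^n W_j$ for each $i\in\{1,\dots,n\}$. Let $\mathcal Z_n(i)$ be the in-degree of $i$ in $G_n$, let $\max\mathcal Z_n:=\max_{1\le i\le n}\mathcal Z_n(i)$, and let $\log_\theta$ be the logarithm to base $\theta$. Then the following limits hold in probability as $n\to\infty$. (Weibull) Suppose that there are $\alpha>1$ and a positive function $\ell$, slowly varying at infinity, such that $\mathbb P(W\ge 1-1/x)=\ell(x)x^{-(\alpha-1)}$ for all $x\ge 1$. Then $$\frac{\max\mathcal Z_n-\log_\theta n}{\log_\theta\log_\theta n}\to-(\alpha-1).$$ (Gumbel-RV)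 Suppose that there are $a,c,\tau>0$ and $b\in\mathbb R$ such that $\mathbb P(W>1-1/x)\sim a x^b e^{-(x/c)^\tau}$ as $x\to\infty$, and set $\gamma:=1/(1+\tau)$. Then $$\frac{\max\mathcal Z_n-\log_\theta n}{(\log_\theta n)^{1-\gamma}}\to-\frac{\tau^\gamma}{(1-\gamma)\log\theta}\Big(\frac{1-\theta^{-1}}{c}\Big)^{1-\gamma}.$$ (Gumbel-RaV) Suppose that there are $a,c>0$, $b\in\mathbb R$ and $\tau>1$ such that $\mathbb P(W>1-1/x)\sim a(\log x)^b e^{-(\log (x)/c)^\tau}$ as $x\to\infty$. Then $$\frac{\max\mathcal Z_n-\log_\theta n+C_1(\log_\theta\log_\theta n)^\tau-C_2(\log_\theta\log_\theta n)^{\tau-1}\log_\theta\log_\theta\log_\theta n}{(\log_\theta\log_\theta n)^{\tau-1}}\to C_3,$$ where $C_1:=(\log\theta)^{\tau-1}c^{-\tau}$, $C_2:=(\log\theta)^{\tau-1}\tau(\tau-1)c^{-\tau}$ and $$C_3:=\Big(\log_\theta(\log\theta)\,(\tau-1)\log\theta-\log\big(e\,c^\tau(1-\theta^{-1})/\tau\big)\Big)(\log\theta)^{\tau-2}\,\tau\,c^{-\tau}.$$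 -/

import Mathlib

open MeasureTheory ProbabilityTheory Filter Topology Asymptotics

noncomputable section

namespace WRT

/-- Standing conditions on the law `ν` of a vertex-weight: it is a probability measure carried by
`(0, ∞)`, and the supremum of its support, `sup {x | P(W ≤ x) < 1}`, equals one. -/
structure WeightLaw (ν : Measure ℝ) : Prop where
  isProbabilityMeasure : IsProbabilityMeasure ν
  pos : ∀ᵐ w ∂ν, 0 < w
  isLUB_one : IsLUB {x : ℝ | ν (Set.Iic x) < 1} 1

/-- Slow variation at infinity. -/
def SlowlyVarying (l : ℝ → ℝ) : Prop :=
  ∀ t : ℝ, 0 < t → Tendsto (fun x => l (t * x) / l x) atTop (𝓝 1)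

/-- The Weibull case: `P(W ≥ 1 - 1/x) = l(x) x^{-(α-1)}` for `x ≥ 1`, where `α > 1` and `l` is
positive and slowly varying at infinity. -/
structure WeibullCase (ν : Measure ℝ) (α : ℝ) (l : ℝ → ℝ) : Prop where
  one_lt : 1 < α
  pos : ∀ x : ℝ, 1 ≤ x → 0 < l x
  slowlyVarying : SlowlyVarying l
  tail : ∀ x : ℝ, 1 ≤ x → ν.real (Set.Ici (1 - 1 / x)) = l x * x ^ (-(α - 1))

/-- The Gumbel-RV case: `P(W > 1 - 1/x) ∼ a x^b exp(-(x/c)^τ)` as `x → ∞`. -/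
structure GumbelRVCase (ν : Measure ℝ) (a b c τ : ℝ) : Prop where
  a_pos : 0 < a
  c_pos : 0 < c
  τ_pos : 0 < τ
  tail : (fun x : ℝ => ν.real (Set.Ioi (1 - 1 / x)))
    ~[atTop] fun x : ℝ => a * x ^ b * Real.exp (-(x / c) ^ τ)

/-- The Gumbel-RaV case: `P(W > 1 - 1/x) ∼ a (log x)^b exp(-(log x/c)^τ)` as `x → ∞`, `τ > 1`. -/
structure GumbelRaVCase (ν : Measure ℝ) (a b c τ : ℝ) : Prop where
  a_pos : 0 < a
  c_pos : 0 < c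
  one_lt_τ : 1 < τ
  tail : (fun x : ℝ => ν.real (Set.Ioi (1 - 1 / x)))
    ~[atTop] fun x : ℝ => a * Real.log x ^ b * Real.exp (-(Real.log x / c) ^ τ)

variable {Ω : Type*}

/-- The information available when vertex `n` attaches itself: all vertex-weights, and the tree on
the vertices `0, …, n - 1`, that is, the parents of the vertices `1, …, n - 1`. -/
abbrev past (W : ℕ → Ω → ℝ) (parent : ℕ → Ω → ℕ) (n : ℕ) : MeasurableSpace Ω :=
  (⨆ j : ℕ, MeasurableSpace.comap (W j) inferInstance) ⊔
    ⨆ k ∈ Finset.Ico 1 n, MeasurableSpace.comap (parent k) inferInstance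

/-- The weighted recursive tree with weight law `ν`. Vertices are numbered from `0`, so that
vertex `i` has label `i + 1`, and `G_n` is the tree on the vertices `0, …, n - 1`. The weights
`W i` are i.i.d. with law `ν`. For `n ≥ 1` the vertex `n` sends one directed edge to a vertex
`parent n`, which, conditionally on the weights and on `G_n`, equals `i < n` with probability
`W i / (W 0 + … + W (n - 1))`. The root is `0`; the value of `parent 0` is irrelevant. -/
structure IsWRT [MeasurableSpace Ω] (μ : Measure Ω) (ν : Measure ℝ)
    (W : ℕ → Ω → ℝ) (parent : ℕ → Ω → ℕ) : Prop where
  measurable_weight : ∀ i, Measurable (W i)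
  law_weight : ∀ i, μ.map (W i) = ν
  indep_weight : iIndepFun W μ
  measurable_parent : ∀ n, 1 ≤ n → Measurable (parent n)
  condProb_parent : ∀ n, 1 ≤ n → ∀ i < n,
    μ⟦parent n ⁻¹' {i} | past W parent n⟧
      =ᵐ[μ] fun ω => W i ω / ∑ j ∈ Finset.range n, W j ω

/-- The in-degree `Z_n(i)` of vertex `i` in `G_n`. -/
def inDegree (parent : ℕ → Ω → ℕ) (n i : ℕ) (ω : Ω) : ℕ :=
  ((Finset.Ico 1 n).filter fun k => parent k ω = i).card

/-- The maximum in-degree of `G_n`. -/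
def maxInDegree (parent : ℕ → Ω → ℕ) (n : ℕ) (ω : Ω) : ℕ :=
  (Finset.range n).sup fun i => inDegree parent n i ω

/-- `θ = 1 + E[W]`. -/
def theta (ν : Measure ℝ) : ℝ := 1 + ∫ w, w ∂ν

/-- The constant of the Gumbel-RV case, with `γ = 1/(1+τ)`. -/
def constRV (θ τ c : ℝ) : ℝ :=
  τ ^ (1 / (1 + τ)) / ((1 - 1 / (1 + τ)) * Real.log θ) *
    ((1 - θ⁻¹) / c) ^ (1 - 1 / (1 + τ))

/-- The constant `C₁` of the Gumbel-RaV case. -/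
def C₁ (θ τ c : ℝ) : ℝ := Real.log θ ^ (τ - 1) * c ^ (-τ)

/-- The constant `C₂` of the Gumbel-RaV case. -/
def C₂ (θ τ c : ℝ) : ℝ := Real.log θ ^ (τ - 1) * τ * (τ - 1) * c ^ (-τ)

/-- The constant `C₃` of the Gumbel-RaV case. -/
def C₃ (θ τ c : ℝ) : ℝ :=
  (Real.logb θ (Real.log θ) * (τ - 1) * Real.log θ
      - Real.log (Real.exp 1 * c ^ τ * (1 - θ⁻¹) / τ))
    * Real.log θ ^ (τ - 2) * τ * c ^ (-τ)

end WRT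

end

/-! Write `s = E[W] = θ - 1` and let `S_m` be the sum of the first `m` weights. Given the weights,
the in-degree of vertex `i` is a sum of independent Bernoulli variables with parameters `W_i / S_m`,
`i < m < n`, and distinct in-degrees are negatively correlated. The maximum is therefore located by
the first and second moment of the number of vertices of in-degree at least `k`.

If `S_m` were equal to `s m`, the expected number of such vertices, all of weight `w`, would satisfy
a linear recursion in `(n, k)` with exact solution `n (w / (w + s)) ^ k` (`linCount_le`,
`le_linCount`). Hence the relevant mean is `n p_k` with `p_k = E[(W / (W + s)) ^ k]`, called
`degTail`. The maximum is below `k` with high probability if `n p_k → 0`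
(`IsWRT.tendsto_measure_le_maxInDegree`) and at least `k` if `n p_k → ∞`
(`IsWRT.tendsto_measure_maxInDegree_lt`). Only `k` close to `log_θ n` matter. By Hoeffding's
inequality `S_m` is within a factor `1 ± 1 / log² n` of `s m` for all `m ≥ log⁶ n`, an error that
stays bounded after raising to the power `k`. The first `log⁶ n` vertices are removed by a Chernoff
bound with base `√θ`.

Since `W ≤ 1`, `p_k = θ ^ (-k) exp(-D_k)` with `D_k` the `defect`, and `n p_k` is of order one where
`k = log_θ n - D_k / log θ`. So the limits follow from the asymptotics of `D_k`
(`IsWRT.tendstoInMeasure_of_defect`). These come from Laplace's method: near `w = 1` the quantity `θ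
w / (w + s)` behaves like `exp(-A (1 - w))`, `A = 1 - θ⁻¹`, and with `w = 1 - 1/x` one finds that
`D_k` is close to the minimum over `x` of `A k / x - log P(W > 1 - 1/x)` (`WeightLaw.le_defect`,
`WeightLaw.defect_le`). In the Weibull case the optimal `x` is of order `k` and `D_k ~ (α - 1) log
k`. In the Gumbel-RV case `A k / x + (x / c) ^ τ` has an explicit minimum. In the Gumbel-RaV case `A
k / x + (log x / c) ^ τ` is expanded in `log k` up to `o((log k) ^ (τ - 1))`. -/

namespace WRT

/-! ### Sums of independent Bernoulli variables. -/

/-- The expectation of `f (X 0 + ⋯ + X (n - 1))` for independent Bernoulli variables `X m` with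
parameters `p m`. -/
noncomputable def bernExp (p : ℕ → ℝ) : ℕ → (ℕ → ℝ) → ℝ
  | 0, f => f 0
  | n + 1, f => (1 - p n) * bernExp p n f + p n * bernExp p n (fun z => f (z + 1))

/-- The indicator function of `{z | k ≤ z}`. -/
noncomputable def tailInd (k : ℕ) : ℕ → ℝ := fun z => if k ≤ z then 1 else 0

lemma tailInd_mono (k : ℕ) : Monotone (tailInd k) := by
  intro a b hab
  unfold tailInd
  split_ifs with h1 h2
  · exact le_rfl
  · omega
  · exact zero_le_one
  · exact le_rfl

lemma tailInd_nonneg (k z : ℕ) : 0 ≤ tailInd k z := by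
  unfold tailInd; split_ifs <;> norm_num

lemma tailInd_le_one (k z : ℕ) : tailInd k z ≤ 1 := by
  unfold tailInd; split_ifs <;> norm_num

lemma tailInd_succ (k : ℕ) : (fun z => tailInd (k + 1) (z + 1)) = tailInd k := by
  funext z; simp [tailInd]

lemma tailInd_zero : tailInd 0 = fun _ => 1 := by
  funext z; simp [tailInd]

lemma bernExp_mono {p : ℕ → ℝ} {n : ℕ} (hp : ∀ m < n, 0 ≤ p m ∧ p m ≤ 1) {f g : ℕ → ℝ}
    (hfg : ∀ z, f z ≤ g z) : bernExp p n f ≤ bernExp p n g := by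
  induction n generalizing f g with
  | zero => exact hfg 0
  | succ n ih =>
    have hp' : ∀ m < n, 0 ≤ p m ∧ p m ≤ 1 := fun m hm => hp m (by omega)
    obtain ⟨h0, h1⟩ := hp n (by omega)
    exact add_le_add (mul_le_mul_of_nonneg_left (ih hp' hfg) (by linarith))
      (mul_le_mul_of_nonneg_left (ih hp' fun z => hfg (z + 1)) h0)

lemma bernExp_const (p : ℕ → ℝ) (n : ℕ) (c : ℝ) : bernExp p n (fun _ => c) = c := by
  induction n with
  | zero => rfl
  | succ n ih => simp only [bernExp, ih]; ring

lemma bernExp_const_mul (p : ℕ → ℝ) (n : ℕ) (c : ℝ) (f : ℕ → ℝ) :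
    bernExp p n (fun z => c * f z) = c * bernExp p n f := by
  induction n generalizing f with
  | zero => rfl
  | succ n ih =>
    simp only [bernExp, ih f, ih fun z => f (z + 1)]; ring

lemma bernExp_le_shift {p : ℕ → ℝ} {n : ℕ} (hp : ∀ m < n, 0 ≤ p m ∧ p m ≤ 1) {f : ℕ → ℝ}
    (hf : Monotone f) : bernExp p n f ≤ bernExp p n (fun z => f (z + 1)) :=
  bernExp_mono hp fun z => hf (Nat.le_succ z)

/-- Raising a parameter moves mass from `f z` to `f (z + 1)`, which is at least as large. This is
the coupling that later replaces random attachment rates by linear ones. -/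
lemma bernExp_mono_prob {p r : ℕ → ℝ} {n : ℕ} (hp : ∀ m < n, 0 ≤ p m) (hpr : ∀ m < n, p m ≤ r m)
    (hr : ∀ m < n, r m ≤ 1) {f : ℕ → ℝ} (hf : Monotone f) : bernExp p n f ≤ bernExp r n f := by
  induction n generalizing f with
  | zero => exact le_rfl
  | succ n ih =>
    have ih' := fun {f : ℕ → ℝ} (hf : Monotone f) => ih (fun m hm => hp m (by omega))
      (fun m hm => hpr m (by omega)) (fun m hm => hr m (by omega)) hf
    have h1 := ih' hf
    have h2 := ih' (f := fun z => f (z + 1)) (fun a b hab => hf (by omega))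
    have h3 : bernExp r n f ≤ bernExp r n (fun z => f (z + 1)) :=
      bernExp_le_shift (fun m hm => ⟨(hp m (by omega)).trans (hpr m (by omega)),
        hr m (by omega)⟩) hf
    have a1 := hp n (by omega)
    have a2 := hpr n (by omega)
    have a3 := hr n (by omega)
    simp only [bernExp]
    nlinarith [mul_le_mul_of_nonneg_left h1 (by linarith : 0 ≤ 1 - p n),
      mul_le_mul_of_nonneg_left h2 a1, mul_nonneg (sub_nonneg.2 a2) (sub_nonneg.2 h3)]

lemma bernExp_pow (p : ℕ → ℝ) (n : ℕ) (x : ℝ) :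
    bernExp p n (fun z => x ^ z) = ∏ m ∈ Finset.range n, (1 + (x - 1) * p m) := by
  induction n with
  | zero => simp [bernExp]
  | succ n ih =>
    have h : (fun z : ℕ => x ^ (z + 1)) = fun z => x * x ^ z := by funext z; ring
    rw [Finset.prod_range_succ, ← ih]
    simp only [bernExp, h, bernExp_const_mul]
    ring

/-- Chernoff's bound: the indicator of `k ≤ z` is at most `x ^ z / x ^ k`, and the generating
function factorises. -/
lemma bernExp_tailInd_le {p : ℕ → ℝ} {n : ℕ} (hp : ∀ m < n, 0 ≤ p m ∧ p m ≤ 1) {x : ℝ}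
    (hx : 1 ≤ x) (k : ℕ) :
    bernExp p n (tailInd k) ≤ x⁻¹ ^ k * ∏ m ∈ Finset.range n, (1 + (x - 1) * p m) := by
  rw [← bernExp_pow, ← bernExp_const_mul]
  refine bernExp_mono hp fun z => ?_
  have hx0 : 0 < x := by linarith
  unfold tailInd
  split_ifs with h
  · rw [inv_pow, inv_mul_eq_div, one_le_div (by positivity)]
    exact pow_le_pow_right₀ hx h
  · positivity

lemma bernExp_tailInd_nonneg {p : ℕ → ℝ} {n : ℕ} (hp : ∀ m < n, 0 ≤ p m ∧ p m ≤ 1) (k : ℕ) :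
    0 ≤ bernExp p n (tailInd k) := by
  have := bernExp_mono hp (f := fun _ => 0) (tailInd_nonneg k)
  rwa [bernExp_const] at this

lemma bernExp_tailInd_le_one {p : ℕ → ℝ} {n : ℕ} (hp : ∀ m < n, 0 ≤ p m ∧ p m ≤ 1) (k : ℕ) :
    bernExp p n (tailInd k) ≤ 1 := by
  have := bernExp_mono hp (g := fun _ => 1) (tailInd_le_one k)
  rwa [bernExp_const] at this

lemma bernExp_eq_zero_of_rate {p : ℕ → ℝ} {n : ℕ} (hp : ∀ m < n, p m = 0) (f : ℕ → ℝ) :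
    bernExp p n f = f 0 := by
  induction n with
  | zero => rfl
  | succ n ih => simp [bernExp, hp n (by omega), ih fun m hm => hp m (by omega)]

/-! ### Exact linear rates and the recursion for degree counts. -/

/-- The probability that vertex `i` receives an edge at time `m` if the rate is exactly `r / m`. -/
noncomputable def linRate (r : ℝ) (i m : ℕ) : ℝ := if i < m then r / m else 0

lemma linRate_mem {r : ℝ} {i : ℕ} (hr : 0 ≤ r) (hi : r ≤ i + 1) (m : ℕ) :
    0 ≤ linRate r i m ∧ linRate r i m ≤ 1 := by
  unfold linRate
  split_ifs with h
  · have hm : (i : ℝ) + 1 ≤ m := by exact_mod_cast h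
    have : (0 : ℝ) < m := by have := Nat.cast_nonneg (α := ℝ) i; linarith
    exact ⟨by positivity, (div_le_one this).2 (by linarith)⟩
  · norm_num

/-- Expected number of vertices among `a, …, n - 1` with degree at least `k`, for linear rates. -/
noncomputable def linCount (r : ℝ) (a n k : ℕ) : ℝ :=
  ∑ i ∈ Finset.Ico a n, bernExp (linRate r i) n (tailInd k)

lemma linCount_zero (r : ℝ) {a n : ℕ} (h : a ≤ n) : linCount r a n 0 = n - a := by
  simp [linCount, tailInd_zero, bernExp_const, Nat.cast_sub h]

/-- The rate at time `n` is `r / n` for every vertex `i < n`, independently of `i`, so the sum over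
vertices satisfies a closed recursion. The vertex `n` itself still has in-degree zero and does not
contribute to a count of degrees at least `k + 1`. -/
lemma linCount_succ (r : ℝ) {a n : ℕ} (h : a ≤ n) (k : ℕ) :
    linCount r a (n + 1) (k + 1)
      = (1 - r / n) * linCount r a n (k + 1) + r / n * linCount r a n k := by
  unfold linCount
  rw [Finset.sum_Ico_succ_top h, bernExp_eq_zero_of_rate, Finset.mul_sum, Finset.mul_sum,
    ← Finset.sum_add_distrib]
  · have : tailInd (k + 1) 0 = 0 := by simp [tailInd]
    rw [this, add_zero]
    refine Finset.sum_congr rfl fun i hi => ?_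
    have hi' : i < n := (Finset.mem_Ico.1 hi).2
    simp only [bernExp, tailInd_succ]
    simp [linRate, hi']
  · intro m hm
    simp [linRate, show ¬ n < m by omega]

/-- With `q = r / (1 + r)`, the function `n q ^ k` solves the recursion exactly, because `(n - r) q
+ r = (n + 1) q`. It dominates the count on the boundary: at `n = a` the count is zero, at `k = 0`
it is `n - a`. -/
lemma linCount_le {r : ℝ} {a : ℕ} (hr : 0 ≤ r) (ha : r ≤ a) (ha1 : 1 ≤ a) {n : ℕ} (h : a ≤ n)
    (k : ℕ) : linCount r a n k ≤ n * (r / (1 + r)) ^ k := by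
  induction n, h using Nat.le_induction generalizing k with
  | base => simp only [linCount, Finset.Ico_self, Finset.sum_empty]; positivity
  | succ n h ih =>
    cases k with
    | zero =>
      rw [linCount_zero r (by omega)]
      have := Nat.cast_nonneg (α := ℝ) a
      simp
    | succ k =>
      rw [linCount_succ r h]
      have hn : (a : ℝ) ≤ n := by exact_mod_cast h
      have hn0 : (0 : ℝ) < n := by exact_mod_cast (by omega : 0 < n)
      have h1 : r / n ≤ 1 := (div_le_one hn0).2 (by linarith)
      have h0 : 0 ≤ r / n := by positivity
      refine (add_le_add (mul_le_mul_of_nonneg_left (ih (k + 1)) (by linarith))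
        (mul_le_mul_of_nonneg_left (ih k) h0)).trans_eq ?_
      have h2 : 1 + r ≠ 0 := by positivity
      rw [pow_succ]
      push_cast
      field_simp
      ring

/-- The subtracted term is a second exact solution, because `(1 - r / n) x⁻¹ + r / n = x⁻¹ (1 + (x -
1) r / n)`. It covers the boundary excess of `n q ^ k`: at `n = a` since `q ≤ x⁻¹`, and at `k = 0`
since the product is at least one. -/
lemma le_linCount {r x : ℝ} {a : ℕ} (hr : 0 ≤ r) (ha : r ≤ a) (ha1 : 1 ≤ a) (hx : 1 ≤ x)
    (hxr : r / (1 + r) ≤ x⁻¹) {n : ℕ} (h : a ≤ n) (k : ℕ) :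
    n * (r / (1 + r)) ^ k - a * x⁻¹ ^ k * ∏ m ∈ Finset.Ico a n, (1 + (x - 1) * (r / m))
      ≤ linCount r a n k := by
  have hx0 : 0 < x := by linarith
  induction n, h using Nat.le_induction generalizing k with
  | base =>
    simp only [linCount, Finset.Ico_self, Finset.sum_empty, Finset.prod_empty, mul_one]
    rw [sub_nonpos]
    gcongr
  | succ n h ih =>
    have hn : (a : ℝ) ≤ n := by exact_mod_cast h
    have hn0 : (0 : ℝ) < n := by exact_mod_cast (by omega : 0 < n)
    cases k with
    | zero =>
      rw [linCount_zero r (by omega)]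
      have : 1 ≤ ∏ m ∈ Finset.Ico a (n + 1), (1 + (x - 1) * (r / m)) := by
        refine le_trans (le_of_eq Finset.prod_const_one.symm)
          (Finset.prod_le_prod (fun _ _ => zero_le_one) fun m _ => ?_)
        have : 0 ≤ (x - 1) * (r / m) := mul_nonneg (by linarith) (by positivity)
        linarith
      have h0 := mul_le_mul_of_nonneg_left this (Nat.cast_nonneg (α := ℝ) a)
      simp only [pow_zero, mul_one] at h0 ⊢
      linarith
    | succ k =>
      rw [linCount_succ r h, Finset.prod_Ico_succ_top h]
      have h1 : r / n ≤ 1 := (div_le_one hn0).2 (by linarith)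
      have h0 : 0 ≤ r / n := by positivity
      refine le_trans (le_of_eq ?_) (add_le_add (mul_le_mul_of_nonneg_left (ih (k + 1))
        (by linarith)) (mul_le_mul_of_nonneg_left (ih k) h0))
      have h2 : 1 + r ≠ 0 := by positivity
      generalize ∏ m ∈ Finset.Ico a n, (1 + (x - 1) * (r / m)) = P
      rw [pow_succ, pow_succ]
      push_cast
      field_simp
      ring

end WRT

/-! ### Conditional law of the in-degrees given the weights. -/

namespace WRT

variable {Ω : Type*}

/-- The information contained in the vertex-weights. -/
abbrev weightSigma (W : ℕ → Ω → ℝ) : MeasurableSpace Ω :=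
  ⨆ j : ℕ, MeasurableSpace.comap (W j) inferInstance

/-- The conditional probability, given the weights, that vertex `m` attaches itself to `i`. -/
noncomputable def attachProb (W : ℕ → Ω → ℝ) (i m : ℕ) (ω : Ω) : ℝ :=
  if i < m then W i ω / ∑ j ∈ Finset.range m, W j ω else 0

lemma measurable_weightSigma (W : ℕ → Ω → ℝ) (i : ℕ) : Measurable[weightSigma W] (W i) :=
  Measurable.of_comap_le (le_iSup (fun j => MeasurableSpace.comap (W j) inferInstance) i)

lemma measurable_sum_weight (W : ℕ → Ω → ℝ) (m : ℕ) :
    Measurable[weightSigma W] fun ω => ∑ j ∈ Finset.range m, W j ω :=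
  Finset.measurable_fun_sum _ fun j _ => measurable_weightSigma W j

lemma measurable_attachProb (W : ℕ → Ω → ℝ) (i m : ℕ) :
    Measurable[weightSigma W] (attachProb W i m) := by
  unfold attachProb
  split_ifs
  · exact Measurable.div (measurable_weightSigma W i) (measurable_sum_weight W m)
  · exact measurable_const

lemma measurable_bernExp_attachProb (W : ℕ → Ω → ℝ) (i n : ℕ) (f : ℕ → ℝ) :
    Measurable[weightSigma W] fun ω => bernExp (fun m => attachProb W i m ω) n f := by
  induction n generalizing f with
  | zero => exact measurable_const
  | succ n ih =>
    simp only [bernExp]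
    exact Measurable.add
      (Measurable.mul (Measurable.sub measurable_const (measurable_attachProb W i n)) (ih f))
      (Measurable.mul (measurable_attachProb W i n) (ih fun z => f (z + 1)))

lemma attachProb_mem {W : ℕ → Ω → ℝ} {ω : Ω} (hω : ∀ i, 0 < W i ω) (i m : ℕ) :
    0 ≤ attachProb W i m ω ∧ attachProb W i m ω ≤ 1 := by
  unfold attachProb
  split_ifs with h
  · have h1 : W i ω ≤ ∑ j ∈ Finset.range m, W j ω :=
      Finset.single_le_sum (f := fun j => W j ω) (fun j _ => (hω j).le) (Finset.mem_range.2 h)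
    have h2 := (hω i).trans_le h1
    exact ⟨(div_pos (hω i) h2).le, (div_le_one h2).2 h1⟩
  · norm_num

/-- The event that vertex `m` avoids both `i` and `j` gets a nonnegative weight, as the two-vertex
induction requires. -/
lemma attachProb_add_le_one {W : ℕ → Ω → ℝ} {ω : Ω} (hω : ∀ i, 0 < W i ω) {i j : ℕ} (hij : i ≠ j)
    (m : ℕ) : attachProb W i m ω + attachProb W j m ω ≤ 1 := by
  by_cases hi : i < m
  · by_cases hj : j < m
    · have h1 : W i ω + W j ω ≤ ∑ j ∈ Finset.range m, W j ω := by
        rw [← Finset.sum_pair (f := fun j => W j ω) hij]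
        refine Finset.sum_le_sum_of_subset_of_nonneg ?_ fun j _ _ => (hω j).le
        intro x hx
        simp only [Finset.mem_insert, Finset.mem_singleton] at hx
        rcases hx with rfl | rfl <;> simpa
      have h2 := (add_pos (hω i) (hω j)).trans_le h1
      simp only [attachProb, hi, hj, if_true]
      rw [← add_div, div_le_one h2]
      exact h1
    · have := (attachProb_mem hω i m).2
      simpa [attachProb, hj] using this
  · have := (attachProb_mem hω j m).2
    simpa [attachProb, hi] using this

lemma sum_attachProb {W : ℕ → Ω → ℝ} {ω : Ω} (hω : ∀ i, 0 < W i ω) {m : ℕ} (hm : 1 ≤ m) :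
    ∑ i ∈ Finset.range m, attachProb W i m ω = 1 := by
  have h : 0 < ∑ j ∈ Finset.range m, W j ω :=
    Finset.sum_pos (fun j _ => hω j) ⟨0, Finset.mem_range.2 hm⟩
  rw [Finset.sum_congr rfl (g := fun i => W i ω / ∑ j ∈ Finset.range m, W j ω)
    fun i hi => by simp [attachProb, Finset.mem_range.1 hi], ← Finset.sum_div]
  exact div_self h.ne'

lemma inDegree_zero (parent : ℕ → Ω → ℕ) (i : ℕ) (ω : Ω) : inDegree parent 0 i ω = 0 := by
  simp [inDegree]

lemma inDegree_one (parent : ℕ → Ω → ℕ) (i : ℕ) (ω : Ω) : inDegree parent 1 i ω = 0 := by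
  simp [inDegree]

lemma inDegree_succ (parent : ℕ → Ω → ℕ) {n : ℕ} (hn : 1 ≤ n) (i : ℕ) (ω : Ω) :
    inDegree parent (n + 1) i ω = inDegree parent n i ω + if parent n ω = i then 1 else 0 := by
  unfold inDegree
  rw [← Finset.insert_Ico_right_eq_Ico_add_one hn, Finset.filter_insert]
  split_ifs with h
  · rw [Finset.card_insert_of_notMem (by simp)]
  · rw [add_zero]

lemma measurable_inDegree (W : ℕ → Ω → ℝ) (parent : ℕ → Ω → ℕ) (n i : ℕ) :
    Measurable[past W parent n] (inDegree parent n i) := by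
  have : inDegree parent n i
      = fun ω => ∑ k ∈ Finset.Ico 1 n, if parent k ω = i then 1 else 0 := by
    funext ω; simp only [inDegree, Finset.card_filter]
  rw [this]
  refine Finset.measurable_fun_sum _ fun k hk => ?_
  have hk' : Measurable[past W parent n] (parent k) :=
    Measurable.of_comap_le (le_sup_of_le_right
      (le_iSup₂ (f := fun k (_ : k ∈ Finset.Ico 1 n) =>
        MeasurableSpace.comap (parent k) inferInstance) k hk))
  exact Measurable.ite (hk' (measurableSet_singleton i)) measurable_const measurable_const

lemma WeightLaw.ae_le_one {ν : Measure ℝ} (hν : WeightLaw ν) : ∀ᵐ w ∂ν, w ≤ 1 := by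
  have := hν.isProbabilityMeasure
  have h : ∀ n : ℕ, ∀ᵐ w ∂ν, w ≤ 1 + 1 / ((n : ℝ) + 1) := by
    intro n
    have h1 : ¬ ν (Set.Iic (1 + 1 / ((n : ℝ) + 1))) < 1 := fun h => by
      have := hν.isLUB_one.1 h
      have h2 : 0 < 1 / ((n : ℝ) + 1) := Nat.one_div_pos_of_nat
      linarith
    exact (prob_compl_eq_zero_iff measurableSet_Iic).2 (le_antisymm prob_le_one (not_lt.1 h1))
  filter_upwards [ae_all_iff.2 h] with w hw
  have : Tendsto (fun n : ℕ => 1 + 1 / ((n : ℝ) + 1)) atTop (𝓝 (1 + 0)) :=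
    tendsto_one_div_add_atTop_nhds_zero_nat.const_add 1
  rw [add_zero] at this
  exact ge_of_tendsto' this hw

variable [mΩ : MeasurableSpace Ω] {μ : Measure Ω} {ν : Measure ℝ} {W : ℕ → Ω → ℝ}
  {parent : ℕ → Ω → ℕ}

lemma integral_add_add {a b c : Ω → ℝ} (ha : Integrable a μ) (hb : Integrable b μ)
    (hc : Integrable c μ) :
    ∫ ω, (a ω + b ω + c ω) ∂μ = ∫ ω, a ω ∂μ + ∫ ω, b ω ∂μ + ∫ ω, c ω ∂μ := by
  have h : Integrable (fun ω => a ω + b ω) μ := ha.add hb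
  rw [integral_add h hc, integral_add ha hb]

lemma integral_sub_sub_add_add {a b c d e : Ω → ℝ} (ha : Integrable a μ) (hb : Integrable b μ)
    (hc : Integrable c μ) (hd : Integrable d μ) (he : Integrable e μ) :
    ∫ ω, (a ω - b ω - c ω + d ω + e ω) ∂μ
      = ∫ ω, a ω ∂μ - ∫ ω, b ω ∂μ - ∫ ω, c ω ∂μ + ∫ ω, d ω ∂μ + ∫ ω, e ω ∂μ := by
  have h1 : Integrable (fun ω => a ω - b ω) μ := ha.sub hb
  have h2 : Integrable (fun ω => a ω - b ω - c ω) μ := h1.sub hc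
  rw [integral_add_add h2 hd he, integral_sub h1 hc, integral_sub ha hb]

lemma IsWRT.ae_weight (hG : IsWRT μ ν W parent) {P : ℝ → Prop} (hP : ∀ᵐ w ∂ν, P w) :
    ∀ᵐ ω ∂μ, ∀ i, P (W i ω) := by
  refine ae_all_iff.2 fun i => ?_
  refine ae_of_ae_map (hG.measurable_weight i).aemeasurable ?_
  rwa [hG.law_weight i]

lemma IsWRT.weightSigma_le (hG : IsWRT μ ν W parent) : weightSigma W ≤ mΩ :=
  iSup_le fun j => (hG.measurable_weight j).comap_le

lemma IsWRT.past_le (hG : IsWRT μ ν W parent) (n : ℕ) : past W parent n ≤ mΩ :=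
  sup_le hG.weightSigma_le (iSup₂_le fun k hk =>
    (hG.measurable_parent k (Finset.mem_Ico.1 hk).1).comap_le)

/-- `X` is determined by the past, so it can be pulled out of the conditional expectation of the
indicator of `parent n = i`. -/
lemma IsWRT.integral_mul_parent_of_lt [IsProbabilityMeasure μ] (hG : IsWRT μ ν W parent)
    {n i : ℕ} (hn : 1 ≤ n) (hi : i < n)
    {X : Ω → ℝ} (hX : Measurable[past W parent n] X) {C : ℝ} (hC : ∀ᵐ ω ∂μ, |X ω| ≤ C) :
    ∫ ω, X ω * (if parent n ω = i then 1 else 0) ∂μ = ∫ ω, X ω * attachProb W i n ω ∂μ := by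
  have hm := hG.past_le n
  have hS : MeasurableSet (parent n ⁻¹' {i}) := hG.measurable_parent n hn (measurableSet_singleton i)
  have hint : Integrable ((parent n ⁻¹' {i}).indicator fun _ => (1 : ℝ)) μ :=
    (integrable_const 1).indicator hS
  have h := condExp_stronglyMeasurable_mul_of_bound hm hX.stronglyMeasurable hint C hC
  have h2 := hG.condProb_parent n hn i hi
  calc ∫ ω, X ω * (if parent n ω = i then 1 else 0) ∂μ
      = ∫ ω, (X * (parent n ⁻¹' {i}).indicator fun _ => (1 : ℝ)) ω ∂μ := by
        congr 1; funext ω; by_cases h : parent n ω = i <;> simp [h]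
    _ = ∫ ω, (μ[X * (parent n ⁻¹' {i}).indicator fun _ => (1 : ℝ)|past W parent n]) ω ∂μ :=
        (integral_condExp hm).symm
    _ = _ := by
        refine integral_congr_ae ?_
        filter_upwards [h, h2] with ω h h2
        rw [h, Pi.mul_apply, h2]
        simp [attachProb, hi]

/-- The model prescribes only the probabilities of the values below `n`; they sum to one, which
leaves no mass for other values. -/
lemma IsWRT.ae_parent_lt [IsProbabilityMeasure μ] (hG : IsWRT μ ν W parent) (hν : WeightLaw ν)
    {n : ℕ} (hn : 1 ≤ n) : ∀ᵐ ω ∂μ, parent n ω < n := by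
  have hpos := hG.ae_weight hν.pos
  have hP : ∀ i, MeasurableSet {ω | parent n ω = i} := fun i =>
    hG.measurable_parent n hn (measurableSet_singleton i)
  have hI : ∀ i, Integrable (fun ω => if parent n ω = i then (1 : ℝ) else 0) μ := fun i =>
    Integrable.of_bound (Measurable.ite (hP i) measurable_const
      measurable_const).aestronglyMeasurable 1 (ae_of_all _ fun ω => by split_ifs <;> simp)
  have hA : ∀ i, Integrable (attachProb W i n) μ := fun i =>
    Integrable.of_bound ((measurable_attachProb W i n).mono hG.weightSigma_le
      le_rfl).aestronglyMeasurable 1 (by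
      filter_upwards [hpos] with ω hω
      rw [Real.norm_eq_abs, abs_le]
      have := attachProb_mem hω i n
      exact ⟨by linarith, this.2⟩)
  have h1 : ∫ ω, ∑ i ∈ Finset.range n, (if parent n ω = i then (1 : ℝ) else 0) ∂μ = 1 := by
    rw [integral_finsetSum _ fun i _ => hI i]
    rw [Finset.sum_congr rfl (g := fun i => ∫ ω, attachProb W i n ω ∂μ) fun i hi => ?_]
    · rw [← integral_finsetSum _ fun i _ => hA i]
      rw [integral_congr_ae (g := fun _ => (1 : ℝ))]
      · simp
      · filter_upwards [hpos] with ω hω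
        exact sum_attachProb hω hn
    · have := hG.integral_mul_parent_of_lt hn (Finset.mem_range.1 hi) (X := fun _ => 1)
        measurable_const (C := 1) (ae_of_all _ fun _ => by simp)
      simpa using this
  have hM : MeasurableSet {ω | parent n ω < n} := hG.measurable_parent n hn measurableSet_Iio
  have h2 : (fun ω => ∑ i ∈ Finset.range n, (if parent n ω = i then (1 : ℝ) else 0))
      = {ω | parent n ω < n}.indicator fun _ => 1 := by
    funext ω
    simp [Set.indicator_apply]
  rw [h2, integral_indicator_const _ hM, smul_eq_mul, mul_one] at h1
  have : μ {ω | parent n ω < n} = 1 := by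
    rw [measureReal_def] at h1
    rw [← ENNReal.ofReal_toReal (measure_ne_top μ _), h1, ENNReal.ofReal_one]
  exact (prob_compl_eq_zero_iff hM).2 this

lemma IsWRT.integral_mul_parent [IsProbabilityMeasure μ] (hG : IsWRT μ ν W parent)
    (hν : WeightLaw ν) {n : ℕ} (i : ℕ) (hn : 1 ≤ n)
    {X : Ω → ℝ} (hX : Measurable[past W parent n] X) {C : ℝ} (hC : ∀ᵐ ω ∂μ, |X ω| ≤ C) :
    ∫ ω, X ω * (if parent n ω = i then 1 else 0) ∂μ = ∫ ω, X ω * attachProb W i n ω ∂μ := by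
  by_cases hi : i < n
  · exact hG.integral_mul_parent_of_lt hn hi hX hC
  · refine integral_congr_ae ?_
    filter_upwards [hG.ae_parent_lt hν hn] with ω hω
    simp [attachProb, hi, show parent n ω ≠ i by omega]

lemma IsWRT.integrable_of_bound [IsProbabilityMeasure μ] (hG : IsWRT μ ν W parent) {n : ℕ}
    {X : Ω → ℝ} (hX : Measurable[past W parent n] X) {C : ℝ} (hC : ∀ᵐ ω ∂μ, |X ω| ≤ C) :
    Integrable X μ :=
  Integrable.of_bound (hX.mono (hG.past_le n) le_rfl).aestronglyMeasurable C hC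

/-- Given the weights, the in-degree of a vertex is a sum of independent Bernoulli variables. -/
lemma IsWRT.integral_mul_inDegree [IsProbabilityMeasure μ] (hG : IsWRT μ ν W parent)
    (hν : WeightLaw ν) (n i : ℕ) {F : Ω → ℝ} (hF : Measurable[weightSigma W] F)
    {C : ℝ} (hC : ∀ᵐ ω ∂μ, |F ω| ≤ C) {f : ℕ → ℝ} {D : ℝ} (hD : ∀ z, |f z| ≤ D) :
    ∫ ω, F ω * f (inDegree parent n i ω) ∂μ
      = ∫ ω, F ω * bernExp (fun m => attachProb W i m ω) n f ∂μ := by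
  have hpos := hG.ae_weight hν.pos
  -- The weight factor has to vary: each step multiplies `F` by `1 - p` with `f` kept, or by `p`
  -- with `f` shifted by one.
  induction n generalizing F f C with
  | zero => simp [inDegree_zero, bernExp]
  | succ n ih =>
    -- No edge is created at time `0`: `parent 0` carries no information, and `attachProb` vanishes
    -- there too.
    rcases Nat.eq_zero_or_pos n with rfl | hn
    · simp [inDegree_one, bernExp, attachProb]
    have hWp : weightSigma W ≤ past W parent n := le_sup_left
    have hFp : Measurable[past W parent n] F := hF.mono hWp le_rfl
    have hZ := measurable_inDegree W parent n i
    have hf : ∀ f : ℕ → ℝ, Measurable[past W parent n] fun ω => f (inDegree parent n i ω) :=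
      fun f => (measurable_of_countable f).comp hZ
    have hbound : ∀ f : ℕ → ℝ, (∀ z, |f z| ≤ D) →
        ∀ᵐ ω ∂μ, |F ω * f (inDegree parent n i ω)| ≤ C * D := by
      intro f hD
      filter_upwards [hC] with ω hω
      rw [abs_mul]
      exact mul_le_mul hω (hD _) (abs_nonneg _) ((abs_nonneg _).trans hω)
    have hp := measurable_attachProb W i n
    have hp1 : ∀ᵐ ω ∂μ, |attachProb W i n ω| ≤ 1 := by
      filter_upwards [hpos] with ω hω
      have := attachProb_mem hω i n
      exact abs_le.2 ⟨by linarith, this.2⟩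
    have hpp : Measurable[past W parent n] (attachProb W i n) := hp.mono hWp le_rfl
    have hI : ∀ f : ℕ → ℝ, (∀ z, |f z| ≤ D) →
        Integrable (fun ω => F ω * f (inDegree parent n i ω)) μ := fun f hD =>
      hG.integrable_of_bound (hFp.mul (hf f)) (hbound f hD)
    have hIp : ∀ f : ℕ → ℝ, (∀ z, |f z| ≤ D) →
        Integrable (fun ω => F ω * f (inDegree parent n i ω) * attachProb W i n ω) μ :=
      fun f hD => (hI f hD).mul_bdd (c := 1) (hpp.mono (hG.past_le n) le_rfl).aestronglyMeasurable hp1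
    have hIpar : ∀ f : ℕ → ℝ, (∀ z, |f z| ≤ D) → Integrable (fun ω =>
        F ω * f (inDegree parent n i ω) * (if parent n ω = i then 1 else 0)) μ :=
      fun f hD => (hI f hD).mul_bdd (c := 1) (Measurable.ite (hG.measurable_parent n hn
        (measurableSet_singleton i)) measurable_const measurable_const).aestronglyMeasurable
        (ae_of_all _ fun ω => by split_ifs <;> simp)
    have hD' : ∀ z, |f (z + 1)| ≤ D := fun z => hD (z + 1)
    have e1 := hG.integral_mul_parent hν i hn (hFp.mul (hf f)) (hbound f hD)
    have e2 := hG.integral_mul_parent hν i hn (hFp.mul (hf fun z => f (z + 1))) (hbound _ hD')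
    have hq : ∀ᵐ ω ∂μ, |1 - attachProb W i n ω| ≤ 1 := by
      filter_upwards [hpos] with ω hω
      have := attachProb_mem hω i n
      exact abs_le.2 ⟨by linarith, by linarith⟩
    have hC1 : ∀ᵐ ω ∂μ, |F ω * (1 - attachProb W i n ω)| ≤ C := by
      filter_upwards [hC, hq] with ω h1 h2
      rw [abs_mul]
      calc |F ω| * |1 - attachProb W i n ω| ≤ C * 1 :=
            mul_le_mul h1 h2 (abs_nonneg _) ((abs_nonneg _).trans h1)
        _ = C := mul_one C
    have hC2 : ∀ᵐ ω ∂μ, |F ω * attachProb W i n ω| ≤ C := by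
      filter_upwards [hC, hp1] with ω h1 h2
      rw [abs_mul]
      calc |F ω| * |attachProb W i n ω| ≤ C * 1 :=
            mul_le_mul h1 h2 (abs_nonneg _) ((abs_nonneg _).trans h1)
        _ = C := mul_one C
    have hF1 : Measurable[weightSigma W] fun ω => F ω * (1 - attachProb W i n ω) :=
      Measurable.mul hF (Measurable.sub measurable_const hp)
    have hF2 : Measurable[weightSigma W] fun ω => F ω * attachProb W i n ω := Measurable.mul hF hp
    have i1 := ih hF1 hC1 hD
    have i2 := ih hF2 hC2 hD'
    have hB : ∀ f : ℕ → ℝ, (∀ z, |f z| ≤ D) → Integrable (fun ω =>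
        bernExp (fun m => attachProb W i m ω) n f) μ := by
      intro f hD
      refine Integrable.of_bound ((measurable_bernExp_attachProb W i n f).mono hG.weightSigma_le
        le_rfl).aestronglyMeasurable D ?_
      filter_upwards [hpos] with ω hω
      have hmem := fun m (_ : m < n) => attachProb_mem hω i m
      have l1 := bernExp_mono hmem (f := f) (g := fun _ => D) fun z => (abs_le.1 (hD z)).2
      have l2 := bernExp_mono hmem (g := f) (f := fun _ => -D) fun z => (abs_le.1 (hD z)).1
      rw [bernExp_const] at l1 l2
      exact abs_le.2 ⟨l2, l1⟩
    calc ∫ ω, F ω * f (inDegree parent (n + 1) i ω) ∂μ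
        = ∫ ω, (F ω * f (inDegree parent n i ω)
            - F ω * f (inDegree parent n i ω) * (if parent n ω = i then 1 else 0)
            + F ω * f (inDegree parent n i ω + 1) * (if parent n ω = i then 1 else 0)) ∂μ := by
          congr 1; funext ω
          rw [inDegree_succ parent hn]
          split_ifs <;> simp
      _ = ∫ ω, (F ω * f (inDegree parent n i ω)
            - F ω * f (inDegree parent n i ω) * attachProb W i n ω
            + F ω * f (inDegree parent n i ω + 1) * attachProb W i n ω) ∂μ := by
          rw [integral_add, integral_sub, integral_add, integral_sub]
          · exact congrArg₂ _ (congrArg₂ _ rfl e1) e2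
          · exact hI f hD
          · exact hIp f hD
          · exact (hI f hD).sub (hIp f hD)
          · exact hIp _ hD'
          · exact hI f hD
          · exact hIpar f hD
          · exact (hI f hD).sub (hIpar f hD)
          · exact hIpar _ hD'
      _ = ∫ ω, F ω * (1 - attachProb W i n ω) * f (inDegree parent n i ω) ∂μ
          + ∫ ω, F ω * attachProb W i n ω * f (inDegree parent n i ω + 1) ∂μ := by
          rw [← integral_add]
          · congr 1; funext ω; ring
          · refine ((hI f hD).sub (hIp f hD)).congr (ae_of_all _ fun ω => ?_)
            simp only [Pi.sub_apply]; ring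
          · refine (hIp _ hD').congr (ae_of_all _ fun ω => ?_)
            ring
      _ = _ := by
          rw [i1, i2, ← integral_add]
          · congr 1; funext ω; simp only [bernExp]; ring
          · exact (hB f hD).bdd_mul (c := C) (hF1.mono hG.weightSigma_le
              le_rfl).aestronglyMeasurable hC1
          · exact (hB _ hD').bdd_mul (c := C) (hF2.mono hG.weightSigma_le
              le_rfl).aestronglyMeasurable hC2

lemma IsWRT.integrable_mul_bernExp [IsProbabilityMeasure μ] (hG : IsWRT μ ν W parent)
    (hν : WeightLaw ν) (n i : ℕ) {F : Ω → ℝ} (hF : Integrable F μ) {f : ℕ → ℝ} {D : ℝ}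
    (hD : ∀ z, |f z| ≤ D) :
    Integrable (fun ω => F ω * bernExp (fun m => attachProb W i m ω) n f) μ := by
  refine hF.mul_bdd (c := D) ((measurable_bernExp_attachProb W i n f).mono hG.weightSigma_le
    le_rfl).aestronglyMeasurable ?_
  filter_upwards [hG.ae_weight hν.pos] with ω hω
  have hmem := fun m (_ : m < n) => attachProb_mem hω i m
  have l1 := bernExp_mono hmem (f := f) (g := fun _ => D) fun z => (abs_le.1 (hD z)).2
  have l2 := bernExp_mono hmem (g := f) (f := fun _ => -D) fun z => (abs_le.1 (hD z)).1
  rw [bernExp_const] at l1 l2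
  exact abs_le.2 ⟨l2, l1⟩

/-- Given the weights, the in-degrees of two vertices are negatively correlated. -/
lemma IsWRT.integral_mul_inDegree_mul_le [IsProbabilityMeasure μ] (hG : IsWRT μ ν W parent)
    (hν : WeightLaw ν) (n : ℕ) {i j : ℕ} (hij : i ≠ j)
    {F : Ω → ℝ} (hF : Measurable[weightSigma W] F) {C : ℝ} (hC : ∀ᵐ ω ∂μ, |F ω| ≤ C)
    (hF0 : ∀ᵐ ω ∂μ, 0 ≤ F ω) {f g : ℕ → ℝ} (hf : Monotone f) (hg : Monotone g)
    {D : ℝ} (hD : ∀ z, |f z| ≤ D) {E : ℝ} (hE : ∀ z, |g z| ≤ E) :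
    ∫ ω, F ω * f (inDegree parent n i ω) * g (inDegree parent n j ω) ∂μ
      ≤ ∫ ω, F ω * bernExp (fun m => attachProb W i m ω) n f
          * bernExp (fun m => attachProb W j m ω) n g ∂μ := by
  have hpos := hG.ae_weight hν.pos
  -- At each step there are three disjoint outcomes: the new edge hits `i`, hits `j`, or hits
  -- neither. Their probabilities are absorbed into `F`.
  induction n generalizing F f g C with
  | zero => simp [inDegree_zero, bernExp]
  | succ n ih =>
    rcases Nat.eq_zero_or_pos n with rfl | hn
    · simp [inDegree_one, bernExp, attachProb]
    have hWp : weightSigma W ≤ past W parent n := le_sup_left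
    have hFp : Measurable[past W parent n] F := hF.mono hWp le_rfl
    have hmf : ∀ (i : ℕ) (f : ℕ → ℝ),
        Measurable[past W parent n] fun ω => f (inDegree parent n i ω) :=
      fun i f => (measurable_of_countable f).comp (measurable_inDegree W parent n i)
    have hX : ∀ f g : ℕ → ℝ, Measurable[past W parent n] fun ω =>
        F ω * f (inDegree parent n i ω) * g (inDegree parent n j ω) :=
      fun f g => (hFp.mul (hmf i f)).mul (hmf j g)
    have hbound : ∀ f g : ℕ → ℝ, (∀ z, |f z| ≤ D) → (∀ z, |g z| ≤ E) →
        ∀ᵐ ω ∂μ, |F ω * f (inDegree parent n i ω) * g (inDegree parent n j ω)| ≤ C * D * E := by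
      intro f g hD hE
      filter_upwards [hC] with ω hω
      rw [abs_mul, abs_mul]
      have hC0 := (abs_nonneg _).trans hω
      have hD0 := (abs_nonneg _).trans (hD 0)
      exact mul_le_mul (mul_le_mul hω (hD _) (abs_nonneg _) hC0) (hE _) (abs_nonneg _)
        (mul_nonneg hC0 hD0)
    have hI : ∀ f g : ℕ → ℝ, (∀ z, |f z| ≤ D) → (∀ z, |g z| ≤ E) →
        Integrable (fun ω => F ω * f (inDegree parent n i ω) * g (inDegree parent n j ω)) μ :=
      fun f g hD hE => hG.integrable_of_bound (hX f g) (hbound f g hD hE)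
    have hp1 : ∀ i, ∀ᵐ ω ∂μ, |attachProb W i n ω| ≤ 1 := by
      intro i
      filter_upwards [hpos] with ω hω
      have := attachProb_mem hω i n
      exact abs_le.2 ⟨by linarith, this.2⟩
    have hpm : ∀ i, AEStronglyMeasurable (attachProb W i n) μ := fun i =>
      ((measurable_attachProb W i n).mono hG.weightSigma_le le_rfl).aestronglyMeasurable
    have hIpar : ∀ (l : ℕ) (f g : ℕ → ℝ), (∀ z, |f z| ≤ D) → (∀ z, |g z| ≤ E) →
        Integrable (fun ω => F ω * f (inDegree parent n i ω) * g (inDegree parent n j ω)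
          * (if parent n ω = l then 1 else 0)) μ :=
      fun l f g hD hE => (hI f g hD hE).mul_bdd (c := 1) (Measurable.ite (hG.measurable_parent n hn
        (measurableSet_singleton l)) measurable_const measurable_const).aestronglyMeasurable
        (ae_of_all _ fun ω => by split_ifs <;> simp)
    have hIp : ∀ (l : ℕ) (f g : ℕ → ℝ), (∀ z, |f z| ≤ D) → (∀ z, |g z| ≤ E) →
        Integrable (fun ω => F ω * f (inDegree parent n i ω) * g (inDegree parent n j ω)
          * attachProb W l n ω) μ :=
      fun l f g hD hE => (hI f g hD hE).mul_bdd (c := 1) (hpm l) (hp1 l)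
    have key : ∀ (l : ℕ) (f g : ℕ → ℝ), (∀ z, |f z| ≤ D) → (∀ z, |g z| ≤ E) →
        ∫ ω, F ω * f (inDegree parent n i ω) * g (inDegree parent n j ω)
          * (if parent n ω = l then 1 else 0) ∂μ
        = ∫ ω, F ω * f (inDegree parent n i ω) * g (inDegree parent n j ω)
          * attachProb W l n ω ∂μ :=
      fun l f g hD hE => hG.integral_mul_parent hν l hn (hX f g) (hbound f g hD hE)
    have hD' : ∀ z, |f (z + 1)| ≤ D := fun z => hD (z + 1)
    have hE' : ∀ z, |g (z + 1)| ≤ E := fun z => hE (z + 1)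
    have hf' : Monotone fun z => f (z + 1) := fun a b hab => hf (by omega)
    have hg' : Monotone fun z => g (z + 1) := fun a b hab => hg (by omega)
    have hmul : ∀ {a : Ω → ℝ}, (∀ᵐ ω ∂μ, 0 ≤ a ω ∧ a ω ≤ 1) →
        (∀ᵐ ω ∂μ, |F ω * a ω| ≤ C) ∧ (∀ᵐ ω ∂μ, 0 ≤ F ω * a ω) := by
      intro a ha
      refine ⟨?_, ?_⟩
      · filter_upwards [hC, ha] with ω h1 h2
        rw [abs_mul, abs_of_nonneg h2.1]
        exact (mul_le_of_le_one_right (abs_nonneg _) h2.2).trans h1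
      · filter_upwards [hF0, ha] with ω h1 h2
        exact mul_nonneg h1 h2.1
    have ha0 : ∀ᵐ ω ∂μ, 0 ≤ 1 - attachProb W i n ω - attachProb W j n ω
        ∧ 1 - attachProb W i n ω - attachProb W j n ω ≤ 1 := by
      filter_upwards [hpos] with ω hω
      have h1 := attachProb_mem hω i n
      have h2 := attachProb_mem hω j n
      have h3 := attachProb_add_le_one hω hij n
      constructor <;> linarith
    have hap : ∀ l, ∀ᵐ ω ∂μ, 0 ≤ attachProb W l n ω ∧ attachProb W l n ω ≤ 1 := fun l => by
      filter_upwards [hpos] with ω hω using attachProb_mem hω l n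
    have hpi := measurable_attachProb W i n
    have hpj := measurable_attachProb W j n
    have m0 : Measurable[weightSigma W] fun ω =>
        F ω * (1 - attachProb W i n ω - attachProb W j n ω) :=
      Measurable.mul hF (Measurable.sub (Measurable.sub measurable_const hpi) hpj)
    have m1 : Measurable[weightSigma W] fun ω => F ω * attachProb W i n ω := Measurable.mul hF hpi
    have m2 : Measurable[weightSigma W] fun ω => F ω * attachProb W j n ω := Measurable.mul hF hpj
    have i0 := ih m0 (hmul ha0).1 (hmul ha0).2 hf hg hD hE
    have i1 := ih m1 (hmul (hap i)).1 (hmul (hap i)).2 hf' hg hD' hE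
    have i2 := ih m2 (hmul (hap j)).1 (hmul (hap j)).2 hf hg' hD hE'
    have hFint : ∀ {G : Ω → ℝ}, Measurable[weightSigma W] G → (∀ᵐ ω ∂μ, |G ω| ≤ C) →
        Integrable G μ := fun hG' hb => Integrable.of_bound
      (hG'.mono hG.weightSigma_le le_rfl).aestronglyMeasurable C hb
    have hB : ∀ {G : Ω → ℝ} {f g : ℕ → ℝ}, Integrable G μ → (∀ z, |f z| ≤ D) →
        (∀ z, |g z| ≤ E) → ∀ n n', Integrable (fun ω =>
        G ω * bernExp (fun m => attachProb W i m ω) n f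
          * bernExp (fun m => attachProb W j m ω) n' g) μ := fun hG' hD hE n n' =>
      hG.integrable_mul_bernExp hν n' j (hG.integrable_mul_bernExp hν n i hG' hD) hE
    have hJ0 := hFint m0 (hmul ha0).1
    have hJ1 := hFint m1 (hmul (hap i)).1
    have hJ2 := hFint m2 (hmul (hap j)).1
    calc ∫ ω, F ω * f (inDegree parent (n + 1) i ω) * g (inDegree parent (n + 1) j ω) ∂μ
        = ∫ ω, (F ω * f (inDegree parent n i ω) * g (inDegree parent n j ω)
            - F ω * f (inDegree parent n i ω) * g (inDegree parent n j ω)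
              * (if parent n ω = i then 1 else 0)
            - F ω * f (inDegree parent n i ω) * g (inDegree parent n j ω)
              * (if parent n ω = j then 1 else 0)
            + F ω * f (inDegree parent n i ω + 1) * g (inDegree parent n j ω)
              * (if parent n ω = i then 1 else 0)
            + F ω * f (inDegree parent n i ω) * g (inDegree parent n j ω + 1)
              * (if parent n ω = j then 1 else 0)) ∂μ := by
          congr 1; funext ω
          rw [inDegree_succ parent hn, inDegree_succ parent hn]
          by_cases h1 : parent n ω = i
          · simp [h1, hij]
          · by_cases h2 : parent n ω = j
            · simp [h2, hij.symm]
            · simp [h1, h2]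
      _ = ∫ ω, (F ω * f (inDegree parent n i ω) * g (inDegree parent n j ω)
            - F ω * f (inDegree parent n i ω) * g (inDegree parent n j ω) * attachProb W i n ω
            - F ω * f (inDegree parent n i ω) * g (inDegree parent n j ω) * attachProb W j n ω
            + F ω * f (inDegree parent n i ω + 1) * g (inDegree parent n j ω) * attachProb W i n ω
            + F ω * f (inDegree parent n i ω) * g (inDegree parent n j ω + 1)
              * attachProb W j n ω) ∂μ := by
          have A0 := hI f g hD hE
          have A1 := hIpar i f g hD hE
          have A2 := hIpar j f g hD hE
          have A3 := hIpar i _ g hD' hE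
          have A4 := hIpar j f _ hD hE'
          have B1 := hIp i f g hD hE
          have B2 := hIp j f g hD hE
          have B3 := hIp i _ g hD' hE
          have B4 := hIp j f _ hD hE'
          rw [integral_sub_sub_add_add A0 A1 A2 A3 A4, integral_sub_sub_add_add A0 B1 B2 B3 B4,
            key i f g hD hE, key j f g hD hE, key i _ g hD' hE, key j f _ hD hE']
      _ = ∫ ω, F ω * (1 - attachProb W i n ω - attachProb W j n ω)
            * f (inDegree parent n i ω) * g (inDegree parent n j ω) ∂μ
          + ∫ ω, F ω * attachProb W i n ω
            * f (inDegree parent n i ω + 1) * g (inDegree parent n j ω) ∂μ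
          + ∫ ω, F ω * attachProb W j n ω
            * f (inDegree parent n i ω) * g (inDegree parent n j ω + 1) ∂μ := by
          have A0 := hI f g hD hE
          have B1 := hIp i f g hD hE
          have B2 := hIp j f g hD hE
          have B3 : Integrable (fun ω => F ω * attachProb W i n ω
              * f (inDegree parent n i ω + 1) * g (inDegree parent n j ω)) μ :=
            (hIp i _ g hD' hE).congr (ae_of_all _ fun ω => by ring)
          have B4 : Integrable (fun ω => F ω * attachProb W j n ω
              * f (inDegree parent n i ω) * g (inDegree parent n j ω + 1)) μ :=
            (hIp j f _ hD hE').congr (ae_of_all _ fun ω => by ring)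
          have B0 : Integrable (fun ω => F ω * (1 - attachProb W i n ω - attachProb W j n ω)
              * f (inDegree parent n i ω) * g (inDegree parent n j ω)) μ :=
            ((A0.sub B1).sub B2).congr (ae_of_all _ fun ω => by
              simp only [Pi.sub_apply]; ring)
          rw [← integral_add_add B0 B3 B4]
          congr 1; funext ω; ring
      _ ≤ _ := add_le_add (add_le_add i0 i1) i2
      _ ≤ _ := by
          rw [← integral_add_add (hB hJ0 hD hE n n) (hB hJ1 hD' hE n n) (hB hJ2 hD hE' n n)]
          refine integral_mono_ae (((hB hJ0 hD hE n n).add (hB hJ1 hD' hE n n)).add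
            (hB hJ2 hD hE' n n)) (hB (hFint hF hC) hD hE (n + 1) (n + 1)) ?_
          filter_upwards [hpos, hF0] with ω hω hF0
          have b1 := sub_nonneg.2 (bernExp_le_shift (n := n)
            (fun m _ => attachProb_mem hω i m) hf)
          have b2 := sub_nonneg.2 (bernExp_le_shift (n := n)
            (fun m _ => attachProb_mem hω j m) hg)
          -- Two independent Bernoulli steps exceed the three-outcome step by `p_i p_j` times the
          -- product of the increments of the two expectations. Both increments are nonnegative by
          -- monotonicity. This is the gain from the impossibility of one edge hitting both
          -- vertices.
          have b3 := mul_nonneg hF0 (mul_nonneg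
            (mul_nonneg (attachProb_mem hω i n).1 (attachProb_mem hω j n).1) (mul_nonneg b1 b2))
          simp only [bernExp]
          linarith [b3]

end WRT

/-! ### First moment bound for the maximum. -/

namespace WRT

lemma sum_inv_le (n : ℕ) (hn : 1 ≤ n) : ∑ m ∈ Finset.range n, (m : ℝ)⁻¹ ≤ 1 + Real.log n := by
  obtain ⟨n, rfl⟩ : ∃ l, n = l + 1 := ⟨n - 1, by omega⟩
  -- The term `m = 0` is split off; it is zero by the convention `0⁻¹ = 0`.
  rw [Finset.sum_range_succ']
  have h := harmonic_le_one_add_log n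
  have h1 : Real.log n ≤ Real.log (n + 1 : ℕ) := by
    rcases Nat.eq_zero_or_pos n with rfl | h0
    · simp
    · exact Real.log_le_log (by exact_mod_cast h0) (by push_cast; linarith)
  simp only [harmonic, Rat.cast_sum, Rat.cast_inv, Rat.cast_natCast] at h
  simp only [Nat.cast_zero, inv_zero, add_zero]
  linarith

/-- Before `K` only `p m ≤ 1` is available and each factor costs `x`. From `K` on, `1 + u ≤ exp u`
turns the product into a harmonic sum. -/
lemma prod_one_add_le {x c : ℝ} (hx : 1 ≤ x) (hc : 0 ≤ c) {p : ℕ → ℝ} {K n : ℕ} (hn : 1 ≤ n)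
    (hp : ∀ m < n, 0 ≤ p m ∧ p m ≤ 1) (hK : ∀ m < n, K ≤ m → p m ≤ c / m) :
    ∏ m ∈ Finset.range n, (1 + (x - 1) * p m)
      ≤ x ^ K * Real.exp ((x - 1) * c * (1 + Real.log n)) := by
  have hx1 : 0 ≤ x - 1 := by linarith
  calc ∏ m ∈ Finset.range n, (1 + (x - 1) * p m)
      ≤ ∏ m ∈ Finset.range n, ((if m < K then x else 1) * Real.exp ((x - 1) * c * (m : ℝ)⁻¹)) := by
        refine Finset.prod_le_prod (fun m hm => ?_) fun m hm => ?_
        · have := mul_nonneg hx1 (hp m (Finset.mem_range.1 hm)).1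
          linarith
        · have hpm := hp m (Finset.mem_range.1 hm)
          split_ifs with h
          · have h1 : 1 ≤ Real.exp ((x - 1) * c * (m : ℝ)⁻¹) := Real.one_le_exp (by positivity)
            have h2 : (x - 1) * p m ≤ x - 1 := mul_le_of_le_one_right hx1 hpm.2
            nlinarith
          · rw [one_mul]
            have h1 := mul_le_mul_of_nonneg_left (hK m (Finset.mem_range.1 hm) (not_lt.1 h)) hx1
            have h2 := Real.add_one_le_exp ((x - 1) * c * (m : ℝ)⁻¹)
            rw [div_eq_mul_inv, ← mul_assoc] at h1
            linarith
    _ = x ^ ((Finset.range n).filter (· < K)).card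
          * Real.exp ((x - 1) * c * ∑ m ∈ Finset.range n, (m : ℝ)⁻¹) := by
        rw [Finset.prod_mul_distrib, Finset.prod_ite, Finset.prod_const, Finset.prod_const_one,
          mul_one, ← Real.exp_sum, Finset.mul_sum]
    _ ≤ _ := by
        have hcard : ((Finset.range n).filter (· < K)).card ≤ K := by
          calc _ ≤ (Finset.range K).card := Finset.card_le_card fun m hm => by
                simp only [Finset.mem_filter, Finset.mem_range] at hm ⊢; exact hm.2
            _ = K := Finset.card_range K
        have h3 := sum_inv_le n hn
        gcongr

lemma measurable_bernExp_linRate (c : ℝ) (i n : ℕ) (f : ℕ → ℝ) :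
    Measurable fun w : ℝ => bernExp (linRate (w * c) i) n f := by
  induction n generalizing f with
  | zero => exact measurable_const
  | succ n ih =>
    have h : Measurable fun w : ℝ => linRate (w * c) i n := by
      unfold linRate
      split_ifs <;> fun_prop
    simp only [bernExp]
    exact ((measurable_const.sub h).mul (ih f)).add (h.mul (ih fun z => f (z + 1)))

lemma le_maxInDegree_iff {Ω : Type*} {parent : ℕ → Ω → ℕ} {n k : ℕ} (hn : 1 ≤ n) (ω : Ω) :
    k ≤ maxInDegree parent n ω ↔ ∃ i < n, k ≤ inDegree parent n i ω := by
  constructor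
  · intro h
    obtain ⟨i, hi, hs⟩ := Finset.exists_mem_eq_sup (Finset.range n) ⟨0, Finset.mem_range.2 hn⟩
      fun i => inDegree parent n i ω
    exact ⟨i, Finset.mem_range.1 hi, h.trans_eq hs⟩
  · rintro ⟨i, hi, h⟩
    exact h.trans (Finset.le_sup (f := fun i => inDegree parent n i ω) (Finset.mem_range.2 hi))

variable {Ω : Type*} [mΩ : MeasurableSpace Ω] {μ : Measure Ω} {ν : Measure ℝ} {W : ℕ → Ω → ℝ}
  {parent : ℕ → Ω → ℕ}

lemma WeightLaw.ae_mem {ν : Measure ℝ} (hν : WeightLaw ν) : ∀ᵐ w ∂ν, 0 < w ∧ w ≤ 1 := by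
  filter_upwards [hν.pos, hν.ae_le_one] with w h1 h2 using ⟨h1, h2⟩

lemma linRate_weight_mem {c : ℝ} {a i : ℕ} {w : ℝ} (hc : 0 ≤ c) (hca : c ≤ a) (hi : a ≤ i)
    (hw : 0 < w ∧ w ≤ 1) (m : ℕ) : 0 ≤ linRate (w * c) i m ∧ linRate (w * c) i m ≤ 1 := by
  have h1 : w * c ≤ c := mul_le_of_le_one_left hc hw.2
  have h2 : (a : ℝ) ≤ i := by exact_mod_cast hi
  exact linRate_mem (mul_nonneg hw.1.le hc) (by linarith) m

lemma WeightLaw.integrable_bernExp_linRate (hν : WeightLaw ν) {c : ℝ} {a i : ℕ} (hc : 0 ≤ c)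
    (hca : c ≤ a) (hi : a ≤ i) (n k : ℕ) :
    Integrable (fun w : ℝ => bernExp (linRate (w * c) i) n (tailInd k)) ν := by
  have := hν.isProbabilityMeasure
  refine Integrable.of_bound (measurable_bernExp_linRate c i n _).aestronglyMeasurable 1 ?_
  filter_upwards [hν.ae_mem] with w hw
  have hm := fun m (_ : m < n) => linRate_weight_mem hc hca hi hw m
  rw [Real.norm_eq_abs, abs_of_nonneg (bernExp_tailInd_nonneg hm k)]
  exact bernExp_tailInd_le_one hm k

lemma WeightLaw.integrable_pow (hν : WeightLaw ν) {c : ℝ} (hc : 0 ≤ c) (k : ℕ) :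
    Integrable (fun w : ℝ => (w * c / (1 + w * c)) ^ k) ν := by
  have := hν.isProbabilityMeasure
  refine Integrable.of_bound (Measurable.aestronglyMeasurable (by fun_prop)) 1 ?_
  filter_upwards [hν.ae_mem] with w hw
  have h1 : 0 ≤ w * c := mul_nonneg hw.1.le hc
  have h2 : 0 ≤ w * c / (1 + w * c) := by positivity
  rw [Real.norm_eq_abs, abs_of_nonneg (by positivity)]
  exact pow_le_one₀ h2 ((div_le_one (by positivity)).2 (by linarith))

lemma WeightLaw.integral_linCount (hν : WeightLaw ν) {c : ℝ} {a : ℕ} (hc : 0 ≤ c)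
    (hca : c ≤ a) (n k : ℕ) :
    ∑ i ∈ Finset.Ico a n, ∫ w, bernExp (linRate (w * c) i) n (tailInd k) ∂ν
      = ∫ w, linCount (w * c) a n k ∂ν := by
  unfold linCount
  rw [integral_finsetSum]
  intro i hi
  exact hν.integrable_bernExp_linRate hc hca (Finset.mem_Ico.1 hi).1 n k

lemma WeightLaw.integrable_linCount (hν : WeightLaw ν) {c : ℝ} {a : ℕ} (hc : 0 ≤ c)
    (hca : c ≤ a) (n k : ℕ) : Integrable (fun w => linCount (w * c) a n k) ν :=
  integrable_finsetSum _ fun _ hi =>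
    hν.integrable_bernExp_linRate hc hca (Finset.mem_Ico.1 hi).1 n k

lemma WeightLaw.integral_linCount_le (hν : WeightLaw ν) {c : ℝ} {a : ℕ} (hc : 0 ≤ c)
    (hca : c ≤ a) (ha : 1 ≤ a) {n : ℕ} (han : a ≤ n) (k : ℕ) :
    ∫ w, linCount (w * c) a n k ∂ν ≤ n * ∫ w, (w * c / (1 + w * c)) ^ k ∂ν := by
  rw [← integral_const_mul]
  refine integral_mono_ae (hν.integrable_linCount hc hca n k)
    ((hν.integrable_pow hc k).const_mul _) ?_
  filter_upwards [hν.ae_mem] with w hw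
  exact linCount_le (mul_nonneg hw.1.le hc) ((mul_le_of_le_one_left hc hw.2).trans hca) ha han k

/-- The error term of `le_linCount` is increasing in the rate, so its value at weight one bounds it
for all weights. -/
lemma WeightLaw.le_integral_linCount (hν : WeightLaw ν) {c x : ℝ} {a : ℕ} (hc : 0 ≤ c)
    (hca : c ≤ a) (ha : 1 ≤ a) (hx : 1 ≤ x) (hxc : c / (1 + c) ≤ x⁻¹) {n : ℕ} (han : a ≤ n)
    (k : ℕ) :
    n * ∫ w, (w * c / (1 + w * c)) ^ k ∂ν
        - a * x⁻¹ ^ k * Real.exp ((x - 1) * c * (1 + Real.log n))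
      ≤ ∫ w, linCount (w * c) a n k ∂ν := by
  have := hν.isProbabilityMeasure
  set R := a * x⁻¹ ^ k * Real.exp ((x - 1) * c * (1 + Real.log n)) with hR
  have h1 : ∫ w, (n * (w * c / (1 + w * c)) ^ k - R) ∂ν
      = n * ∫ w, (w * c / (1 + w * c)) ^ k ∂ν - R := by
    rw [integral_sub ((hν.integrable_pow hc k).const_mul _) (integrable_const _),
      integral_const_mul]
    simp
  rw [← h1]
  refine integral_mono_ae (((hν.integrable_pow hc k).const_mul _).sub (integrable_const _))
    (hν.integrable_linCount hc hca n k) ?_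
  filter_upwards [hν.ae_mem] with w hw
  have hr : 0 ≤ w * c := mul_nonneg hw.1.le hc
  have hrc : w * c ≤ c := mul_le_of_le_one_left hc hw.2
  have hq : w * c / (1 + w * c) ≤ x⁻¹ := by
    refine le_trans ?_ hxc
    rw [div_le_div_iff₀ (by positivity) (by positivity)]
    nlinarith
  have h2 := le_linCount hr (hrc.trans hca) ha hx hq han k
  refine le_trans ?_ h2
  have hx1 : 0 ≤ x - 1 := by linarith
  have h3 : ∏ m ∈ Finset.Ico a n, (1 + (x - 1) * (w * c / m))
      ≤ Real.exp ((x - 1) * c * (1 + Real.log n)) := by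
    calc ∏ m ∈ Finset.Ico a n, (1 + (x - 1) * (w * c / m))
        ≤ ∏ m ∈ Finset.Ico a n, Real.exp ((x - 1) * c * (m : ℝ)⁻¹) := by
          refine Finset.prod_le_prod (fun m _ => by positivity) fun m _ => ?_
          have h4 := Real.add_one_le_exp ((x - 1) * c * (m : ℝ)⁻¹)
          have h5 : (x - 1) * (w * c / m) ≤ (x - 1) * c * (m : ℝ)⁻¹ := by
            calc (x - 1) * (w * c / m) ≤ (x - 1) * (c / m) := by gcongr
              _ = _ := by rw [div_eq_mul_inv, mul_assoc]
          linarith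
      _ = Real.exp ((x - 1) * c * ∑ m ∈ Finset.Ico a n, (m : ℝ)⁻¹) := by
          rw [← Real.exp_sum, Finset.mul_sum]
      _ ≤ _ := by
          have h6 : ∑ m ∈ Finset.Ico a n, (m : ℝ)⁻¹ ≤ ∑ m ∈ Finset.range n, (m : ℝ)⁻¹ :=
            Finset.sum_le_sum_of_subset_of_nonneg (fun m hm => by
              simp only [Finset.mem_Ico, Finset.mem_range] at hm ⊢; exact hm.2)
              fun m _ _ => by positivity
          have h7 := sum_inv_le n (ha.trans han)
          have h8 := h6.trans h7
          gcongr
  have h4 : (a : ℝ) * x⁻¹ ^ k * ∏ m ∈ Finset.Ico a n, (1 + (x - 1) * (w * c / m)) ≤ R := by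
    rw [hR]
    gcongr
  linarith

lemma IsWRT.measurable_inDegree (hG : IsWRT μ ν W parent) (n i : ℕ) :
    Measurable (inDegree parent n i) :=
  (WRT.measurable_inDegree W parent n i).mono (hG.past_le n) le_rfl

lemma IsWRT.measurable_maxInDegree (hG : IsWRT μ ν W parent) (n : ℕ) :
    Measurable (maxInDegree parent n) := by
  have h : ∀ l, Measurable fun ω => (Finset.range l).sup fun i => inDegree parent n i ω := by
    intro l
    induction l with
    | zero => simp
    | succ l ih =>
      simp only [Finset.range_add_one, Finset.sup_insert]
      exact (hG.measurable_inDegree n l).sup ih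
  exact h n

lemma IsWRT.integral_comp_weight (hG : IsWRT μ ν W parent) (i : ℕ) {h : ℝ → ℝ}
    (hh : Measurable h) : ∫ ω, h (W i ω) ∂μ = ∫ w, h w ∂ν := by
  rw [← hG.law_weight i, integral_map (hG.measurable_weight i).aemeasurable
    hh.aestronglyMeasurable]

/-- First moment bound for the maximum in-degree. -/
lemma IsWRT.measure_le_maxInDegree_le [IsProbabilityMeasure μ] (hG : IsWRT μ ν W parent)
    (hν : WeightLaw ν) {G : Set Ω} (hGm : MeasurableSet[weightSigma W] G) {b c x : ℝ}
    {a n K : ℕ} (k : ℕ) (hb : 0 < b) (hc : 0 < c) (hx : 1 ≤ x) (hca : c⁻¹ ≤ a) (ha : 1 ≤ a)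
    (han : a ≤ n) (hGK : ∀ ω ∈ G, ∀ m < n, K ≤ m → b * m ≤ ∑ j ∈ Finset.range m, W j ω)
    (hGa : ∀ ω ∈ G, ∀ m < n, a ≤ m → c * m ≤ ∑ j ∈ Finset.range m, W j ω) :
    μ.real (G ∩ {ω | k ≤ maxInDegree parent n ω})
      ≤ a * (x⁻¹ ^ k * (x ^ K * Real.exp ((x - 1) * b⁻¹ * (1 + Real.log n))))
        + n * ∫ w, (w * c⁻¹ / (1 + w * c⁻¹)) ^ k ∂ν := by
  have hn : 1 ≤ n := ha.trans han
  have hGM : MeasurableSet G := hG.weightSigma_le _ hGm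
  have hmem := hG.ae_weight hν.ae_mem
  have hc' : 0 ≤ c⁻¹ := by positivity
  -- `G` depends on the weights only, so its indicator is an admissible factor in the conditional
  -- formulas.
  set F : Ω → ℝ := G.indicator fun _ => 1 with hF
  have hFm : Measurable[weightSigma W] F := Measurable.indicator measurable_const hGm
  have hF0 : ∀ ω, 0 ≤ F ω := fun ω => Set.indicator_nonneg (fun _ _ => zero_le_one) ω
  have hF1 : ∀ ω, F ω ≤ 1 := fun ω => Set.indicator_le_self' (fun _ _ => zero_le_one) ω
  have hFb : ∀ᵐ ω ∂μ, |F ω| ≤ 1 := ae_of_all _ fun ω => by rw [abs_of_nonneg (hF0 ω)]; exact hF1 ω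
  have hFi : Integrable F μ := (integrable_const (1 : ℝ)).indicator hGM
  have htail : ∀ z, |tailInd k z| ≤ 1 := fun z => by
    rw [abs_of_nonneg (tailInd_nonneg k z)]; exact tailInd_le_one k z
  have hi1 : ∀ i, Integrable (fun ω => F ω * tailInd k (inDegree parent n i ω)) μ := fun i =>
    hFi.mul_bdd (c := 1) ((measurable_of_countable (tailInd k)).comp
      (hG.measurable_inDegree n i)).aestronglyMeasurable (ae_of_all _ fun ω => htail _)
  have hA : MeasurableSet (G ∩ {ω | k ≤ maxInDegree parent n ω}) :=
    hGM.inter (measurableSet_le measurable_const (hG.measurable_maxInDegree n))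
  have hunion : μ.real (G ∩ {ω | k ≤ maxInDegree parent n ω})
      ≤ ∑ i ∈ Finset.range n, ∫ ω, F ω * tailInd k (inDegree parent n i ω) ∂μ := by
    rw [← integral_finsetSum _ fun i _ => hi1 i, ← integral_indicator_one hA]
    refine integral_mono ((integrable_const _).indicator hA)
      (integrable_finsetSum _ fun i _ => hi1 i) fun ω => ?_
    have hnn : ∀ i ∈ Finset.range n, 0 ≤ F ω * tailInd k (inDegree parent n i ω) := fun i _ =>
      mul_nonneg (hF0 ω) (tailInd_nonneg _ _)
    by_cases hω : ω ∈ G ∩ {ω | k ≤ maxInDegree parent n ω}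
    · rw [Set.indicator_of_mem hω]
      obtain ⟨i, hi, hk⟩ := (le_maxInDegree_iff hn ω).1 hω.2
      refine le_trans ?_ (Finset.single_le_sum hnn (Finset.mem_range.2 hi))
      simp [hF, hω.1, tailInd, hk]
    · rw [Set.indicator_of_notMem hω]
      exact Finset.sum_nonneg hnn
  refine hunion.trans ?_
  have hint : ∀ i, ∫ ω, F ω * tailInd k (inDegree parent n i ω) ∂μ
      = ∫ ω, F ω * bernExp (fun m => attachProb W i m ω) n (tailInd k) ∂μ := fun i =>
    hG.integral_mul_inDegree hν n i hFm hFb htail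
  have hi2 : ∀ i, Integrable (fun ω =>
      F ω * bernExp (fun m => attachProb W i m ω) n (tailInd k)) μ := fun i =>
    hG.integrable_mul_bernExp hν n i hFi htail
  rw [← Finset.sum_range_add_sum_Ico _ han]
  refine add_le_add ?_ ?_
  -- Vertices below `a`: a crude Chernoff bound, with rates at most `1 / (b m)` from time `K` on.
  · set Q := x⁻¹ ^ k * (x ^ K * Real.exp ((x - 1) * b⁻¹ * (1 + Real.log n))) with hQ
    have hQ0 : 0 ≤ Q := by positivity
    have : ∀ i ∈ Finset.range a, ∫ ω, F ω * tailInd k (inDegree parent n i ω) ∂μ ≤ Q := by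
      intro i _
      rw [hint]
      have : ∫ _, Q ∂μ = Q := by simp
      rw [← this]
      refine integral_mono_ae (hi2 i) (integrable_const _) ?_
      filter_upwards [hmem] with ω hω
      by_cases hωG : ω ∈ G
      · simp only [hF, Set.indicator_of_mem hωG, one_mul]
        have hp := fun m (_ : m < n) => attachProb_mem (fun i => (hω i).1) i m
        refine (bernExp_tailInd_le hp hx k).trans ?_
        rw [hQ]
        refine mul_le_mul_of_nonneg_left ?_ (by positivity)
        refine prod_one_add_le hx (by positivity) hn hp fun m hm hKm => ?_
        unfold attachProb
        split_ifs with him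
        · have hm0 : (0 : ℝ) < m := by exact_mod_cast (by omega : 0 < m)
          have := hGK ω hωG m hm hKm
          calc W i ω / ∑ j ∈ Finset.range m, W j ω ≤ 1 / (b * m) :=
                div_le_div₀ zero_le_one (hω i).2 (by positivity) this
            _ = b⁻¹ / m := by rw [one_div, mul_inv, div_eq_mul_inv]
        · positivity
      · simp only [hF, Set.indicator_of_notMem hωG, zero_mul]
        exact hQ0
    calc _ ≤ ∑ i ∈ Finset.range a, Q := Finset.sum_le_sum this
      _ = _ := by rw [Finset.sum_const, Finset.card_range, nsmul_eq_mul]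
  -- Vertices from `a` on: on `G` the rate is at most `W_i / (c m)`, a linear rate that depends on
  -- the single weight `W_i`.
  · refine le_trans ?_ (hν.integral_linCount_le hc' hca ha han k)
    rw [← hν.integral_linCount hc' hca]
    refine Finset.sum_le_sum fun i hi => ?_
    obtain ⟨hai, hin⟩ := Finset.mem_Ico.1 hi
    rw [hint, ← hG.integral_comp_weight i (measurable_bernExp_linRate c⁻¹ i n _)]
    have hint : Integrable (fun ω => bernExp (linRate (W i ω * c⁻¹) i) n (tailInd k)) μ := by
      have h := hν.integrable_bernExp_linRate hc' hca hai n k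
      rw [← hG.law_weight i] at h
      exact h.comp_measurable (hG.measurable_weight i)
    refine integral_mono_ae (hi2 i) hint ?_
    filter_upwards [hmem] with ω hω
    have hl := linRate_weight_mem hc' hca hai (hω i)
    by_cases hωG : ω ∈ G
    · simp only [hF, Set.indicator_of_mem hωG, one_mul]
      refine bernExp_mono_prob (fun m _ => (attachProb_mem (fun i => (hω i).1) i m).1)
        (fun m hm => ?_) (fun m _ => (hl m).2) (tailInd_mono k)
      unfold attachProb linRate
      split_ifs with him
      · have hm0 : (0 : ℝ) < m := by exact_mod_cast (by omega : 0 < m)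
        have := hGa ω hωG m hm (by omega)
        calc W i ω / ∑ j ∈ Finset.range m, W j ω ≤ W i ω / (c * m) :=
              div_le_div_of_nonneg_left (hω i).1.le (by positivity) this
          _ = W i ω * c⁻¹ / m := by field_simp
      · exact le_rfl
    · simp only [hF, Set.indicator_of_notMem hωG, zero_mul]
      exact bernExp_tailInd_nonneg (fun m _ => hl m) k

end WRT

/-! ### Second moment bound for the maximum. -/

namespace WRT

variable {Ω : Type*} [mΩ : MeasurableSpace Ω] {μ : Measure Ω} {ν : Measure ℝ} {W : ℕ → Ω → ℝ}
  {parent : ℕ → Ω → ℕ}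

/-- Chebyshev's inequality for a sum of independent `[0, 1]`-valued variables. -/
lemma measure_sum_le_half_le [IsProbabilityMeasure μ] {X : ℕ → Ω → ℝ} (s : Finset ℕ)
    (hX : ∀ i ∈ s, Measurable (X i)) (h01 : ∀ i ∈ s, ∀ᵐ ω ∂μ, 0 ≤ X i ω ∧ X i ω ≤ 1)
    (hind : Set.Pairwise (s : Set ℕ) fun i j => X i ⟂ᵢ[μ] X j) {M : ℝ}
    (hM : ∑ i ∈ s, ∫ ω, X i ω ∂μ = M) (hM0 : 0 < M) :
    μ.real {ω | ∑ i ∈ s, X i ω ≤ M / 2} ≤ 4 / M := by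
  have hint : ∀ i ∈ s, Integrable (X i) μ := fun i hi =>
    Integrable.of_bound (hX i hi).aestronglyMeasurable 1 (by
      filter_upwards [h01 i hi] with ω hω
      rw [Real.norm_eq_abs, abs_of_nonneg hω.1]; exact hω.2)
  have hL2 : ∀ i ∈ s, MemLp (X i) 2 μ := fun i hi =>
    MemLp.of_bound (hX i hi).aestronglyMeasurable 1 (by
      filter_upwards [h01 i hi] with ω hω
      rw [Real.norm_eq_abs, abs_of_nonneg hω.1]; exact hω.2)
  have hsum : MemLp (∑ i ∈ s, X i) 2 μ := memLp_finsetSum' _ hL2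
  -- The variance is additive by pairwise independence, and each variance is at most the mean
  -- because `X ^ 2 ≤ X` on `[0, 1]`.
  have hvar : variance (∑ i ∈ s, X i) μ ≤ M := by
    rw [IndepFun.variance_sum hL2 hind, ← hM]
    refine Finset.sum_le_sum fun i hi => ?_
    refine (variance_le_expectation_sq (hX i hi).aestronglyMeasurable).trans ?_
    refine integral_mono_ae ((hL2 i hi).integrable_sq) (hint i hi) ?_
    filter_upwards [h01 i hi] with ω hω
    simp only [Pi.pow_apply]
    nlinarith [hω.1, hω.2]
  have hE : ∫ ω, (∑ i ∈ s, X i) ω ∂μ = M := by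
    simp only [Finset.sum_apply]
    rw [integral_finsetSum _ hint, hM]
  have hcheb := meas_ge_le_variance_div_sq hsum (half_pos hM0)
  rw [hE] at hcheb
  have h1 : μ {ω | ∑ i ∈ s, X i ω ≤ M / 2} ≤ ENNReal.ofReal (4 / M) := by
    calc μ {ω | ∑ i ∈ s, X i ω ≤ M / 2} ≤ μ {ω | M / 2 ≤ |(∑ i ∈ s, X i) ω - M|} := by
          refine measure_mono fun ω hω => ?_
          simp only [Set.mem_ofPred_eq, Finset.sum_apply] at hω ⊢
          rw [abs_sub_comm]
          exact le_trans (by linarith) (le_abs_self _)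
      _ ≤ _ := hcheb
      _ ≤ ENNReal.ofReal (4 / M) := by
          refine ENNReal.ofReal_le_ofReal ?_
          calc variance (∑ i ∈ s, X i) μ / (M / 2) ^ 2 ≤ M / (M / 2) ^ 2 := by gcongr
            _ = 4 / M := by field_simp; norm_num
  exact ENNReal.toReal_le_of_le_ofReal (by positivity) h1

/-- Conditional second moment bound for the maximum in-degree. -/
lemma IsWRT.measure_maxInDegree_lt_le_of_le [IsProbabilityMeasure μ] (hG : IsWRT μ ν W parent)
    (hν : WeightLaw ν) {H : Set Ω} (hHm : MeasurableSet[weightSigma W] H) {n : ℕ} (k : ℕ)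
    {s : Finset ℕ} (hs : ∀ i ∈ s, i < n) {M : ℝ} (hM : 0 < M)
    (hH : ∀ᵐ ω ∂μ, ω ∈ H →
      M ≤ ∑ i ∈ s, bernExp (fun m => attachProb W i m ω) n (tailInd k)) :
    μ.real (H ∩ {ω | maxInDegree parent n ω < k}) ≤ 1 / M := by
  have hHM : MeasurableSet H := hG.weightSigma_le _ hHm
  have hpos := hG.ae_weight hν.pos
  set u : ℕ → Ω → ℝ := fun i ω => bernExp (fun m => attachProb W i m ω) n (tailInd k) with hu
  set X : ℕ → Ω → ℝ := fun i ω => tailInd k (inDegree parent n i ω) with hXdef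
  set U : Ω → ℝ := fun ω => ∑ i ∈ s, u i ω with hU
  have hum : ∀ i, Measurable[weightSigma W] (u i) := fun i => measurable_bernExp_attachProb W i n _
  have hUm : Measurable[weightSigma W] U := Finset.measurable_fun_sum _ fun i _ => hum i
  have hu01 : ∀ᵐ ω ∂μ, ∀ i, 0 ≤ u i ω ∧ u i ω ≤ 1 := by
    filter_upwards [hpos] with ω hω i
    have hp := fun m (_ : m < n) => attachProb_mem hω i m
    exact ⟨bernExp_tailInd_nonneg hp k, bernExp_tailInd_le_one hp k⟩
  have hUb : ∀ᵐ ω ∂μ, 0 ≤ U ω ∧ U ω ≤ s.card := by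
    filter_upwards [hu01] with ω hω
    refine ⟨Finset.sum_nonneg fun i _ => (hω i).1, ?_⟩
    calc U ω ≤ ∑ i ∈ s, (1 : ℝ) := Finset.sum_le_sum fun i _ => (hω i).2
      _ = s.card := by simp
  have hXm : ∀ i, Measurable (X i) := fun i =>
    (measurable_of_countable (tailInd k)).comp (hG.measurable_inDegree n i)
  have hX01 : ∀ i ω, 0 ≤ X i ω ∧ X i ω ≤ 1 := fun i ω => ⟨tailInd_nonneg _ _, tailInd_le_one _ _⟩
  have htail : ∀ z, |tailInd k z| ≤ 1 := fun z => by
    rw [abs_of_nonneg (tailInd_nonneg k z)]; exact tailInd_le_one k z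
  -- This factor carries out a conditional Chebyshev inequality inside one integral: with `N` the
  -- number of vertices in `s` of in-degree at least `k`, `F (N - U) ^ 2 = 1` on `H` whenever `N =
  -- 0`.
  set F : Ω → ℝ := H.indicator fun ω => (U ω ^ 2)⁻¹ with hF
  have hFm : Measurable[weightSigma W] F :=
    Measurable.indicator (Measurable.inv (Measurable.pow_const hUm 2)) hHm
  have hF0 : ∀ ω, 0 ≤ F ω := fun ω => Set.indicator_nonneg (fun _ _ => by positivity) ω
  have hFb : ∀ᵐ ω ∂μ, |F ω| ≤ (M ^ 2)⁻¹ := by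
    filter_upwards [hH] with ω hω
    rw [abs_of_nonneg (hF0 ω), hF]
    by_cases h : ω ∈ H
    · rw [Set.indicator_of_mem h]
      have := hω h
      gcongr
    · rw [Set.indicator_of_notMem h]; positivity
  have hbd : ∀ {f : Ω → ℝ}, Measurable f → (∃ C, ∀ᵐ ω ∂μ, |f ω| ≤ C) → Integrable f μ :=
    fun hf ⟨C, hC⟩ => Integrable.of_bound hf.aestronglyMeasurable C hC
  have hFM : Measurable F := hFm.mono hG.weightSigma_le le_rfl
  have hUM : Measurable U := hUm.mono hG.weightSigma_le le_rfl
  have huM : ∀ i, Measurable (u i) := fun i => (hum i).mono hG.weightSigma_le le_rfl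
  have hFi : Integrable F μ := hbd hFM ⟨_, hFb⟩
  have hFU : Integrable (fun ω => F ω * U ω) μ := hFi.mul_bdd (c := s.card)
    hUM.aestronglyMeasurable (by
      filter_upwards [hUb] with ω hω
      rw [Real.norm_eq_abs, abs_of_nonneg hω.1]; exact hω.2)
  have hFUm : Measurable[weightSigma W] fun ω => F ω * U ω := Measurable.mul hFm hUm
  have hFUb : ∀ᵐ ω ∂μ, |F ω * U ω| ≤ (M ^ 2)⁻¹ * s.card := by
    filter_upwards [hFb, hUb] with ω h1 h2
    rw [abs_mul, abs_of_nonneg h2.1]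
    exact mul_le_mul h1 h2.2 h2.1 (by positivity)
  have mulX : ∀ {f : Ω → ℝ} (i), Integrable f μ → Integrable (fun ω => f ω * X i ω) μ :=
    fun i hf => hf.mul_bdd (c := 1) (hXm i).aestronglyMeasurable (ae_of_all _ fun ω => by
      rw [Real.norm_eq_abs, abs_of_nonneg (hX01 i ω).1]; exact (hX01 i ω).2)
  have mulu : ∀ {f : Ω → ℝ} (i), Integrable f μ → Integrable (fun ω => f ω * u i ω) μ :=
    fun i hf => hf.mul_bdd (c := 1) (huM i).aestronglyMeasurable (by
      filter_upwards [hu01] with ω hω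
      rw [Real.norm_eq_abs, abs_of_nonneg (hω i).1]; exact (hω i).2)
  set N : Ω → ℝ := fun ω => ∑ i ∈ s, X i ω with hN
  have eN : ∀ {f : Ω → ℝ}, Measurable[weightSigma W] f → Integrable f μ →
      ∀ {C : ℝ}, (∀ᵐ ω ∂μ, |f ω| ≤ C) → ∫ ω, f ω * N ω ∂μ = ∫ ω, f ω * U ω ∂μ := by
    intro f hf hfi C hC
    simp only [hN, hU, Finset.mul_sum]
    rw [integral_finsetSum _ fun i _ => mulX i hfi, integral_finsetSum _ fun i _ => mulu i hfi]
    exact Finset.sum_congr rfl fun i _ => hG.integral_mul_inDegree hν n i hf hC htail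
  have hFNi : Integrable (fun ω => F ω * N ω) μ := by
    simp only [hN, Finset.mul_sum]
    exact integrable_finsetSum _ fun i _ => mulX i hFi
  have hFNN : Integrable (fun ω => F ω * N ω * N ω) μ := by
    have : (fun ω => F ω * N ω * N ω) = fun ω => ∑ i ∈ s, F ω * N ω * X i ω := by
      funext ω; rw [← Finset.mul_sum]
    rw [this]
    exact integrable_finsetSum _ fun i _ => mulX i hFNi
  have hFUN : Integrable (fun ω => F ω * U ω * N ω) μ := by
    have : (fun ω => F ω * U ω * N ω) = fun ω => ∑ i ∈ s, F ω * U ω * X i ω := by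
      funext ω; rw [← Finset.mul_sum]
    rw [this]
    exact integrable_finsetSum _ fun i _ => mulX i hFU
  have hFUU : Integrable (fun ω => F ω * U ω * U ω) μ := by
    have : (fun ω => F ω * U ω * U ω) = fun ω => ∑ i ∈ s, F ω * U ω * u i ω := by
      funext ω; rw [← Finset.mul_sum]
    rw [this]
    exact integrable_finsetSum _ fun i _ => mulu i hFU
  -- Off-diagonal terms are controlled by negative correlation; the diagonal contributes at most the
  -- mean, since `X i ^ 2 ≤ X i`.
  have second : ∫ ω, F ω * N ω * N ω ∂μ ≤ ∫ ω, F ω * U ω * U ω ∂μ + ∫ ω, F ω * U ω ∂μ := by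
    have e1 : ∫ ω, F ω * N ω * N ω ∂μ = ∑ i ∈ s, ∑ j ∈ s, ∫ ω, F ω * X i ω * X j ω ∂μ := by
      have : (fun ω => F ω * N ω * N ω) = fun ω => ∑ i ∈ s, ∑ j ∈ s, F ω * X i ω * X j ω := by
        funext ω
        simp only [hN, Finset.mul_sum, Finset.sum_mul]
        exact Finset.sum_comm
      rw [this, integral_finsetSum _ fun i _ => integrable_finsetSum _ fun j _ =>
        mulX j (mulX i hFi)]
      exact Finset.sum_congr rfl fun i _ => integral_finsetSum _ fun j _ => mulX j (mulX i hFi)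
    have e2 : ∫ ω, F ω * U ω * U ω ∂μ = ∑ i ∈ s, ∑ j ∈ s, ∫ ω, F ω * u i ω * u j ω ∂μ := by
      have : (fun ω => F ω * U ω * U ω) = fun ω => ∑ i ∈ s, ∑ j ∈ s, F ω * u i ω * u j ω := by
        funext ω
        simp only [hU, Finset.mul_sum, Finset.sum_mul]
        exact Finset.sum_comm
      rw [this, integral_finsetSum _ fun i _ => integrable_finsetSum _ fun j _ =>
        mulu j (mulu i hFi)]
      exact Finset.sum_congr rfl fun i _ => integral_finsetSum _ fun j _ => mulu j (mulu i hFi)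
    have e3 : ∫ ω, F ω * U ω ∂μ = ∑ i ∈ s, ∫ ω, F ω * u i ω ∂μ := by
      simp only [hU, Finset.mul_sum]
      exact integral_finsetSum _ fun i _ => mulu i hFi
    rw [e1, e2, e3, ← Finset.sum_add_distrib]
    refine Finset.sum_le_sum fun i hi => ?_
    rw [← Finset.add_sum_erase _ _ hi,
      ← Finset.add_sum_erase s (fun j => ∫ ω, F ω * u i ω * u j ω ∂μ) hi]
    have d1 : ∫ ω, F ω * X i ω * X i ω ∂μ ≤ ∫ ω, F ω * u i ω ∂μ := by
      rw [← hG.integral_mul_inDegree hν n i hFm hFb htail]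
      refine integral_mono (mulX i (mulX i hFi)) (mulX i hFi) fun ω => ?_
      exact mul_le_of_le_one_right (mul_nonneg (hF0 ω) (hX01 i ω).1) (hX01 i ω).2
    have d2 : 0 ≤ ∫ ω, F ω * u i ω * u i ω ∂μ := by
      refine integral_nonneg_of_ae ?_
      filter_upwards [hu01] with ω hω
      exact mul_nonneg (mul_nonneg (hF0 ω) (hω i).1) (hω i).1
    have d3 : ∑ j ∈ s.erase i, ∫ ω, F ω * X i ω * X j ω ∂μ
        ≤ ∑ j ∈ s.erase i, ∫ ω, F ω * u i ω * u j ω ∂μ :=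
      Finset.sum_le_sum fun j hj => hG.integral_mul_inDegree_mul_le hν n
        (Finset.ne_of_mem_erase hj).symm hFm hFb (ae_of_all _ hF0) (tailInd_mono k)
        (tailInd_mono k) htail htail
    linarith
  have hA : MeasurableSet (H ∩ {ω | maxInDegree parent n ω < k}) :=
    hHM.inter (measurableSet_lt (hG.measurable_maxInDegree n) measurable_const)
  have hV : Integrable (fun ω => F ω * N ω * N ω - F ω * U ω * N ω - F ω * U ω * N ω
      + F ω * U ω * U ω) μ := ((hFNN.sub hFUN).sub hFUN).add hFUU
  calc μ.real (H ∩ {ω | maxInDegree parent n ω < k})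
      = ∫ ω, (H ∩ {ω | maxInDegree parent n ω < k}).indicator 1 ω ∂μ :=
        (integral_indicator_one hA).symm
    _ ≤ ∫ ω, (F ω * N ω * N ω - F ω * U ω * N ω - F ω * U ω * N ω + F ω * U ω * U ω) ∂μ := by
        refine integral_mono_ae ((integrable_const _).indicator hA) hV ?_
        filter_upwards [hH] with ω hω
        have hsq : F ω * N ω * N ω - F ω * U ω * N ω - F ω * U ω * N ω + F ω * U ω * U ω
          = F ω * (N ω - U ω) ^ 2 := by ring
        rw [hsq]
        by_cases h : ω ∈ H ∩ {ω | maxInDegree parent n ω < k}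
        · rw [Set.indicator_of_mem h]
          have hN0 : N ω = 0 := by
            refine Finset.sum_eq_zero fun i hi => ?_
            have hlt : ¬ k ≤ inDegree parent n i ω := fun hle => by
              have := (le_maxInDegree_iff (parent := parent) (k := k)
                (by have := hs i hi; omega : 1 ≤ n) ω).2 ⟨i, hs i hi, hle⟩
              exact absurd h.2 (not_lt.2 this)
            simp [hXdef, tailInd, hlt]
          have hU0 : 0 < U ω := hM.trans_le (hω h.1)
          rw [hN0, hF, Set.indicator_of_mem h.1, zero_sub, neg_sq,
            inv_mul_cancel₀ (by positivity)]
          exact le_rfl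
        · rw [Set.indicator_of_notMem h]
          exact mul_nonneg (hF0 ω) (sq_nonneg _)
    _ = ∫ ω, F ω * N ω * N ω ∂μ - ∫ ω, F ω * U ω * U ω ∂μ := by
        have s1 : Integrable (fun ω => F ω * N ω * N ω - F ω * U ω * N ω) μ := hFNN.sub hFUN
        have s2 : Integrable (fun ω => F ω * N ω * N ω - F ω * U ω * N ω - F ω * U ω * N ω) μ :=
          s1.sub hFUN
        rw [integral_add s2 hFUU, integral_sub s1 hFUN, integral_sub hFNN hFUN,
          eN hFUm hFU hFUb]
        ring
    _ ≤ ∫ ω, F ω * U ω ∂μ := by linarith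
    _ ≤ ∫ _, 1 / M ∂μ := by
        refine integral_mono_ae hFU (integrable_const _) ?_
        filter_upwards [hH] with ω hω
        by_cases h : ω ∈ H
        · have hM' := hω h
          have hU0 : 0 < U ω := hM.trans_le hM'
          simp only [hF, Set.indicator_of_mem h]
          calc (U ω ^ 2)⁻¹ * U ω = 1 / U ω := by field_simp
            _ ≤ 1 / M := one_div_le_one_div_of_le hM hM'
        · simp only [hF, Set.indicator_of_notMem h, zero_mul]
          positivity
    _ = 1 / M := by simp

/-- Lower bound for the maximum in-degree in terms of a single-weight expectation. -/
lemma IsWRT.measure_maxInDegree_lt_le [IsProbabilityMeasure μ] (hG : IsWRT μ ν W parent)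
    (hν : WeightLaw ν) {G : Set Ω} (hGm : MeasurableSet[weightSigma W] G) {c M : ℝ}
    {a n : ℕ} (k : ℕ) (hc : 0 < c) (hca : c⁻¹ ≤ a)
    (hGa : ∀ ω ∈ G, ∀ m < n, a ≤ m → ∑ j ∈ Finset.range m, W j ω ≤ c * m)
    (hM : ∫ w, linCount (w * c⁻¹) a n k ∂ν = M) (hM0 : 0 < M) :
    μ.real (G ∩ {ω | maxInDegree parent n ω < k}) ≤ 6 / M := by
  have hmem := hG.ae_weight hν.ae_mem
  have hc' : 0 ≤ c⁻¹ := by positivity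
  set h : ℕ → ℝ → ℝ := fun i w => bernExp (linRate (w * c⁻¹) i) n (tailInd k) with hh
  have hhm : ∀ i, Measurable (h i) := fun i => measurable_bernExp_linRate c⁻¹ i n _
  -- The true conditional probabilities share the partial sums and are dependent. `Y i` is a lower
  -- bound on `G` that depends on `W i` alone, so Chebyshev's inequality for independent summands
  -- applies to it.
  set Y : ℕ → Ω → ℝ := fun i ω => h i (W i ω) with hY
  have hYm : ∀ i, Measurable[weightSigma W] (Y i) := fun i =>
    (hhm i).comp (measurable_weightSigma W i)
  have hY01 : ∀ i ∈ Finset.Ico a n, ∀ᵐ ω ∂μ, 0 ≤ Y i ω ∧ Y i ω ≤ 1 := by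
    intro i hi
    filter_upwards [hmem] with ω hω
    have hl := fun m (_ : m < n) => linRate_weight_mem hc' hca (Finset.mem_Ico.1 hi).1 (hω i) m
    exact ⟨bernExp_tailInd_nonneg hl k, bernExp_tailInd_le_one hl k⟩
  have hYM : ∑ i ∈ Finset.Ico a n, ∫ ω, Y i ω ∂μ = M := by
    rw [← hM, ← hν.integral_linCount hc' hca]
    exact Finset.sum_congr rfl fun i _ => hG.integral_comp_weight i (hhm i)
  have hcheb := measure_sum_le_half_le (μ := μ) (X := Y) (Finset.Ico a n)
    (fun i _ => (hYm i).mono hG.weightSigma_le le_rfl) hY01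
    (fun i _ j _ hij => (hG.indep_weight.indepFun hij).comp (hhm i) (hhm j)) hYM hM0
  set S : Ω → ℝ := fun ω => ∑ i ∈ Finset.Ico a n, Y i ω with hS
  have hSm : Measurable[weightSigma W] S := Finset.measurable_fun_sum _ fun i _ => hYm i
  have hHm : MeasurableSet[weightSigma W] (G ∩ {ω | M / 2 < S ω}) :=
    MeasurableSet.inter hGm (hSm measurableSet_Ioi)
  have hmain := hG.measure_maxInDegree_lt_le_of_le hν hHm k (s := Finset.Ico a n) (n := n)
    (fun i hi => (Finset.mem_Ico.1 hi).2) (half_pos hM0) (by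
      filter_upwards [hmem] with ω hω hωH
      refine hωH.2.le.trans (Finset.sum_le_sum fun i hi => ?_)
      have hl := linRate_weight_mem hc' hca (Finset.mem_Ico.1 hi).1 (hω i)
      refine bernExp_mono_prob (fun m _ => (hl m).1) (fun m hm => ?_)
        (fun m _ => (attachProb_mem (fun i => (hω i).1) i m).2) (tailInd_mono k)
      unfold attachProb linRate
      split_ifs with him
      · have hm0 : (0 : ℝ) < m := by exact_mod_cast (by omega : 0 < m)
        have := hGa ω hωH.1 m hm (by have := (Finset.mem_Ico.1 hi).1; omega)
        have hpos : 0 < ∑ j ∈ Finset.range m, W j ω :=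
          Finset.sum_pos (fun j _ => (hω j).1) ⟨i, Finset.mem_range.2 him⟩
        calc W i ω * c⁻¹ / m = W i ω / (c * m) := by field_simp
          _ ≤ W i ω / ∑ j ∈ Finset.range m, W j ω :=
              div_le_div_of_nonneg_left (hω i).1.le hpos this
      · exact le_rfl)
  calc μ.real (G ∩ {ω | maxInDegree parent n ω < k})
      ≤ μ.real (G ∩ {ω | M / 2 < S ω} ∩ {ω | maxInDegree parent n ω < k}
          ∪ {ω | S ω ≤ M / 2}) := by
        refine measureReal_mono fun ω hω => ?_
        rcases lt_or_ge (M / 2) (S ω) with h1 | h1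
        · exact Or.inl ⟨⟨hω.1, h1⟩, hω.2⟩
        · exact Or.inr h1
    _ ≤ _ := measureReal_union_le _ _
    _ ≤ 1 / (M / 2) + 4 / M := add_le_add hmain hcheb
    _ = 6 / M := by field_simp; norm_num

end WRT

/-! ### Concentration of the partial sums of the weights. -/

namespace WRT

/-- The event that the partial sums of the weights are close to their expectations. -/
def goodEvent {Ω : Type*} (W : ℕ → Ω → ℝ) (s δ ε : ℝ) (K a n : ℕ) : Set Ω :=
  {ω | ∀ m < n, (K ≤ m → s * (1 - δ) * m ≤ ∑ j ∈ Finset.range m, W j ω) ∧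
    (a ≤ m → s * (1 - ε) * m ≤ ∑ j ∈ Finset.range m, W j ω ∧
      ∑ j ∈ Finset.range m, W j ω ≤ s * (1 + ε) * m)}

lemma measurableSet_goodEvent {Ω : Type*} (W : ℕ → Ω → ℝ) (s δ ε : ℝ) (K a n : ℕ) :
    MeasurableSet[weightSigma W] (goodEvent W s δ ε K a n) := by
  have hS := measurable_sum_weight W
  have h1 : ∀ (c : ℝ) (m : ℕ),
      MeasurableSet[weightSigma W] {ω | c ≤ ∑ j ∈ Finset.range m, W j ω} := fun c m =>
    hS m measurableSet_Ici
  have h2 : ∀ (c : ℝ) (m : ℕ),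
      MeasurableSet[weightSigma W] {ω | ∑ j ∈ Finset.range m, W j ω ≤ c} := fun c m =>
    hS m measurableSet_Iic
  have : goodEvent W s δ ε K a n = ⋂ m, ⋂ (_ : m < n),
      ((⋂ (_ : K ≤ m), {ω | s * (1 - δ) * m ≤ ∑ j ∈ Finset.range m, W j ω}) ∩
        ⋂ (_ : a ≤ m), ({ω | s * (1 - ε) * m ≤ ∑ j ∈ Finset.range m, W j ω} ∩
          {ω | ∑ j ∈ Finset.range m, W j ω ≤ s * (1 + ε) * m})) := by
    ext ω; simp [goodEvent]
  rw [this]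
  refine MeasurableSet.iInter fun m => MeasurableSet.iInter fun _ => MeasurableSet.inter ?_ ?_
  · exact MeasurableSet.iInter fun _ => h1 _ m
  · exact MeasurableSet.iInter fun _ => MeasurableSet.inter (h1 _ m) (h2 _ m)

variable {Ω : Type*} [mΩ : MeasurableSpace Ω] {μ : Measure Ω} {ν : Measure ℝ} {W : ℕ → Ω → ℝ}
  {parent : ℕ → Ω → ℕ}

lemma WeightLaw.integrable_id (hν : WeightLaw ν) : Integrable (fun w : ℝ => w) ν := by
  have := hν.isProbabilityMeasure
  refine Integrable.of_bound measurable_id.aestronglyMeasurable 1 ?_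
  filter_upwards [hν.ae_mem] with w hw
  rw [Real.norm_eq_abs, abs_of_pos hw.1]
  exact hw.2

lemma WeightLaw.integral_pos (hν : WeightLaw ν) : 0 < ∫ w, w ∂ν := by
  have := hν.isProbabilityMeasure
  rw [integral_pos_iff_support_of_nonneg_ae (hν.pos.mono fun w hw => hw.le) hν.integrable_id]
  have h : ν (Function.support fun w : ℝ => w)ᶜ = 0 := by
    refine measure_mono_null (t := {w | ¬ 0 < w}) (fun w hw => ?_) hν.pos
    have : w = 0 := by simpa using hw
    simp [this]
  have h1 : ν (Function.support fun w : ℝ => w) = 1 :=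
    (prob_compl_eq_zero_iff (measurableSet_support measurable_id)).1 h
  rw [h1]
  exact one_pos

lemma IsWRT.hoeffding [IsProbabilityMeasure μ] (hG : IsWRT μ ν W parent) (hν : WeightLaw ν)
    {s : ℝ} (hs : s = ∫ w, w ∂ν) {t : ℝ} (ht : 0 ≤ t) (m : ℕ) :
    μ.real {ω | (s + t) * m ≤ ∑ j ∈ Finset.range m, W j ω} ≤ Real.exp (-(2 * t ^ 2) * m) ∧
    μ.real {ω | ∑ j ∈ Finset.range m, W j ω ≤ (s - t) * m} ≤ Real.exp (-(2 * t ^ 2) * m) := by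
  have hE : ∀ i, ∫ ω, W i ω ∂μ = s := fun i => by
    rw [hs]; exact hG.integral_comp_weight i measurable_id
  have hmem := hG.ae_weight hν.ae_mem
  -- Hoeffding's lemma on `[0, 1]` gives the parameter `((1 - 0) / 2) ^ 2 = 1 / 4`.
  have hsub : ∀ i, HasSubgaussianMGF (fun ω => W i ω - s) (1 / 4) μ := by
    intro i
    have h := hasSubgaussianMGF_of_mem_Icc (μ := μ) (X := W i) (a := 0) (b := 1)
      (hG.measurable_weight i).aemeasurable (by
        filter_upwards [hmem] with ω hω
        exact ⟨(hω i).1.le, (hω i).2⟩)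
    rw [hE i] at h
    convert h using 1
    norm_num
  have hrate : -(t * m) ^ 2 / (2 * m * ((1 / 4 : NNReal) : ℝ)) = -(2 * t ^ 2) * m := by
    rcases Nat.eq_zero_or_pos m with rfl | hm
    · simp
    · have : (0 : ℝ) < m := by exact_mod_cast hm
      push_cast
      field_simp
      norm_num
  constructor
  · have h := HasSubgaussianMGF.measure_sum_range_ge_le_of_iIndepFun (n := m)
      (hG.indep_weight.comp (fun _ w => w - s) fun _ => by fun_prop)
      (fun i _ => hsub i) (ε := t * m) (by positivity)
    rw [hrate] at h
    refine le_trans (le_of_eq ?_) h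
    congr 1
    ext ω
    simp only [Set.mem_ofPred_eq, Function.comp, Finset.sum_sub_distrib, Finset.sum_const,
      Finset.card_range, nsmul_eq_mul]
    constructor <;> intro h <;> linarith
  · have h := HasSubgaussianMGF.measure_sum_range_ge_le_of_iIndepFun (n := m)
      (hG.indep_weight.comp (fun _ w => -(w - s)) fun _ => by fun_prop)
      (fun i _ => (hsub i).neg) (ε := t * m) (by positivity)
    rw [hrate] at h
    refine le_trans (le_of_eq ?_) h
    congr 1
    ext ω
    simp only [Set.mem_ofPred_eq, Function.comp, Finset.sum_neg_distrib, Finset.sum_sub_distrib,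
      Finset.sum_const, Finset.card_range, nsmul_eq_mul]
    constructor <;> intro h <;> linarith

/-- Union bound over `m`: the `δ`-deviations sum to a geometric tail starting at `K`, while the
`ε`-deviations are bounded by `n` times the largest term, the one at `m = a`. -/
lemma IsWRT.measure_compl_goodEvent_le [IsProbabilityMeasure μ] (hG : IsWRT μ ν W parent)
    (hν : WeightLaw ν) {s : ℝ} (hs : s = ∫ w, w ∂ν) {δ ε : ℝ} (hδ : 0 < δ) (hε : 0 ≤ ε)
    (K a n : ℕ) :
    μ.real (goodEvent W s δ ε K a n)ᶜ
      ≤ Real.exp (-(2 * (s * δ) ^ 2)) ^ K / (1 - Real.exp (-(2 * (s * δ) ^ 2)))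
        + 2 * (n * Real.exp (-(2 * (s * ε) ^ 2) * a)) := by
  have hs0 : 0 < s := hs ▸ hν.integral_pos
  set A : ℕ → Set Ω := fun m => {ω | ∑ j ∈ Finset.range m, W j ω ≤ (s - s * δ) * m}
  set B : ℕ → Set Ω := fun m => {ω | ∑ j ∈ Finset.range m, W j ω ≤ (s - s * ε) * m}
  set C : ℕ → Set Ω := fun m => {ω | (s + s * ε) * m ≤ ∑ j ∈ Finset.range m, W j ω}
  have hsub : (goodEvent W s δ ε K a n)ᶜ ⊆ (⋃ m ∈ Finset.Ico K n, A m) ∪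
      ((⋃ m ∈ Finset.Ico a n, B m) ∪ ⋃ m ∈ Finset.Ico a n, C m) := by
    intro ω hω
    by_contra hcon
    refine hω fun m hm => ⟨fun hK => ?_, fun ha => ⟨?_, ?_⟩⟩ <;> by_contra hlt <;>
      refine hcon ?_
    · have h : ω ∈ A m := show _ ≤ (s - s * δ) * (m : ℝ) by linarith
      exact Or.inl (Set.mem_biUnion (Finset.mem_coe.2 (Finset.mem_Ico.2 ⟨hK, hm⟩)) h)
    · have h : ω ∈ B m := show _ ≤ (s - s * ε) * (m : ℝ) by linarith
      exact Or.inr (Or.inl (Set.mem_biUnion (Finset.mem_coe.2 (Finset.mem_Ico.2 ⟨ha, hm⟩)) h))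
    · have h : ω ∈ C m := show (s + s * ε) * (m : ℝ) ≤ _ by linarith
      exact Or.inr (Or.inr (Set.mem_biUnion (Finset.mem_coe.2 (Finset.mem_Ico.2 ⟨ha, hm⟩)) h))
  set r := Real.exp (-(2 * (s * δ) ^ 2)) with hr
  have hr1 : r < 1 := by
    rw [← Real.exp_zero, hr]
    exact Real.exp_lt_exp.2 (by have := mul_pos hs0 hδ; nlinarith)
  have hA : μ.real (⋃ m ∈ Finset.Ico K n, A m) ≤ r ^ K / (1 - r) := by
    refine (measureReal_biUnion_finset_le _ _).trans ?_
    refine le_trans (Finset.sum_le_sum fun m _ => ?_)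
      (geom_sum_Ico_le_of_lt_one (m := K) (n := n) (Real.exp_nonneg _) hr1)
    refine (hG.hoeffding hν hs (mul_pos hs0 hδ).le m).2.trans_eq ?_
    rw [hr, ← Real.exp_nat_mul, mul_comm]
  have hBC : ∀ {D : ℕ → Set Ω}, (∀ m, μ.real (D m) ≤ Real.exp (-(2 * (s * ε) ^ 2) * m)) →
      μ.real (⋃ m ∈ Finset.Ico a n, D m) ≤ n * Real.exp (-(2 * (s * ε) ^ 2) * a) := by
    intro D hD
    refine (measureReal_biUnion_finset_le _ _).trans ?_
    calc ∑ m ∈ Finset.Ico a n, μ.real (D m)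
        ≤ ∑ m ∈ Finset.Ico a n, Real.exp (-(2 * (s * ε) ^ 2) * a) := by
          refine Finset.sum_le_sum fun m hm => (hD m).trans (Real.exp_le_exp.2 ?_)
          have : (a : ℝ) ≤ m := by exact_mod_cast (Finset.mem_Ico.1 hm).1
          nlinarith [sq_nonneg (s * ε)]
      _ = (n - a : ℕ) * Real.exp (-(2 * (s * ε) ^ 2) * a) := by simp
      _ ≤ _ := by gcongr; omega
  have hB := hBC (D := B) fun m => (hG.hoeffding hν hs (mul_nonneg hs0.le hε) m).2
  have hC := hBC (D := C) fun m => (hG.hoeffding hν hs (mul_nonneg hs0.le hε) m).1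
  calc μ.real (goodEvent W s δ ε K a n)ᶜ ≤ _ := measureReal_mono hsub
    _ ≤ _ := measureReal_union_le _ _
    _ ≤ _ := add_le_add hA ((measureReal_union_le _ _).trans (add_le_add hB hC))
    _ = _ := by ring

end WRT

/-! ### Choice of scales, and stability of the degree tail. -/

namespace WRT

lemma tendsto_log_natCast : Tendsto (fun n : ℕ => Real.log n) atTop atTop :=
  Real.tendsto_log_atTop.comp tendsto_natCast_atTop_atTop

/-- The left side is the exponent of `n` in the Chernoff bound for early vertices, with base `x =
√θ` and `k ≈ log n / log θ`. The factor `x⁻¹ ^ k` contributes `-1/2`. At `δ = 0` the last term is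
`(x - 1) / s = 1 / (x + 1) < 1/2`, and continuity leaves room for a positive `δ`. -/
lemma exists_delta {s : ℝ} (hs : 0 < s) : ∃ δ : ℝ, 0 < δ ∧ δ < 1 / 2 ∧
    δ * Real.log √(1 + s) - 1 / 2 + (√(1 + s) - 1) * (s * (1 - δ))⁻¹ < 0 := by
  set x := √(1 + s) with hx
  have hx2 : x ^ 2 = 1 + s := Real.sq_sqrt (by positivity)
  have hx1 : 1 < x := by
    rw [hx, Real.lt_sqrt zero_le_one]; linarith
  have hcont : ContinuousAt (fun δ : ℝ => δ * Real.log x - 1 / 2 + (x - 1) * (s * (1 - δ))⁻¹)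
      0 := by
    have h : s * (1 - (0 : ℝ)) ≠ 0 := by simp [hs.ne']
    have : ContinuousAt (fun δ : ℝ => s * (1 - δ)) 0 := by fun_prop
    have h2 := this.inv₀ h
    fun_prop (disch := assumption)
  have h0 : (0 : ℝ) * Real.log x - 1 / 2 + (x - 1) * (s * (1 - 0))⁻¹ < 0 := by
    have hs' : s = (x - 1) * (x + 1) := by nlinarith
    have h1 : (x - 1) * (s * (1 - 0))⁻¹ = 1 / (x + 1) := by
      have : x - 1 ≠ 0 := by linarith
      rw [hs']; field_simp; ring
    rw [h1]
    have : 1 / (x + 1) < 1 / 2 := one_div_lt_one_div_of_lt (by norm_num) (by linarith)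
    linarith
  have hev := hcont.eventually (gt_mem_nhds h0)
  have hev2 : ∀ᶠ δ : ℝ in 𝓝[>] 0, δ < 1 / 2 := nhdsWithin_le_nhds (gt_mem_nhds (by norm_num))
  obtain ⟨δ, ⟨h1, h2⟩, h3⟩ := (((eventually_nhdsWithin_of_eventually_nhds hev).and hev2).and
    (eventually_mem_of_tendsto_nhdsWithin tendsto_id)).exists
  exact ⟨δ, h3, h2, h1⟩

lemma tendsto_pow_mul_exp_neg (j : ℕ) {b : ℝ} (hb : 0 < b) :
    Tendsto (fun x : ℝ => x ^ j * Real.exp (-b * x)) atTop (𝓝 0) := by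
  have h := (isLittleO_pow_exp_pos_mul_atTop j hb).tendsto_div_nhds_zero
  refine h.congr fun x => ?_
  rw [neg_mul, Real.exp_neg, div_eq_mul_inv]

/-- The expression is a power of `log n` times `n ^ (E + o(1))`, where the exponent `E` is negative
by `hE`. -/
lemma tendsto_early_term {s δ : ℝ} (hs : 0 < s) (hδ : 0 < δ)
    (hE : δ * Real.log √(1 + s) - 1 / 2 + (√(1 + s) - 1) * (s * (1 - δ))⁻¹ < 0)
    {k : ℕ → ℕ} (hk : Tendsto (fun n : ℕ => (k n : ℝ) / Real.log n) atTop
      (𝓝 (1 / Real.log (1 + s)))) :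
    Tendsto (fun n : ℕ => (⌈Real.log n ^ 6⌉₊ : ℝ) * ((√(1 + s))⁻¹ ^ k n *
      (√(1 + s) ^ ⌈δ * Real.log n⌉₊ *
        Real.exp ((√(1 + s) - 1) * (s * (1 - δ))⁻¹ * (1 + Real.log n))))) atTop (𝓝 0) := by
  have hlx : Real.log √(1 + s) = Real.log (1 + s) / 2 := Real.log_sqrt (by positivity)
  have hl : 0 < Real.log (1 + s) := Real.log_pos (by linarith)
  have hx0 : 0 < √(1 + s) := by positivity
  set x := √(1 + s) with hx
  set b := (x - 1) * (s * (1 - δ))⁻¹ with hb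
  set E := δ * Real.log x - 1 / 2 + b with hEdef
  set e : ℕ → ℝ := fun n => (⌈δ * Real.log n⌉₊ : ℝ) * Real.log x - k n * Real.log x
    + b * (1 + Real.log n) with he
  have hK : Tendsto (fun n : ℕ => (⌈δ * Real.log n⌉₊ : ℝ) / Real.log n) atTop (𝓝 δ) :=
    (tendsto_nat_ceil_mul_div_atTop hδ.le).comp tendsto_log_natCast
  have hinv : Tendsto (fun n : ℕ => 1 / Real.log n) atTop (𝓝 0) :=
    tendsto_const_nhds.div_atTop tendsto_log_natCast
  have hlim : Tendsto (fun n : ℕ => e n / Real.log n) atTop (𝓝 E) := by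
    have h : Tendsto (fun n : ℕ => (⌈δ * Real.log n⌉₊ : ℝ) / Real.log n * Real.log x
        - (k n : ℝ) / Real.log n * Real.log x + b * (1 / Real.log n + 1)) atTop
        (𝓝 (δ * Real.log x - 1 / Real.log (1 + s) * Real.log x + b * (0 + 1))) :=
      ((hK.mul_const _).sub (hk.mul_const _)).add ((hinv.add_const 1).const_mul b)
    have hval : δ * Real.log x - 1 / Real.log (1 + s) * Real.log x + b * (0 + 1) = E := by
      rw [hEdef, hlx]; field_simp; ring
    rw [hval] at h
    refine h.congr' ?_
    filter_upwards [tendsto_log_natCast.eventually_gt_atTop 0] with n hn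
    simp only [he]
    field_simp
  have hev : ∀ᶠ n : ℕ in atTop, e n ≤ -(-E / 2) * Real.log n := by
    filter_upwards [hlim.eventually (gt_mem_nhds (show E < E / 2 by linarith)),
      tendsto_log_natCast.eventually_gt_atTop 0] with n h1 h2
    rw [div_lt_iff₀ h2] at h1
    linarith
  have hbd : Tendsto (fun n : ℕ => Real.log n ^ 6 * Real.exp (-(-E / 2) * Real.log n)
      + Real.log n ^ 0 * Real.exp (-(-E / 2) * Real.log n)) atTop (𝓝 (0 + 0)) :=
    (((tendsto_pow_mul_exp_neg 6 (by linarith)).comp tendsto_log_natCast)).add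
      ((tendsto_pow_mul_exp_neg 0 (by linarith)).comp tendsto_log_natCast)
  rw [add_zero] at hbd
  refine squeeze_zero' (Eventually.of_forall fun n => by positivity) ?_ hbd
  filter_upwards [hev, tendsto_log_natCast.eventually_gt_atTop 0] with n h1 h2
  have hexp : x⁻¹ ^ k n * (x ^ ⌈δ * Real.log n⌉₊ * Real.exp (b * (1 + Real.log n)))
      = Real.exp (e n) := by
    have e1 : ∀ j : ℕ, x ^ j = Real.exp (j * Real.log x) := fun j => by
      rw [Real.exp_nat_mul, Real.exp_log hx0]
    rw [inv_pow, e1, e1, ← Real.exp_neg, ← Real.exp_add, ← Real.exp_add]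
    congr 1
    simp only [he]; ring
  rw [hexp, pow_zero, ← add_mul]
  exact mul_le_mul (Nat.ceil_lt_add_one (by positivity)).le (Real.exp_le_exp.2 h1)
    (Real.exp_nonneg _) (by positivity)

variable {Ω : Type*} [mΩ : MeasurableSpace Ω] {μ : Measure Ω} {ν : Measure ℝ} {W : ℕ → Ω → ℝ}
  {parent : ℕ → Ω → ℕ}

/-- With `ε = 1 / log² n` and `a ≥ log⁶ n` one has `ε² a ≥ log² n`, which beats the factor `n` of
the union bound. For the crude lower bound with fixed `δ` it suffices that `K → ∞`. -/
lemma IsWRT.tendsto_measure_compl_goodEvent [IsProbabilityMeasure μ] (hG : IsWRT μ ν W parent)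
    (hν : WeightLaw ν) {s : ℝ} (hs : s = ∫ w, w ∂ν) {δ : ℝ} (hδ : 0 < δ) :
    Tendsto (fun n : ℕ => μ.real (goodEvent W s δ (1 / Real.log n ^ 2) ⌈δ * Real.log n⌉₊
      ⌈Real.log n ^ 6⌉₊ n)ᶜ) atTop (𝓝 0) := by
  have hs0 : 0 < s := hs ▸ hν.integral_pos
  set r := Real.exp (-(2 * (s * δ) ^ 2)) with hr
  have hr1 : r < 1 := by
    rw [← Real.exp_zero, hr]
    exact Real.exp_lt_exp.2 (by have := mul_pos hs0 hδ; nlinarith)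
  have hK : Tendsto (fun n : ℕ => ⌈δ * Real.log n⌉₊) atTop atTop :=
    tendsto_nat_ceil_atTop.comp (tendsto_log_natCast.const_mul_atTop hδ)
  have h1 : Tendsto (fun n : ℕ => r ^ ⌈δ * Real.log n⌉₊ / (1 - r)) atTop (𝓝 (0 / (1 - r))) :=
    ((tendsto_pow_atTop_nhds_zero_of_lt_one (Real.exp_nonneg _) hr1).comp hK).div_const _
  have h2 : Tendsto (fun n : ℕ => 2 * (Real.log n ^ 0 * Real.exp (-1 * Real.log n))) atTop
      (𝓝 (2 * 0)) :=
    ((tendsto_pow_mul_exp_neg 0 one_pos).comp tendsto_log_natCast).const_mul 2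
  have h12 := h1.add h2
  rw [zero_div, mul_zero, add_zero] at h12
  refine squeeze_zero' (Eventually.of_forall fun n => measureReal_nonneg) ?_ h12
  -- Once `s² log n ≥ 1`, the Hoeffding exponent `2 s² log² n` is at least `2 log n`, so `n` times
  -- the exponential is at most `1 / n`.
  filter_upwards [tendsto_log_natCast.eventually_ge_atTop (1 / s ^ 2),
    tendsto_log_natCast.eventually_gt_atTop 0, eventually_gt_atTop 0] with n hn hn0 hn1
  refine (hG.measure_compl_goodEvent_le hν hs hδ (ε := 1 / Real.log n ^ 2) (by positivity)
    _ _ n).trans ?_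
  refine add_le_add le_rfl (mul_le_mul_of_nonneg_left ?_ zero_le_two)
  have hn' : (0 : ℝ) < n := by exact_mod_cast hn1
  rw [pow_zero, one_mul]
  nth_rewrite 1 [← Real.exp_log hn']
  rw [← Real.exp_add]
  refine Real.exp_le_exp.2 ?_
  set L := Real.log n
  have hceil : L ^ 6 ≤ (⌈L ^ 6⌉₊ : ℝ) := Nat.le_ceil _
  have h3 : 2 * (s * (1 / L ^ 2)) ^ 2 * L ^ 6 = 2 * s ^ 2 * L ^ 2 := by field_simp
  have h4 : 2 * (s * (1 / L ^ 2)) ^ 2 * L ^ 6 ≤ 2 * (s * (1 / L ^ 2)) ^ 2 * ⌈L ^ 6⌉₊ :=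
    mul_le_mul_of_nonneg_left hceil (by positivity)
  have h5 : 1 ≤ s ^ 2 * L := by
    rw [div_le_iff₀ (by positivity)] at hn; linarith
  nlinarith

/-- The asymptotic probability that a uniformly chosen vertex has in-degree at least `k`. -/
noncomputable def degTail (ν : Measure ℝ) (k : ℕ) : ℝ :=
  ∫ w, (w / (w + (theta ν - 1))) ^ k ∂ν

lemma theta_sub_one (ν : Measure ℝ) : theta ν - 1 = ∫ w, w ∂ν := by simp [theta]

lemma WeightLaw.integrable_degTail (hν : WeightLaw ν) (k : ℕ) :
    Integrable (fun w : ℝ => (w / (w + (theta ν - 1))) ^ k) ν := by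
  have hs0 : 0 < theta ν - 1 := by rw [theta_sub_one]; exact hν.integral_pos
  refine (hν.integrable_pow (c := (theta ν - 1)⁻¹) (by positivity) k).congr ?_
  filter_upwards [hν.ae_mem] with w hw
  have hw0 := hw.1
  congr 1
  field_simp
  ring

/-- Replacing `s` by `s (1 - ε)` enlarges `w / (w + s)` by a factor at most `(1 - ε)⁻¹`, and `(1 -
ε) ^ k ≥ 1 - k ε ≥ 1/2` by Bernoulli's inequality. -/
lemma WeightLaw.integral_pow_le (hν : WeightLaw ν) {ε : ℝ} (hε0 : 0 ≤ ε) (hε : ε < 1) (k : ℕ)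
    (hkε : k * ε ≤ 1 / 2) :
    ∫ w, (w * ((theta ν - 1) * (1 - ε))⁻¹ / (1 + w * ((theta ν - 1) * (1 - ε))⁻¹)) ^ k ∂ν
      ≤ 2 * degTail ν k := by
  have hs0 : 0 < theta ν - 1 := by rw [theta_sub_one]; exact hν.integral_pos
  set s := theta ν - 1 with hs
  have h1 : 0 < 1 - ε := by linarith
  have hbern : 1 / 2 ≤ (1 - ε) ^ k := by
    have := one_add_mul_le_pow (a := -ε) (by linarith) k
    have e : 1 + -ε = 1 - ε := by ring
    rw [e] at this
    linarith
  unfold degTail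
  rw [← integral_const_mul]
  refine integral_mono_ae (hν.integrable_pow (by positivity) k)
    ((hν.integrable_degTail k).const_mul 2) ?_
  filter_upwards [hν.ae_mem] with w hw
  have hw0 := hw.1
  have h2 : w * (s * (1 - ε))⁻¹ / (1 + w * (s * (1 - ε))⁻¹) = w / (w + s * (1 - ε)) := by
    field_simp
    ring
  have h3 : w / (w + s * (1 - ε)) ≤ (1 - ε)⁻¹ * (w / (w + s)) := by
    have : (1 - ε)⁻¹ * (w / (w + s)) = w / ((1 - ε) * (w + s)) := by field_simp
    rw [this]
    refine div_le_div_of_nonneg_left hw0.le (by positivity) ?_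
    nlinarith
  rw [h2, ← hs]
  calc (w / (w + s * (1 - ε))) ^ k ≤ ((1 - ε)⁻¹ * (w / (w + s))) ^ k :=
        pow_le_pow_left₀ (by positivity) h3 k
    _ = ((1 - ε) ^ k)⁻¹ * (w / (w + s)) ^ k := by rw [mul_pow, inv_pow]
    _ ≤ 2 * (w / (w + s)) ^ k := by
        refine mul_le_mul_of_nonneg_right ?_ (by positivity)
        rw [inv_le_comm₀ (by positivity) two_pos]
        linarith

/-- Replacing `s` by `s (1 + ε)` shrinks `w / (w + s)` by a factor at least `1 - ε`, whose `k`-th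
power is at least `1/2`. -/
lemma WeightLaw.le_integral_pow (hν : WeightLaw ν) {ε : ℝ} (hε0 : 0 ≤ ε) (hε : ε < 1) (k : ℕ)
    (hkε : k * ε ≤ 1 / 2) :
    1 / 2 * degTail ν k
      ≤ ∫ w, (w * ((theta ν - 1) * (1 + ε))⁻¹ / (1 + w * ((theta ν - 1) * (1 + ε))⁻¹)) ^ k ∂ν := by
  have hs0 : 0 < theta ν - 1 := by rw [theta_sub_one]; exact hν.integral_pos
  set s := theta ν - 1 with hs
  have h1 : 0 < 1 - ε := by linarith
  have hbern : 1 / 2 ≤ (1 - ε) ^ k := by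
    have := one_add_mul_le_pow (a := -ε) (by linarith) k
    have e : 1 + -ε = 1 - ε := by ring
    rw [e] at this
    linarith
  unfold degTail
  rw [← integral_const_mul]
  refine integral_mono_ae ((hν.integrable_degTail k).const_mul (1 / 2))
    (hν.integrable_pow (by positivity) k) ?_
  filter_upwards [hν.ae_mem] with w hw
  have hw0 := hw.1
  have h2 : w * (s * (1 + ε))⁻¹ / (1 + w * (s * (1 + ε))⁻¹) = w / (w + s * (1 + ε)) := by
    field_simp
    ring
  have h3 : (1 - ε) * (w / (w + s)) ≤ w / (w + s * (1 + ε)) := by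
    rw [← mul_div_assoc, div_le_div_iff₀ (by positivity) (by positivity)]
    have : 0 ≤ w * (w * ε + s * ε ^ 2) := by positivity
    nlinarith
  rw [h2, ← hs]
  calc 1 / 2 * (w / (w + s)) ^ k ≤ (1 - ε) ^ k * (w / (w + s)) ^ k :=
        mul_le_mul_of_nonneg_right hbern (by positivity)
    _ = ((1 - ε) * (w / (w + s))) ^ k := (mul_pow _ _ _).symm
    _ ≤ _ := pow_le_pow_left₀ (by positivity) h3 k

end WRT

/-! ### From the size of `n * degTail ν (k n)` to the maximum. -/

namespace WRT

variable {Ω : Type*} [mΩ : MeasurableSpace Ω] {μ : Measure Ω} {ν : Measure ℝ} {W : ℕ → Ω → ℝ}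
  {parent : ℕ → Ω → ℕ}

lemma tendsto_mul_one_div_log_sq {k : ℕ → ℕ} {c : ℝ}
    (hk : Tendsto (fun n : ℕ => (k n : ℝ) / Real.log n) atTop (𝓝 c)) :
    Tendsto (fun n : ℕ => (k n : ℝ) * (1 / Real.log n ^ 2)) atTop (𝓝 0) := by
  have hinv : Tendsto (fun n : ℕ => 1 / Real.log n) atTop (𝓝 0) :=
    tendsto_const_nhds.div_atTop tendsto_log_natCast
  have := hk.mul hinv
  rw [mul_zero] at this
  refine this.congr fun n => ?_
  rw [div_mul_div_comm, mul_one, mul_one_div, sq]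

lemma eventually_ceil_log_pow_le : ∀ᶠ n : ℕ in atTop, ⌈Real.log n ^ 6⌉₊ ≤ n := by
  have h : Tendsto (fun n : ℕ => Real.log n ^ 6 / n) atTop (𝓝 0) :=
    ((Real.isLittleO_pow_log_id_atTop (n := 6)).tendsto_div_nhds_zero).comp tendsto_natCast_atTop_atTop
  filter_upwards [h.eventually (gt_mem_nhds one_pos), eventually_gt_atTop 0] with n h1 h2
  have h3 : (0 : ℝ) < n := by exact_mod_cast h2
  rw [div_lt_one h3] at h1
  exact Nat.ceil_le.2 h1.le

lemma tendsto_ceil_log_pow : Tendsto (fun n : ℕ => ⌈Real.log n ^ 6⌉₊) atTop atTop :=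
  tendsto_nat_ceil_atTop.comp ((tendsto_pow_atTop (by norm_num)).comp tendsto_log_natCast)

/-- If the expected number of vertices of in-degree at least `k n` vanishes, then the maximum
in-degree is smaller than `k n` with high probability. -/
lemma IsWRT.tendsto_measure_le_maxInDegree [IsProbabilityMeasure μ] (hG : IsWRT μ ν W parent)
    (hν : WeightLaw ν) {k : ℕ → ℕ} (hk : Tendsto (fun n : ℕ => (k n : ℝ) / Real.log n) atTop
      (𝓝 (1 / Real.log (theta ν))))
    (hp : Tendsto (fun n : ℕ => n * degTail ν (k n)) atTop (𝓝 0)) :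
    Tendsto (fun n => μ.real {ω | k n ≤ maxInDegree parent n ω}) atTop (𝓝 0) := by
  have hs := theta_sub_one ν
  have hs0 : 0 < theta ν - 1 := by rw [hs]; exact hν.integral_pos
  set s := theta ν - 1 with hsdef
  have hθ : theta ν = 1 + s := by rw [hsdef]; ring
  rw [hθ] at hk
  obtain ⟨δ, hδ, hδ2, hE⟩ := exists_delta hs0
  have hgood := hG.tendsto_measure_compl_goodEvent hν hs hδ
  have hearly := tendsto_early_term hs0 hδ hE hk
  have htot := hgood.add (hearly.add (hp.const_mul 2))
  simp only [mul_zero, add_zero] at htot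
  refine squeeze_zero' (Eventually.of_forall fun n => measureReal_nonneg) ?_ htot
  have hx1 : 1 ≤ √(1 + s) := by rw [Real.one_le_sqrt]; linarith
  filter_upwards [tendsto_log_natCast.eventually_ge_atTop 2, eventually_ceil_log_pow_le,
    tendsto_ceil_log_pow.eventually_ge_atTop (max 1 ⌈(s / 2)⁻¹⌉₊),
    (tendsto_mul_one_div_log_sq hk).eventually (ge_mem_nhds (by norm_num : (0 : ℝ) < 1 / 2))]
    with n hn han ha hkε
  set ε := 1 / Real.log n ^ 2 with hε
  have hε0 : 0 ≤ ε := by positivity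
  have hε1 : ε ≤ 1 / 2 := by
    rw [hε]
    exact one_div_le_one_div_of_le (by norm_num) (by nlinarith)
  set a := ⌈Real.log n ^ 6⌉₊ with hadef
  set K := ⌈δ * Real.log n⌉₊ with hK
  set G := goodEvent W s δ ε K a n with hGdef
  have hca : (s * (1 - ε))⁻¹ ≤ a := by
    calc (s * (1 - ε))⁻¹ ≤ (s / 2)⁻¹ := by
          refine inv_anti₀ (by positivity) ?_
          nlinarith
      _ ≤ (⌈(s / 2)⁻¹⌉₊ : ℝ) := Nat.le_ceil _
      _ ≤ a := by exact_mod_cast (le_max_right _ _).trans ha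
  have hmain := hG.measure_le_maxInDegree_le hν (G := G) (measurableSet_goodEvent W s δ ε K a n)
    (b := s * (1 - δ)) (c := s * (1 - ε)) (x := √(1 + s)) (a := a) (n := n) (K := K) (k n)
    (mul_pos hs0 (by linarith)) (mul_pos hs0 (by linarith)) hx1 hca ((le_max_left _ _).trans ha)
    han (fun ω hω m hm hKm => (hω m hm).1 hKm) (fun ω hω m hm ham => ((hω m hm).2 ham).1)
  have hint := hν.integral_pow_le hε0 (by linarith) (k n) hkε
  rw [← hsdef] at hint
  have hn0 : (0 : ℝ) ≤ n := Nat.cast_nonneg n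
  have hint' := mul_le_mul_of_nonneg_left hint hn0
  calc μ.real {ω | k n ≤ maxInDegree parent n ω}
      ≤ μ.real (Gᶜ ∪ G ∩ {ω | k n ≤ maxInDegree parent n ω}) := by
        refine measureReal_mono fun ω hω => ?_
        by_cases h : ω ∈ G
        · exact Or.inr ⟨h, hω⟩
        · exact Or.inl h
    _ ≤ _ := measureReal_union_le _ _
    _ ≤ _ := by
        refine add_le_add le_rfl (hmain.trans (add_le_add le_rfl ?_))
        linarith

/-- If the expected number of vertices of in-degree at least `k n` tends to infinity, then the
maximum in-degree is at least `k n` with high probability. -/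
lemma IsWRT.tendsto_measure_maxInDegree_lt [IsProbabilityMeasure μ] (hG : IsWRT μ ν W parent)
    (hν : WeightLaw ν) {k : ℕ → ℕ} (hk : Tendsto (fun n : ℕ => (k n : ℝ) / Real.log n) atTop
      (𝓝 (1 / Real.log (theta ν))))
    (hp : Tendsto (fun n : ℕ => n * degTail ν (k n)) atTop atTop) :
    Tendsto (fun n => μ.real {ω | maxInDegree parent n ω < k n}) atTop (𝓝 0) := by
  have hs := theta_sub_one ν
  have hs0 : 0 < theta ν - 1 := by rw [hs]; exact hν.integral_pos
  set s := theta ν - 1 with hsdef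
  have hθ : theta ν = 1 + s := by rw [hsdef]; ring
  rw [hθ] at hk
  obtain ⟨δ, hδ, hδ2, hE⟩ := exists_delta hs0
  have hgood := hG.tendsto_measure_compl_goodEvent hν hs hδ
  -- For a lower bound the early vertices can simply be ignored. The same estimate now controls the
  -- error term of `WeightLaw.le_integral_linCount`; the `- 1` in `hM` accounts for it.
  have hearly := tendsto_early_term hs0 hδ hE hk
  have hM : Tendsto (fun n : ℕ => 1 / 2 * (n * degTail ν (k n)) - 1) atTop atTop :=
    tendsto_atTop_add_const_right _ _ (hp.const_mul_atTop (by norm_num))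
  have htot := hgood.add ((tendsto_const_nhds (x := (6 : ℝ))).div_atTop hM)
  rw [add_zero] at htot
  refine squeeze_zero' (Eventually.of_forall fun n => measureReal_nonneg) ?_ htot
  have hx1 : 1 ≤ √(1 + s) := by rw [Real.one_le_sqrt]; linarith
  have hxθ : √(1 + s) ≤ 1 + s := Real.sqrt_le_self_iff.2 (Or.inr (by linarith))
  filter_upwards [tendsto_log_natCast.eventually_ge_atTop 2, eventually_ceil_log_pow_le,
    tendsto_ceil_log_pow.eventually_ge_atTop (max 1 ⌈s⁻¹⌉₊),
    (tendsto_mul_one_div_log_sq hk).eventually (ge_mem_nhds (by norm_num : (0 : ℝ) < 1 / 2)),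
    hearly.eventually (ge_mem_nhds one_pos), hM.eventually_gt_atTop 0]
    with n hn han ha hkε hearly hMpos
  set ε := 1 / Real.log n ^ 2 with hε
  have hε0 : 0 ≤ ε := by positivity
  have hε1 : ε ≤ 1 / 2 := by
    rw [hε]
    exact one_div_le_one_div_of_le (by norm_num) (by nlinarith)
  set a := ⌈Real.log n ^ 6⌉₊ with hadef
  set K := ⌈δ * Real.log n⌉₊ with hK
  set G := goodEvent W s δ ε K a n with hGdef
  set x := √(1 + s) with hx
  have hcs : (s * (1 + ε))⁻¹ ≤ s⁻¹ := inv_anti₀ hs0 (by nlinarith)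
  have hcpos : 0 < s * (1 + ε) := by positivity
  have hca : (s * (1 + ε))⁻¹ ≤ a := by
    calc (s * (1 + ε))⁻¹ ≤ s⁻¹ := hcs
      _ ≤ (⌈s⁻¹⌉₊ : ℝ) := Nat.le_ceil _
      _ ≤ a := by exact_mod_cast (le_max_right _ _).trans ha
  -- The left side is `1 / (1 + s (1 + ε)) ≤ 1 / θ`, and `√θ ≤ θ`.
  have hxc : (s * (1 + ε))⁻¹ / (1 + (s * (1 + ε))⁻¹) ≤ x⁻¹ := by
    have : (s * (1 + ε))⁻¹ / (1 + (s * (1 + ε))⁻¹) = (1 + s * (1 + ε))⁻¹ := by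
      field_simp
      ring
    rw [this]
    refine inv_anti₀ (by linarith) ?_
    nlinarith
  have hcount := hν.le_integral_linCount (c := (s * (1 + ε))⁻¹) (x := x) (by positivity) hca
    ((le_max_left _ _).trans ha) hx1 hxc han (k n)
  have herr : (a : ℝ) * x⁻¹ ^ k n * Real.exp ((x - 1) * (s * (1 + ε))⁻¹ * (1 + Real.log n)) ≤ 1 := by
    refine le_trans ?_ hearly
    rw [mul_assoc]
    refine mul_le_mul_of_nonneg_left (mul_le_mul_of_nonneg_left ?_ (by positivity)) (by positivity)
    have h1 : 1 ≤ x ^ K := one_le_pow₀ hx1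
    refine le_trans ?_ (le_mul_of_one_le_left (Real.exp_nonneg _) h1)
    refine Real.exp_le_exp.2 ?_
    have h2 : (s * (1 + ε))⁻¹ ≤ (s * (1 - δ))⁻¹ :=
      inv_anti₀ (mul_pos hs0 (by linarith)) (by nlinarith)
    have h3 : 0 ≤ x - 1 := by linarith
    gcongr
  have hint := hν.le_integral_pow hε0 (by linarith) (k n) hkε
  rw [← hsdef] at hint
  have hint' := mul_le_mul_of_nonneg_left hint (Nat.cast_nonneg (α := ℝ) n)
  set M := ∫ w, linCount (w * (s * (1 + ε))⁻¹) a n (k n) ∂ν with hMdef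
  have hMle : 1 / 2 * (n * degTail ν (k n)) - 1 ≤ M := by linarith
  have hmain := hG.measure_maxInDegree_lt_le hν (G := G) (measurableSet_goodEvent W s δ ε K a n)
    (c := s * (1 + ε)) (a := a) (n := n) (k n) hcpos hca
    (fun ω hω m hm ham => ((hω m hm).2 ham).2) hMdef.symm (hMpos.trans_le hMle)
  calc μ.real {ω | maxInDegree parent n ω < k n}
      ≤ μ.real (Gᶜ ∪ G ∩ {ω | maxInDegree parent n ω < k n}) := by
        refine measureReal_mono fun ω hω => ?_
        by_cases h : ω ∈ G
        · exact Or.inr ⟨h, hω⟩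
        · exact Or.inl h
    _ ≤ _ := measureReal_union_le _ _
    _ ≤ _ := by
        refine add_le_add le_rfl (hmain.trans ?_)
        exact div_le_div_of_nonneg_left (by norm_num) hMpos hMle

end WRT

/-! ### Reduction of the limit theorems to the defect. -/

namespace WRT

variable {Ω : Type*} [mΩ : MeasurableSpace Ω] {μ : Measure Ω} {ν : Measure ℝ} {W : ℕ → Ω → ℝ}
  {parent : ℕ → Ω → ℕ}

lemma WeightLaw.degTail_pos (hν : WeightLaw ν) (k : ℕ) : 0 < degTail ν k := by
  have := hν.isProbabilityMeasure
  have hs0 : 0 < theta ν - 1 := by rw [theta_sub_one]; exact hν.integral_pos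
  have hpos : ∀ᵐ w ∂ν, 0 < (w / (w + (theta ν - 1))) ^ k := by
    filter_upwards [hν.pos] with w hw
    positivity
  refine lt_of_le_of_ne (integral_nonneg_of_ae (hpos.mono fun w hw => hw.le)) fun h => ?_
  have h0 := (integral_eq_zero_iff_of_nonneg_ae (hpos.mono fun w hw => hw.le)
    (hν.integrable_degTail k)).1 h.symm
  obtain ⟨w, h1, h2⟩ := (hpos.and h0).exists
  exact h1.ne' h2

lemma WeightLaw.one_lt_theta (hν : WeightLaw ν) : 1 < theta ν := by
  have : 0 < theta ν - 1 := by rw [theta_sub_one]; exact hν.integral_pos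
  linarith

/-- The exponential correction of `degTail ν k` with respect to `θ ^ (-k)`. -/
noncomputable def defect (ν : Measure ℝ) (k : ℕ) : ℝ :=
  -Real.log (degTail ν k) - k * Real.log (theta ν)

/-- In units of `B`, the exponent separates into the distance of `k` from the centring `log_θ n - A`
and the error of `A` as an approximation of `defect / log θ`. -/
lemma WeightLaw.mul_degTail_eq (hν : WeightLaw ν) {A B : ℝ} (hB : B ≠ 0) {n : ℕ} (hn : 0 < n)
    (k : ℕ) :
    n * degTail ν k = Real.exp (-(Real.log (theta ν) * B *
      ((k - (Real.logb (theta ν) n - A)) / B + (defect ν k / Real.log (theta ν) - A) / B))) := by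
  have hl : Real.log (theta ν) ≠ 0 := (Real.log_pos hν.one_lt_theta).ne'
  have hn' : (0 : ℝ) < n := by exact_mod_cast hn
  have hp := hν.degTail_pos k
  rw [← Real.exp_log (mul_pos hn' hp), Real.log_mul hn'.ne' hp.ne']
  congr 1
  unfold defect Real.logb
  field_simp
  ring

lemma WeightLaw.tendsto_div_log (hν : WeightLaw ν) {A B : ℕ → ℝ}
    (hA : Tendsto (fun n : ℕ => A n / Real.log n) atTop (𝓝 0))
    (hBl : Tendsto (fun n : ℕ => B n / Real.log n) atTop (𝓝 0)) {k : ℕ → ℕ} {C : ℝ}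
    (hk : ∀ᶠ n : ℕ in atTop, |(k n : ℝ) - (Real.logb (theta ν) n - A n)| ≤ C * B n) :
    Tendsto (fun n : ℕ => (k n : ℝ) / Real.log n) atTop (𝓝 (1 / Real.log (theta ν))) := by
  have h1 : Tendsto (fun n : ℕ => ((k n : ℝ) - (Real.logb (theta ν) n - A n)) / Real.log n) atTop
      (𝓝 0) := by
    have hC := hBl.const_mul C
    rw [mul_zero] at hC
    refine squeeze_zero_norm' ?_ hC
    filter_upwards [hk, tendsto_log_natCast.eventually_gt_atTop 0] with n h1 h2
    rw [Real.norm_eq_abs, abs_div, abs_of_pos h2, ← mul_div_assoc]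
    gcongr
  have h2 := (h1.add_const (1 / Real.log (theta ν))).sub hA
  rw [zero_add, sub_zero] at h2
  refine h2.congr' ?_
  have hl : Real.log (theta ν) ≠ 0 := (Real.log_pos hν.one_lt_theta).ne'
  filter_upwards [tendsto_log_natCast.eventually_gt_atTop 0] with n hn
  unfold Real.logb
  field_simp
  ring

/-- Convergence in probability of the maximum in-degree, from the behaviour of `defect`. -/
lemma IsWRT.tendstoInMeasure_of_defect [IsProbabilityMeasure μ] (hG : IsWRT μ ν W parent)
    (hν : WeightLaw ν) {A B : ℕ → ℝ} (hB : Tendsto B atTop atTop)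
    (hA : Tendsto (fun n : ℕ => A n / Real.log n) atTop (𝓝 0))
    (hBl : Tendsto (fun n : ℕ => B n / Real.log n) atTop (𝓝 0))
    (hf : ∀ (k : ℕ → ℕ) (C : ℝ),
      (∀ᶠ n : ℕ in atTop, |(k n : ℝ) - (Real.logb (theta ν) n - A n)| ≤ C * B n) →
      Tendsto (fun n => (defect ν (k n) / Real.log (theta ν) - A n) / B n) atTop (𝓝 0))
    {X : ℕ → Ω → ℝ} {c : ℝ} (hX : ∀ᶠ n : ℕ in atTop, ∀ ω, X n ω - c
      = ((maxInDegree parent n ω : ℝ) - (Real.logb (theta ν) n - A n)) / B n) :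
    TendstoInMeasure μ X atTop fun _ => c := by
  have hl : 0 < Real.log (theta ν) := Real.log_pos hν.one_lt_theta
  rw [tendstoInMeasure_iff_measureReal_norm]
  intro ε hε
  set D : ℕ → ℝ := fun n => Real.logb (theta ν) n - A n with hD
  -- Nonnegativity guarantees that the natural-number ceilings below do not truncate.
  have hDpos : ∀ᶠ n : ℕ in atTop, 0 ≤ D n - ε * B n := by
    have h : Tendsto (fun n : ℕ => 1 / Real.log (theta ν) - A n / Real.log n
        - ε * (B n / Real.log n)) atTop (𝓝 (1 / Real.log (theta ν) - 0 - ε * 0)) :=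
      (hA.const_sub _).sub (hBl.const_mul ε)
    have h0 : 0 < 1 / Real.log (theta ν) - 0 - ε * 0 := by simp [hl]
    filter_upwards [h.eventually (lt_mem_nhds h0), tendsto_log_natCast.eventually_gt_atTop 0]
      with n h1 h2
    have h3 : D n - ε * B n = (1 / Real.log (theta ν) - A n / Real.log n
        - ε * (B n / Real.log n)) * Real.log n := by
      simp only [hD, Real.logb]; field_simp
    rw [h3]
    positivity
  set kU : ℕ → ℕ := fun n => ⌈D n + ε * B n⌉₊ with hkU
  -- The offset is `ε / 2` rather than `ε`: a deviation of `-ε B` then lies below `kL`, and rounding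
  -- up by at most one still leaves `kL ≤ D - (ε / 4) B` once `B ≥ 4 / ε`.
  set kL : ℕ → ℕ := fun n => ⌈D n - ε / 2 * B n⌉₊ with hkL
  have hU : ∀ᶠ n : ℕ in atTop, |(kU n : ℝ) - (Real.logb (theta ν) n - A n)| ≤ (ε + 1) * B n ∧
      ε ≤ ((kU n : ℝ) - (Real.logb (theta ν) n - A n)) / B n := by
    filter_upwards [hDpos, hB.eventually_ge_atTop 1] with n h1 h2
    have h3 : D n + ε * B n ≤ kU n := Nat.le_ceil _
    have h4 : (kU n : ℝ) < D n + ε * B n + 1 := Nat.ceil_lt_add_one (by nlinarith)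
    change |(kU n : ℝ) - D n| ≤ _ ∧ ε ≤ ((kU n : ℝ) - D n) / B n
    refine ⟨abs_le.2 ⟨?_, by linarith⟩, ?_⟩
    · nlinarith
    · rw [le_div_iff₀ (by linarith)]; linarith
  have hL : ∀ᶠ n : ℕ in atTop, |(kL n : ℝ) - (Real.logb (theta ν) n - A n)| ≤ (ε + 1) * B n ∧
      ((kL n : ℝ) - (Real.logb (theta ν) n - A n)) / B n ≤ -(ε / 4) := by
    filter_upwards [hDpos, hB.eventually_ge_atTop (max 1 (4 / ε))] with n h1 h2
    have hB1 : 1 ≤ B n := (le_max_left _ _).trans h2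
    have hB2 : 4 ≤ B n * ε := by
      have := (le_max_right _ _).trans h2
      rwa [div_le_iff₀ hε] at this
    have h3 : D n - ε / 2 * B n ≤ kL n := Nat.le_ceil _
    have h4 : (kL n : ℝ) < D n - ε / 2 * B n + 1 := Nat.ceil_lt_add_one (by nlinarith)
    change |(kL n : ℝ) - D n| ≤ _ ∧ ((kL n : ℝ) - D n) / B n ≤ _
    refine ⟨abs_le.2 ⟨?_, ?_⟩, ?_⟩
    · nlinarith
    · nlinarith
    · rw [div_le_iff₀ (by linarith)]; linarith
  have hU1 := hU.mono fun _ h => h.1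
  have hL1 := hL.mono fun _ h => h.1
  have hdU := hf kU _ hU1
  have hdL := hf kL _ hL1
  have hpU : Tendsto (fun n : ℕ => n * degTail ν (kU n)) atTop (𝓝 0) := by
    have hexp : Tendsto (fun n => Real.exp (-(Real.log (theta ν) * (ε / 2) * B n))) atTop (𝓝 0) :=
      Real.tendsto_exp_neg_atTop_nhds_zero.comp (hB.const_mul_atTop (by positivity))
    refine squeeze_zero' (Eventually.of_forall fun n =>
      mul_nonneg (Nat.cast_nonneg n) (hν.degTail_pos _).le) ?_ hexp
    filter_upwards [hU, hdU.eventually (lt_mem_nhds (show -(ε / 2) < 0 by linarith)),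
      hB.eventually_gt_atTop 0, eventually_gt_atTop 0] with n h1 h2 h3 h4
    rw [hν.mul_degTail_eq (A := A n) h3.ne' h4 (kU n)]
    refine Real.exp_le_exp.2 (neg_le_neg ?_)
    rw [mul_right_comm]
    exact mul_le_mul_of_nonneg_left (by linarith [h1.2]) (by positivity)
  have hpL : Tendsto (fun n : ℕ => n * degTail ν (kL n)) atTop atTop := by
    have hexp : Tendsto (fun n => Real.exp (Real.log (theta ν) * (ε / 8) * B n)) atTop atTop :=
      Real.tendsto_exp_atTop.comp (hB.const_mul_atTop (by positivity))
    refine tendsto_atTop_mono' _ ?_ hexp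
    filter_upwards [hL, hdL.eventually (gt_mem_nhds (show 0 < ε / 8 by linarith)),
      hB.eventually_gt_atTop 0, eventually_gt_atTop 0] with n h1 h2 h3 h4
    rw [hν.mul_degTail_eq (A := A n) h3.ne' h4 (kL n)]
    refine Real.exp_le_exp.2 ?_
    rw [mul_right_comm, ← mul_neg]
    exact mul_le_mul_of_nonneg_left (by linarith [h1.2]) (by positivity)
  have tU := hG.tendsto_measure_le_maxInDegree hν (hν.tendsto_div_log hA hBl hU1) hpU
  have tL := hG.tendsto_measure_maxInDegree_lt hν (hν.tendsto_div_log hA hBl hL1) hpL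
  have ht := tU.add tL
  rw [add_zero] at ht
  refine squeeze_zero' (Eventually.of_forall fun n => measureReal_nonneg) ?_ ht
  filter_upwards [hX, hDpos, hB.eventually_gt_atTop 0] with n hXn hDn hBn
  refine le_trans (measureReal_mono fun ω hω => ?_) (measureReal_union_le _ _)
  have hω' : ε ≤ |((maxInDegree parent n ω : ℝ) - D n) / B n| := by
    have : ε ≤ ‖X n ω - c‖ := hω
    rwa [hXn ω, Real.norm_eq_abs] at this
  rcases le_abs'.1 hω' with h | h
  · right
    rw [div_le_iff₀ hBn] at h
    change maxInDegree parent n ω < kL n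
    refine Nat.lt_ceil.2 ?_
    nlinarith [mul_pos hε hBn]
  · left
    rw [le_div_iff₀ hBn] at h
    change kU n ≤ maxInDegree parent n ω
    exact Nat.ceil_le.2 (by linarith)

end WRT

/-! ### Laplace bounds for the defect. -/

namespace WRT

variable {ν : Measure ℝ}

lemma WeightLaw.log_theta_pos (hν : WeightLaw ν) : 0 < Real.log (theta ν) :=
  Real.log_pos hν.one_lt_theta

/-- The constant `1 - θ⁻¹`. -/
noncomputable def decay (ν : Measure ℝ) : ℝ := 1 - (theta ν)⁻¹

lemma WeightLaw.decay_pos (hν : WeightLaw ν) : 0 < decay ν :=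
  sub_pos.2 (inv_lt_one_of_one_lt₀ hν.one_lt_theta)

lemma WeightLaw.decay_le_one (hν : WeightLaw ν) : decay ν ≤ 1 := by
  have : 0 < (theta ν)⁻¹ := inv_pos.2 (zero_lt_one.trans hν.one_lt_theta)
  unfold decay; linarith

/-- `decay` is the logarithmic derivative of `w ↦ w / (w + θ - 1)` at `w = 1`. After clearing the
denominator, the tangent line `1 - A (1 - w)` exceeds the function by `θ⁻¹ (θ - 1) (1 - w) ^ 2`. -/
lemma WeightLaw.theta_mul_div_le (hν : WeightLaw ν) {w : ℝ} (hw : 0 < w) :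
    theta ν * (w / (w + (theta ν - 1))) ≤ Real.exp (-(decay ν * (1 - w))) := by
  have hθ := hν.one_lt_theta
  refine le_trans ?_ (Real.add_one_le_exp _)
  unfold decay
  have h1 : 0 < w + (theta ν - 1) := by linarith
  rw [← mul_div_assoc, div_le_iff₀ h1]
  have h2 : 0 < theta ν := by linarith
  have h3 : (-((1 - (theta ν)⁻¹) * (1 - w)) + 1) * (w + (theta ν - 1)) - theta ν * w
      = (theta ν)⁻¹ * (theta ν - 1) * (1 - w) ^ 2 := by
    field_simp
    ring
  have h4 : 0 ≤ (theta ν)⁻¹ * (theta ν - 1) * (1 - w) ^ 2 := by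
    have : 0 ≤ theta ν - 1 := by linarith
    positivity
  linarith

lemma pow_mul_degTail (ν : Measure ℝ) (k : ℕ) :
    theta ν ^ k * degTail ν k = ∫ w, (theta ν * (w / (w + (theta ν - 1)))) ^ k ∂ν := by
  unfold degTail
  rw [← integral_const_mul]
  congr 1
  funext w
  rw [mul_pow]

lemma WeightLaw.defect_eq (hν : WeightLaw ν) (k : ℕ) :
    defect ν k = -Real.log (theta ν ^ k * degTail ν k) := by
  have hθ : 0 < theta ν := zero_lt_one.trans hν.one_lt_theta
  rw [Real.log_mul (by positivity) (hν.degTail_pos k).ne', Real.log_pow]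
  unfold defect
  ring

/-- Lower bound for `defect` in terms of the tail of the weight law. -/
lemma WeightLaw.le_defect (hν : WeightLaw ν) {k : ℕ} (hk : 1 ≤ k) {ε B : ℝ} (hε : 0 < ε)
    (hB : ∀ x : ℝ, 0 < x → x ≤ decay ν * k →
      ν.real (Set.Ioi (1 - 1 / x)) ≤ Real.exp ((1 - ε) * (decay ν * k / x) - B)) :
    B - 1 + Real.log ε ≤ defect ν k := by
  have := hν.isProbabilityMeasure
  have hA := hν.decay_pos
  have hA1 := hν.decay_le_one
  have hk0 : (0 : ℝ) < k := by exact_mod_cast hk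
  set A := decay ν with hAdef
  have hAk : 0 < A * k := by positivity
  set r := Real.exp (-ε) with hr
  have hr1 : r < 1 := by
    rw [hr, ← Real.exp_zero]
    exact Real.exp_lt_exp.2 (by linarith)
  -- `S j` consists of the `w` with `A k (1 - w) < j + 1`. Slicing by the integer part `j` of `A k
  -- (1 - w)` bounds the integrand by `exp (-j)` and reduces its integral to tails at `x = A k / (j
  -- + 1)`.
  set S : ℕ → Set ℝ := fun j => Set.Ioi (1 - 1 / (A * k / (j + 1))) with hS
  have hSm : ∀ j, MeasurableSet (S j) := fun j => measurableSet_Ioi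
  have hint : ∀ j : ℕ, Integrable (fun w => Real.exp (-j) * (S j).indicator 1 w) ν := fun j =>
    ((integrable_const (1 : ℝ)).indicator (hSm j)).const_mul _
  have hpt : ∀ᵐ w ∂ν, (theta ν * (w / (w + (theta ν - 1)))) ^ k
      ≤ ∑ j ∈ Finset.range (k + 1), Real.exp (-j) * (S j).indicator 1 w := by
    filter_upwards [hν.ae_mem] with w hw
    have hs0 : 0 < theta ν - 1 := by have := hν.one_lt_theta; linarith
    have hq : 0 ≤ theta ν * (w / (w + (theta ν - 1))) := by
      have := hw.1
      have h2 : 0 < theta ν := by linarith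
      positivity
    set z := A * k * (1 - w) with hz
    have hz0 : 0 ≤ z := mul_nonneg hAk.le (by linarith [hw.2])
    -- As `A ≤ 1` and `w > 0`, the slices `0, …, k` suffice, and only `x ≤ A k` enters.
    have hzk : z ≤ k := by
      have : (1 - w) ≤ 1 := by linarith [hw.1]
      calc z ≤ A * k * 1 := mul_le_mul_of_nonneg_left this hAk.le
        _ ≤ k := by nlinarith
    have hjk : ⌊z⌋₊ ∈ Finset.range (k + 1) := by
      rw [Finset.mem_range, Nat.lt_succ_iff]
      exact Nat.floor_le_of_le hzk
    have hnn : ∀ j ∈ Finset.range (k + 1), 0 ≤ Real.exp (-(j : ℝ)) * (S j).indicator 1 w :=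
      fun j _ => mul_nonneg (Real.exp_nonneg _) (Set.indicator_nonneg (fun _ _ => zero_le_one) w)
    refine le_trans ?_ (Finset.single_le_sum hnn hjk)
    have hmem : w ∈ S ⌊z⌋₊ := by
      have h1 : z < ⌊z⌋₊ + 1 := Nat.lt_floor_add_one z
      rw [hS, Set.mem_Ioi, one_div_div, sub_lt_comm, lt_div_iff₀ hAk]
      linarith
    rw [Set.indicator_of_mem hmem, Pi.one_apply, mul_one]
    calc (theta ν * (w / (w + (theta ν - 1)))) ^ k ≤ (Real.exp (-(A * (1 - w)))) ^ k :=
          pow_le_pow_left₀ hq (hν.theta_mul_div_le hw.1) k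
      _ = Real.exp (-z) := by rw [← Real.exp_nat_mul, hz]; congr 1; ring
      _ ≤ _ := Real.exp_le_exp.2 (neg_le_neg (Nat.floor_le hz0))
  -- The hypothesis spends only the fraction `1 - ε` of the exponential decay. The remaining factor
  -- `exp (-ε (j + 1))` makes the slices summable, with sum at most `1 / ε`.
  have hterm : ∀ j ∈ Finset.range (k + 1), Real.exp (-(j : ℝ)) * ν.real (S j)
      ≤ Real.exp (1 - B) * r ^ (j + 1) := by
    intro j _
    have hj0 : (0 : ℝ) < j + 1 := by positivity
    have h := hB (A * k / (j + 1)) (by positivity) (div_le_self hAk.le (by linarith))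
    have hx : A * k / (A * k / (j + 1)) = j + 1 := by field_simp
    rw [hx] at h
    calc Real.exp (-(j : ℝ)) * ν.real (S j)
        ≤ Real.exp (-(j : ℝ)) * Real.exp ((1 - ε) * (j + 1) - B) :=
          mul_le_mul_of_nonneg_left h (Real.exp_nonneg _)
      _ = Real.exp (1 - B) * r ^ (j + 1) := by
          rw [hr, ← Real.exp_nat_mul, ← Real.exp_add, ← Real.exp_add]
          congr 1
          push_cast
          ring
  have hgeom : ∑ j ∈ Finset.range (k + 1), r ^ (j + 1) ≤ 1 / ε := by
    have h1 : ∑ j ∈ Finset.range (k + 1), r ^ (j + 1) = ∑ j ∈ Finset.Ico 1 (k + 2), r ^ j := by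
      rw [Finset.sum_Ico_eq_sum_range]
      exact Finset.sum_congr (by congr 1) fun j _ => by rw [add_comm]
    rw [h1]
    refine (geom_sum_Ico_le_of_lt_one (Real.exp_nonneg _) hr1).trans ?_
    rw [pow_one, div_le_div_iff₀ (by linarith) hε, one_mul]
    have h2 := Real.add_one_le_exp ε
    have h3 : r * Real.exp ε = 1 := by rw [hr, ← Real.exp_add]; simp
    have h4 : 0 < r := Real.exp_pos _
    nlinarith
  have hle : theta ν ^ k * degTail ν k ≤ Real.exp (1 - B) * (1 / ε) := by
    rw [pow_mul_degTail]
    have hInt : Integrable (fun w => (theta ν * (w / (w + (theta ν - 1)))) ^ k) ν := by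
      refine ((hν.integrable_degTail k).const_mul (theta ν ^ k)).congr (ae_of_all _ fun w => ?_)
      simp only [mul_pow]
    calc _ ≤ ∫ w, ∑ j ∈ Finset.range (k + 1), Real.exp (-j) * (S j).indicator 1 w ∂ν :=
          integral_mono_ae hInt (integrable_finsetSum _ fun j _ => hint j) hpt
      _ = ∑ j ∈ Finset.range (k + 1), Real.exp (-(j : ℝ)) * ν.real (S j) := by
          rw [integral_finsetSum _ fun j _ => hint j]
          refine Finset.sum_congr rfl fun j _ => ?_
          rw [integral_const_mul, integral_indicator_one (hSm j)]
      _ ≤ ∑ j ∈ Finset.range (k + 1), Real.exp (1 - B) * r ^ (j + 1) := Finset.sum_le_sum hterm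
      _ = Real.exp (1 - B) * ∑ j ∈ Finset.range (k + 1), r ^ (j + 1) := by rw [Finset.mul_sum]
      _ ≤ _ := mul_le_mul_of_nonneg_left hgeom (Real.exp_nonneg _)
  have hθ : 0 < theta ν := zero_lt_one.trans hν.one_lt_theta
  have hpos : 0 < theta ν ^ k * degTail ν k := mul_pos (by positivity) (hν.degTail_pos k)
  have hlog := Real.log_le_log hpos hle
  rw [Real.log_mul (Real.exp_ne_zero _) (by positivity), Real.log_exp, one_div, Real.log_inv]
    at hlog
  rw [hν.defect_eq]
  linarith

/-- Upper bound for `defect` in terms of the tail of the weight law. -/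
lemma WeightLaw.defect_le (hν : WeightLaw ν) (k : ℕ) {x : ℝ} (hx : 1 < x)
    (hpos : 0 < ν.real (Set.Ici (1 - 1 / x))) :
    defect ν k ≤ decay ν * k / (x - 1) - Real.log (ν.real (Set.Ici (1 - 1 / x))) := by
  have := hν.isProbabilityMeasure
  have hθ1 := hν.one_lt_theta
  have hθ : 0 < theta ν := by linarith
  have hs0 : 0 < theta ν - 1 := by linarith
  have hx0 : 0 < x := by linarith
  have hx1 : 0 < x - 1 := by linarith
  set w₀ := 1 - 1 / x with hw0
  have hw0pos : 0 < w₀ := by rw [hw0]; have : 1 / x < 1 := (div_lt_one hx0).2 hx; linarith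
  set q := theta ν * (w₀ / (w₀ + (theta ν - 1))) with hq
  have hqpos : 0 < q := by positivity
  -- `1 / q - 1` equals `A / (x - 1)` exactly, which is why `x - 1` rather than `x` appears in the
  -- bound.
  have hqle : Real.exp (-(decay ν / (x - 1))) ≤ q := by
    rw [Real.exp_neg, inv_le_comm₀ (Real.exp_pos _) hqpos]
    refine le_trans (le_of_eq ?_) (Real.add_one_le_exp _)
    rw [hq, hw0]
    unfold decay
    have : 1 - 1 / x + (theta ν - 1) ≠ 0 := by rw [← hw0]; positivity
    have h2 : 1 - 1 / x ≠ 0 := by rw [← hw0]; positivity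
    have h3 : 1 - 1 / x = (x - 1) / x := by field_simp
    rw [h3]
    field_simp
    ring
  have hInt : Integrable (fun w => (theta ν * (w / (w + (theta ν - 1)))) ^ k) ν := by
    refine ((hν.integrable_degTail k).const_mul (theta ν ^ k)).congr (ae_of_all _ fun w => ?_)
    simp only [mul_pow]
  -- Only the weights from `w₀` upwards are kept; there the integrand is at least its value at `w₀`.
  have hle : q ^ k * ν.real (Set.Ici w₀) ≤ theta ν ^ k * degTail ν k := by
    rw [pow_mul_degTail, ← integral_indicator_one (measurableSet_Ici (a := w₀)),
      ← integral_const_mul]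
    refine integral_mono_ae (((integrable_const (1 : ℝ)).indicator
      measurableSet_Ici).const_mul _) hInt ?_
    filter_upwards [hν.pos] with w hw
    by_cases h : w ∈ Set.Ici w₀
    · simp only [Set.indicator_of_mem h, Pi.one_apply, mul_one]
      have h' : w₀ ≤ w := h
      refine pow_le_pow_left₀ hqpos.le ?_ k
      rw [hq]
      refine mul_le_mul_of_nonneg_left ?_ hθ.le
      rw [div_le_div_iff₀ (by positivity) (by positivity)]
      nlinarith
    · simp only [Set.indicator_of_notMem h, mul_zero]
      positivity
  have hlog := Real.log_le_log (mul_pos (pow_pos hqpos k) hpos) hle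
  rw [Real.log_mul (pow_pos hqpos k).ne' hpos.ne', Real.log_pow] at hlog
  have hlq : -(decay ν / (x - 1)) ≤ Real.log q := by
    rw [Real.le_log_iff_exp_le hqpos]; exact hqle
  have h5 := mul_le_mul_of_nonneg_left hlq (Nat.cast_nonneg (α := ℝ) k)
  rw [hν.defect_eq]
  have h6 : decay ν * k / (x - 1) = k * (decay ν / (x - 1)) := by ring
  rw [h6]
  linarith

end WRT

/-! ### Weibull case: the defect. -/

namespace WRT

variable {ν : Measure ℝ}

lemma one_sub_one_div_mono {x y : ℝ} (hx : 0 < x) (hxy : x ≤ y) : 1 - 1 / x ≤ 1 - 1 / y := by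
  have := one_div_le_one_div_of_le hx hxy
  linarith

/-- The regularly varying tail of the Weibull case, on logarithmic scale. -/
lemma WeibullCase.tendsto_log_tail [IsProbabilityMeasure ν] {α : ℝ} {l : ℝ → ℝ}
    (h : WeibullCase ν α l) :
    Tendsto (fun x : ℝ => Real.log (ν.real (Set.Ici (1 - 1 / x))) / Real.log x) atTop
      (𝓝 (-(α - 1))) := by
  set T : ℝ → ℝ := fun x => ν.real (Set.Ici (1 - 1 / x)) with hT
  have hTpos : ∀ x, 1 ≤ x → 0 < T x := fun x hx => by
    rw [hT]
    simp only [h.tail x hx]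
    exact mul_pos (h.pos x hx) (Real.rpow_pos_of_pos (by linarith) _)
  have hT1 : ∀ x, T x ≤ 1 := fun x => measureReal_le_one
  have hanti : ∀ x y, 0 < x → x ≤ y → T y ≤ T x := fun x y hx hxy =>
    measureReal_mono (Set.Ici_subset_Ici.2 (one_sub_one_div_mono hx hxy))
  set g : ℕ → ℝ := fun j => Real.log (T (2 ^ j)) with hg
  have h2pow : ∀ j : ℕ, (1 : ℝ) ≤ 2 ^ j := fun j => one_le_pow₀ one_le_two
  have hl2 : 0 < Real.log 2 := Real.log_pos one_lt_two
  -- Slow variation is used only for the ratio `2`: Cesàro averaging of these increments gives the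
  -- limit along powers of two.
  have hstep : Tendsto (fun j : ℕ => g (j + 1) - g j) atTop (𝓝 (-(α - 1) * Real.log 2)) := by
    have h1 : Tendsto (fun j : ℕ => Real.log (l (2 * 2 ^ j) / l (2 ^ j))) atTop (𝓝 0) := by
      have := (h.slowlyVarying 2 two_pos).comp (tendsto_pow_atTop_atTop_of_one_lt
        (one_lt_two (α := ℝ)))
      have h3 := (Real.continuousAt_log one_ne_zero).tendsto.comp this
      rwa [Real.log_one] at h3
    have h2 := h1.add_const (-(α - 1) * Real.log 2)
    rw [zero_add] at h2
    refine h2.congr fun j => ?_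
    have hj := h2pow j
    have hj1 := h2pow (j + 1)
    have e : (2 : ℝ) * 2 ^ j = 2 ^ (j + 1) := by ring
    simp only [hg, hT, h.tail _ hj, h.tail _ hj1]
    rw [e, Real.log_div (h.pos _ hj1).ne' (h.pos _ hj).ne',
      Real.log_mul (h.pos _ hj1).ne' (Real.rpow_pos_of_pos (by linarith) _).ne',
      Real.log_mul (h.pos _ hj).ne' (Real.rpow_pos_of_pos (by linarith) _).ne',
      Real.log_rpow (by linarith), Real.log_rpow (by linarith), Real.log_pow, Real.log_pow]
    push_cast
    ring
  have hces : Tendsto (fun j : ℕ => g j / j) atTop (𝓝 (-(α - 1) * Real.log 2)) := by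
    have h1 := hstep.cesaro
    have h2 : Tendsto (fun j : ℕ => g 0 / (j : ℝ)) atTop (𝓝 0) :=
      tendsto_const_nhds.div_atTop tendsto_natCast_atTop_atTop
    have h3 := h1.add h2
    rw [add_zero] at h3
    refine h3.congr fun j => ?_
    rw [Finset.sum_range_sub]
    ring
  set J : ℝ → ℕ := fun x => ⌊1 / Real.log 2 * Real.log x⌋₊ with hJ
  have hJlim : Tendsto (fun x => (J x : ℝ) / Real.log x) atTop (𝓝 (1 / Real.log 2)) :=
    (tendsto_nat_floor_mul_div_atTop (by positivity)).comp Real.tendsto_log_atTop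
  have hJtop : Tendsto J atTop atTop :=
    tendsto_nat_floor_atTop.comp (Real.tendsto_log_atTop.const_mul_atTop (by positivity))
  have hinv : Tendsto (fun x : ℝ => 1 / Real.log x) atTop (𝓝 0) :=
    tendsto_const_nhds.div_atTop Real.tendsto_log_atTop
  have hval : -(α - 1) * Real.log 2 * (1 / Real.log 2) = -(α - 1) := by field_simp
  have hup : Tendsto (fun x => g (J x) / Real.log x) atTop (𝓝 (-(α - 1))) := by
    have := (hces.comp hJtop).mul hJlim
    rw [hval] at this
    refine this.congr' ?_
    filter_upwards [hJtop.eventually_gt_atTop 0] with x hx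
    have : (0 : ℝ) < J x := by exact_mod_cast hx
    simp only [Function.comp]
    field_simp
  have hlow : Tendsto (fun x => g (J x + 1) / Real.log x) atTop (𝓝 (-(α - 1))) := by
    have hJ1 : Tendsto (fun x => J x + 1) atTop atTop := (tendsto_add_atTop_nat 1).comp hJtop
    have h1 := hJlim.add hinv
    rw [add_zero] at h1
    have := (hces.comp hJ1).mul h1
    rw [hval] at this
    refine this.congr fun x => ?_
    have : (0 : ℝ) < (J x : ℝ) + 1 := by positivity
    simp only [Function.comp]
    push_cast
    rw [← add_div]
    field_simp
  -- Monotonicity of the tail fills the gaps between `2 ^ J x` and `2 ^ (J x + 1)`, which enclose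
  -- `x`.
  refine tendsto_of_tendsto_of_tendsto_of_le_of_le' hlow hup ?_ ?_
  · filter_upwards [eventually_ge_atTop (2 : ℝ)] with x hx
    have hx0 : 0 < x := by linarith
    have hlx : 0 < Real.log x := Real.log_pos (by linarith)
    refine div_le_div_of_nonneg_right (Real.log_le_log (hTpos _ (h2pow _)) ?_) hlx.le
    refine hanti _ _ hx0 ?_
    have h1 : 1 / Real.log 2 * Real.log x < (J x : ℝ) + 1 := Nat.lt_floor_add_one _
    rw [one_div, inv_mul_lt_iff₀ hl2] at h1
    rw [← Real.log_le_log_iff hx0 (by positivity), Real.log_pow]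
    push_cast
    linarith
  · filter_upwards [eventually_ge_atTop (2 : ℝ)] with x hx
    have hx0 : 0 < x := by linarith
    have hlx : 0 < Real.log x := Real.log_pos (by linarith)
    refine div_le_div_of_nonneg_right (Real.log_le_log (hTpos _ (by linarith)) ?_) hlx.le
    refine hanti _ _ (by positivity) ?_
    have h1 : (J x : ℝ) ≤ 1 / Real.log 2 * Real.log x := Nat.floor_le (by positivity)
    rw [one_div, le_inv_mul_iff₀ hl2] at h1
    rw [← Real.log_le_log_iff (by positivity) hx0, Real.log_pow]
    linarith

/-- The minimum over `x` of `A k / x + (α - 1) log x` is attained at `x` of order `k`, with value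
`(α - 1) log k + O(1)`. Constant factors in `x` do not matter at this precision, so `x = k` serves
for the upper bound. -/
lemma WeibullCase.tendsto_defect (hν : WeightLaw ν) {α : ℝ} {l : ℝ → ℝ}
    (h : WeibullCase ν α l) :
    Tendsto (fun k : ℕ => defect ν k / Real.log k) atTop (𝓝 (α - 1)) := by
  have := hν.isProbabilityMeasure
  have hA := hν.decay_pos
  have htail := h.tendsto_log_tail
  have hβ : 0 < α - 1 := by linarith [h.one_lt]
  rw [tendsto_order]
  constructor
  · intro b' hb'
    obtain ⟨b, hb1, hb2⟩ := exists_between (max_lt hb' hβ)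
    have hb0 : 0 < b := (le_max_right _ _).trans_lt hb1
    have hbb : b' < b := (le_max_left _ _).trans_lt hb1
    obtain ⟨x₀, hx₀⟩ := eventually_atTop.1 ((htail.eventually (gt_mem_nhds
      (show -(α - 1) < -b by linarith))).and (eventually_ge_atTop (2 : ℝ)))
    set y := max x₀ 2 with hy
    have hy1 : (2 : ℝ) ≤ y := le_max_right _ _
    -- Below `y` the tail is bounded by one; the constant `b log y` keeps the estimate valid for all
    -- `x > 0`.
    have hT : ∀ x : ℝ, 0 < x →
        ν.real (Set.Ioi (1 - 1 / x)) ≤ Real.exp (b * Real.log y - b * Real.log x) := by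
      intro x hx
      rcases le_total y x with hxy | hxy
      · obtain ⟨h1, h2⟩ := hx₀ x ((le_max_left _ _).trans hxy)
        have hlx : 0 < Real.log x := Real.log_pos (by linarith)
        rw [div_lt_iff₀ hlx] at h1
        have hpos : 0 < ν.real (Set.Ici (1 - 1 / x)) := by
          rw [h.tail x (by linarith)]
          exact mul_pos (h.pos x (by linarith)) (Real.rpow_pos_of_pos hx _)
        calc ν.real (Set.Ioi (1 - 1 / x)) ≤ ν.real (Set.Ici (1 - 1 / x)) :=
              measureReal_mono Set.Ioi_subset_Ici_self
          _ = Real.exp (Real.log (ν.real (Set.Ici (1 - 1 / x)))) := (Real.exp_log hpos).symm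
          _ ≤ _ := by
              refine Real.exp_le_exp.2 ?_
              have : 0 ≤ b * Real.log y := mul_nonneg hb0.le (Real.log_nonneg (by linarith))
              linarith
      · refine measureReal_le_one.trans (Real.one_le_exp ?_)
        have := Real.log_le_log hx hxy
        nlinarith
    set A := decay ν with hAdef
    set C := b * Real.log y - b * Real.log (A / (2 * b)) with hC
    have hlow : ∀ k : ℕ, 1 ≤ k →
        b * Real.log k - C - 1 + Real.log (1 / 2) ≤ defect ν k := by
      intro k hk
      have hk0 : (0 : ℝ) < k := by exact_mod_cast hk
      refine hν.le_defect hk (by norm_num) fun x hx _ => (hT x hx).trans (Real.exp_le_exp.2 ?_)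
      -- `log u ≤ u - 1` at `u = A k / (2 b x)` bounds `A k / (2 x) + b log x` from below uniformly
      -- in `x`; the `2` comes from `ε = 1/2` in `WeightLaw.le_defect`.
      have h1 := Real.log_le_sub_one_of_pos (show 0 < A / (2 * b) * (k / x) by positivity)
      rw [Real.log_mul (by positivity) (by positivity), Real.log_div hk0.ne' hx.ne'] at h1
      have h2 := mul_le_mul_of_nonneg_left h1 hb0.le
      have h3 : b * (A / (2 * b) * (k / x) - 1) = (1 - 1 / 2) * (A * k / x) - b := by
        field_simp
        ring
      rw [h3] at h2
      rw [hC]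
      linarith
    have hlim : Tendsto (fun k : ℕ => b - (C + 1 - Real.log (1 / 2)) / Real.log k) atTop
        (𝓝 (b - 0)) :=
      (tendsto_const_nhds.div_atTop tendsto_log_natCast).const_sub b
    rw [sub_zero] at hlim
    filter_upwards [hlim.eventually (lt_mem_nhds hbb), eventually_ge_atTop 1,
      tendsto_log_natCast.eventually_gt_atTop 0] with k h1 h2 h3
    refine h1.trans_le ?_
    rw [le_div_iff₀ h3, sub_mul, div_mul_cancel₀ _ h3.ne']
    linarith [hlow k h2]
  · intro b hb
    have hup : ∀ k : ℕ, 2 ≤ k → defect ν k / Real.log k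
        ≤ decay ν * 2 / Real.log k
          - Real.log (ν.real (Set.Ici (1 - 1 / (k : ℝ)))) / Real.log k := by
      intro k hk
      have hk2 : (2 : ℝ) ≤ k := by exact_mod_cast hk
      have hpos : 0 < ν.real (Set.Ici (1 - 1 / (k : ℝ))) := by
        rw [h.tail k (by linarith)]
        exact mul_pos (h.pos _ (by linarith)) (Real.rpow_pos_of_pos (by linarith) _)
      rw [← sub_div]
      refine div_le_div_of_nonneg_right ?_ (Real.log_nonneg (by linarith))
      refine (hν.defect_le k (by linarith) hpos).trans (sub_le_sub_right ?_ _)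
      rw [div_le_iff₀ (by linarith)]
      nlinarith
    have hlim : Tendsto (fun k : ℕ => decay ν * 2 / Real.log k
        - Real.log (ν.real (Set.Ici (1 - 1 / (k : ℝ)))) / Real.log k) atTop
        (𝓝 (0 - -(α - 1))) :=
      (tendsto_const_nhds.div_atTop tendsto_log_natCast).sub
        (htail.comp tendsto_natCast_atTop_atTop)
    filter_upwards [hlim.eventually (gt_mem_nhds (show 0 - -(α - 1) < b by linarith)),
      eventually_ge_atTop 2] with k h1 h2
    exact (hup k h2).trans_lt h1

end WRT

/-! ### Gumbel-RV case: the defect. -/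

namespace WRT

variable {ν : Measure ℝ}

lemma tendsto_log_sub_log_of_isEquivalent {f g : ℝ → ℝ} (h : f ~[atTop] g)
    (hg : ∀ᶠ x in atTop, 0 < g x) :
    (∀ᶠ x in atTop, 0 < f x) ∧ Tendsto (fun x => Real.log (f x) - Real.log (g x)) atTop (𝓝 0) := by
  have h1 : Tendsto (f / g) atTop (𝓝 1) :=
    (isEquivalent_iff_tendsto_one (hg.mono fun x hx => hx.ne')).1 h
  have hf : ∀ᶠ x in atTop, 0 < f x := by
    filter_upwards [h1.eventually (lt_mem_nhds one_pos), hg] with x h2 h3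
    exact (div_pos_iff_of_pos_right h3).1 h2
  refine ⟨hf, ?_⟩
  have h2 := (Real.continuousAt_log one_ne_zero).tendsto.comp h1
  rw [Real.log_one] at h2
  refine h2.congr' ?_
  filter_upwards [hf, hg] with x h3 h4
  exact Real.log_div h3.ne' h4.ne'

/-- On the logarithmic scale the prefactor `a x ^ b` is negligible against `(x / c) ^ τ`. -/
lemma GumbelRVCase.tendsto_log_tail {a b c τ : ℝ} (h : GumbelRVCase ν a b c τ) :
    (∀ᶠ x : ℝ in atTop, 0 < ν.real (Set.Ioi (1 - 1 / x))) ∧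
    Tendsto (fun x : ℝ => Real.log (ν.real (Set.Ioi (1 - 1 / x))) / (x / c) ^ τ) atTop
      (𝓝 (-1)) := by
  have ha := h.a_pos
  have hc := h.c_pos
  have hτ := h.τ_pos
  obtain ⟨hpos, hlim⟩ := tendsto_log_sub_log_of_isEquivalent h.tail (by
    filter_upwards [eventually_gt_atTop (0 : ℝ)] with x hx
    exact mul_pos (mul_pos ha (Real.rpow_pos_of_pos hx _)) (Real.exp_pos _))
  refine ⟨hpos, ?_⟩
  have hden : Tendsto (fun x : ℝ => (x / c) ^ τ) atTop atTop :=
    (tendsto_rpow_atTop hτ).comp (tendsto_id.atTop_div_const hc)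
  have h1 : Tendsto (fun x : ℝ => (Real.log (ν.real (Set.Ioi (1 - 1 / x)))
      - Real.log (a * x ^ b * Real.exp (-(x / c) ^ τ))) / (x / c) ^ τ) atTop (𝓝 0) :=
    hlim.div_atTop hden
  have h2 : Tendsto (fun x : ℝ => Real.log a / (x / c) ^ τ) atTop (𝓝 0) :=
    tendsto_const_nhds.div_atTop hden
  have h3 : Tendsto (fun x : ℝ => b * (c ^ τ * (Real.log x / x ^ τ))) atTop
      (𝓝 (b * (c ^ τ * 0))) :=
    ((isLittleO_log_rpow_atTop hτ).tendsto_div_nhds_zero.const_mul _).const_mul _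
  have h4 := ((h1.add h2).add h3).add_const (-1)
  simp only [mul_zero, add_zero, zero_add] at h4
  refine h4.congr' ?_
  filter_upwards [eventually_gt_atTop (0 : ℝ)] with x hx
  have hx1 : 0 < x ^ τ := Real.rpow_pos_of_pos hx _
  have hc1 : 0 < c ^ τ := Real.rpow_pos_of_pos hc _
  rw [Real.log_mul (mul_pos ha (Real.rpow_pos_of_pos hx _)).ne' (Real.exp_ne_zero _),
    Real.log_mul ha.ne' (Real.rpow_pos_of_pos hx _).ne', Real.log_exp, Real.log_rpow hx,
    Real.div_rpow hx.le hc.le]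
  field_simp
  ring

/-- The minimum of `x ↦ K / x + (x / c) ^ τ` over `x > 0`. -/
noncomputable def rvMin (τ K c : ℝ) : ℝ :=
  τ ^ (1 / (1 + τ)) / (1 - 1 / (1 + τ)) * (K / c) ^ (1 - 1 / (1 + τ))

/-- Weighted arithmetic-geometric mean inequality with weights `1 - γ` and `γ`: as `τ γ = 1 - γ`,
the variable `x` cancels from the geometric mean. -/
lemma rvMin_le {τ K c x : ℝ} (hτ : 0 < τ) (hK : 0 < K) (hc : 0 < c) (hx : 0 < x) :
    rvMin τ K c ≤ K / x + (x / c) ^ τ := by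
  set γ := 1 / (1 + τ) with hγ
  have h1τ : 0 < 1 + τ := by linarith
  have hγ0 : 0 < γ := by positivity
  have hγτ : 1 - γ = τ * γ := by rw [hγ]; field_simp; ring
  have hγ1 : 0 < 1 - γ := by rw [hγτ]; positivity
  have hxc : 0 < x / c := by positivity
  have hxcτ : 0 < (x / c) ^ τ := Real.rpow_pos_of_pos hxc _
  have h := Real.geom_mean_le_arith_mean2_weighted hγ1.le hγ0.le
    (show 0 ≤ K / x / (1 - γ) by positivity) (show 0 ≤ (x / c) ^ τ / γ by positivity) (by ring)
  have e1 : (1 - γ) * (K / x / (1 - γ)) + γ * ((x / c) ^ τ / γ) = K / x + (x / c) ^ τ := by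
    field_simp
  rw [e1] at h
  refine le_trans (le_of_eq ?_) h
  have hγe : γ = (1 - γ) / τ := by rw [hγτ]; field_simp
  have e2 : ((x / c) ^ τ / γ) ^ γ = (x / c) ^ (1 - γ) * (τ ^ γ / (1 - γ) ^ γ) := by
    rw [Real.div_rpow hxcτ.le hγ0.le, ← Real.rpow_mul hxc.le, ← hγτ]
    nth_rewrite 2 [hγe]
    rw [Real.div_rpow hγ1.le hτ.le, div_div_eq_mul_div, mul_div_assoc]
  have e3 : (K / x / (1 - γ)) ^ (1 - γ) = (K / x) ^ (1 - γ) / (1 - γ) ^ (1 - γ) :=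
    Real.div_rpow (by positivity) hγ1.le _
  have e4 : (K / x) ^ (1 - γ) * (x / c) ^ (1 - γ) = (K / c) ^ (1 - γ) := by
    rw [← Real.mul_rpow (by positivity) hxc.le]
    congr 1
    field_simp
  have e5 : (1 - γ) ^ (1 - γ) * (1 - γ) ^ γ = 1 - γ := by
    rw [← Real.rpow_add hγ1]; simp
  have p1 : 0 < (1 - γ) ^ (1 - γ) := Real.rpow_pos_of_pos hγ1 _
  have p2 : 0 < (1 - γ) ^ γ := Real.rpow_pos_of_pos hγ1 _
  unfold rvMin
  rw [← hγ, e2, e3, ← e4,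
    show τ ^ γ / (1 - γ) = τ ^ γ / ((1 - γ) ^ (1 - γ) * (1 - γ) ^ γ) by rw [e5]]
  field_simp

/-- The critical point satisfies `(x / c) ^ (1 + τ) = K / (τ c)`. -/
lemma rvMin_eq {τ K c : ℝ} (hτ : 0 < τ) (hK : 0 < K) (hc : 0 < c) :
    K / (c * (K / (τ * c)) ^ (1 / (1 + τ))) + (c * (K / (τ * c)) ^ (1 / (1 + τ)) / c) ^ τ
      = rvMin τ K c := by
  set γ := 1 / (1 + τ) with hγ
  have h1τ : 0 < 1 + τ := by linarith
  have hγ0 : 0 < γ := by positivity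
  have hγτ : 1 - γ = τ * γ := by rw [hγ]; field_simp; ring
  have hγ1 : 0 < 1 - γ := by rw [hγτ]; positivity
  set v := K / (τ * c) with hv
  have hv0 : 0 < v := by positivity
  have e1 : (c * v ^ γ / c) ^ τ = v ^ (1 - γ) := by
    rw [mul_div_cancel_left₀ _ hc.ne', ← Real.rpow_mul hv0.le, hγτ, mul_comm]
  have hKe : K = τ * c * v := by rw [hv]; field_simp
  have hvγ : 0 < v ^ γ := Real.rpow_pos_of_pos hv0 _
  have e2 : v = v ^ (1 - γ) * v ^ γ := by rw [← Real.rpow_add hv0]; simp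
  have e3 : K / (c * v ^ γ) = τ * v ^ (1 - γ) := by
    rw [hKe]
    nth_rewrite 1 [e2]
    field_simp
  have e4 : K / c = τ * v := by rw [hKe]; field_simp
  have e5 : τ ^ γ * τ ^ (1 - γ) = τ := by rw [← Real.rpow_add hτ]; simp
  have e6 : (1 + τ) * (1 - γ) = τ := by rw [hγ]; field_simp; ring
  rw [e1, e3]
  unfold rvMin
  rw [← hγ, e4, Real.mul_rpow hτ.le hv0.le, div_mul_eq_mul_div, ← mul_assoc, e5, eq_div_iff hγ1.ne']
  linear_combination v ^ (1 - γ) * e6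

lemma rvMin_mul {τ A c k : ℝ} (hA : 0 < A) (hc : 0 < c) (hk : 0 ≤ k) :
    rvMin τ (A * k) c = rvMin τ A c * k ^ (1 - 1 / (1 + τ)) := by
  unfold rvMin
  rw [mul_div_right_comm, Real.mul_rpow (by positivity) hk, mul_assoc]

lemma GumbelRVCase.tendsto_defect (hν : WeightLaw ν) {a b c τ : ℝ}
    (h : GumbelRVCase ν a b c τ) :
    Tendsto (fun k : ℕ => defect ν k / (k : ℝ) ^ (1 - 1 / (1 + τ))) atTop
      (𝓝 (rvMin τ (decay ν) c)) := by
  have := hν.isProbabilityMeasure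
  have hA := hν.decay_pos
  have hc := h.c_pos
  have hτ := h.τ_pos
  obtain ⟨hTpos, htail⟩ := h.tendsto_log_tail
  set A := decay ν with hAdef
  set γ := 1 / (1 + τ) with hγ
  have h1τ : 0 < 1 + τ := by linarith
  have hγ0 : 0 < γ := by positivity
  have hγτ : 1 - γ = τ * γ := by rw [hγ]; field_simp; ring
  have hγ1 : 0 < 1 - γ := by rw [hγτ]; positivity
  set H := rvMin τ A c with hH
  have hHpos : 0 < H := by
    rw [hH]; unfold rvMin
    rw [← hγ]
    have h1 : 0 < τ ^ γ := Real.rpow_pos_of_pos hτ _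
    have h2 : 0 < (A / c) ^ (1 - γ) := Real.rpow_pos_of_pos (by positivity) _
    positivity
  have hkpow : Tendsto (fun k : ℕ => (k : ℝ) ^ (1 - γ)) atTop atTop :=
    (tendsto_rpow_atTop hγ1).comp tendsto_natCast_atTop_atTop
  rw [tendsto_order]
  constructor
  · intro t ht
    obtain ⟨u, hu1, hu2⟩ := exists_between (max_lt ht hHpos)
    have hu0 : 0 < u := (le_max_right _ _).trans_lt hu1
    have htu : t < u := (le_max_left _ _).trans_lt hu1
    -- One slack serves twice, as `ε` in `WeightLaw.le_defect` and as relative error of the tail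
    -- exponent. Both summands then carry the factor `1 - η`, and `(1 - η) H = u`.
    set η := 1 - u / H with hη
    have hη0 : 0 < η := sub_pos.2 ((div_lt_one hHpos).2 hu2)
    have hη1 : 0 < 1 - η := by rw [hη]; simp; positivity
    have huη : (1 - η) * H = u := by rw [hη]; field_simp; ring
    obtain ⟨x₀, hx₀⟩ := eventually_atTop.1 ((htail.eventually (gt_mem_nhds
      (show -1 < -(1 - η) by linarith))).and hTpos)
    set y := max x₀ 1 with hy
    have hy1 : (1 : ℝ) ≤ y := le_max_right _ _
    set C := (1 - η) * (y / c) ^ τ with hC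
    have hyc : 0 < (y / c) ^ τ := Real.rpow_pos_of_pos (by positivity) _
    have hC0 : 0 ≤ C := by positivity
    have hT : ∀ x : ℝ, 0 < x →
        ν.real (Set.Ioi (1 - 1 / x)) ≤ Real.exp (C - (1 - η) * (x / c) ^ τ) := by
      intro x hx
      have hxc : 0 < (x / c) ^ τ := Real.rpow_pos_of_pos (by positivity) _
      rcases le_total y x with hxy | hxy
      · obtain ⟨h1, h2⟩ := hx₀ x ((le_max_left _ _).trans hxy)
        rw [div_lt_iff₀ hxc] at h1
        rw [← Real.exp_log h2]
        exact Real.exp_le_exp.2 (by linarith)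
      · refine measureReal_le_one.trans (Real.one_le_exp ?_)
        have : (x / c) ^ τ ≤ (y / c) ^ τ :=
          Real.rpow_le_rpow (by positivity) (by gcongr) hτ.le
        rw [hC, ← mul_sub]
        exact mul_nonneg hη1.le (sub_nonneg.2 this)
    have hlow : ∀ k : ℕ, 1 ≤ k →
        u * (k : ℝ) ^ (1 - γ) - C - 1 + Real.log η ≤ defect ν k := by
      intro k hk
      have hk0 : (0 : ℝ) < k := by exact_mod_cast hk
      refine hν.le_defect hk hη0 fun x hx _ => (hT x hx).trans (Real.exp_le_exp.2 ?_)
      have h1 := rvMin_le hτ (mul_pos hA hk0) hc hx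
      rw [rvMin_mul hA hc hk0.le, ← hγ, ← hH] at h1
      have h2 := mul_le_mul_of_nonneg_left h1 hη1.le
      rw [← mul_assoc, huη] at h2
      linarith
    have hlim : Tendsto (fun k : ℕ => u - (C + 1 - Real.log η) / (k : ℝ) ^ (1 - γ)) atTop
        (𝓝 (u - 0)) :=
      (tendsto_const_nhds.div_atTop hkpow).const_sub u
    rw [sub_zero] at hlim
    filter_upwards [hlim.eventually (lt_mem_nhds htu), eventually_ge_atTop 1,
      hkpow.eventually_gt_atTop 0] with k h1 h2 h3
    refine h1.trans_le ?_
    rw [le_div_iff₀ h3, sub_mul, div_mul_cancel₀ _ h3.ne']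
    linarith [hlow k h2]
  · intro t ht
    obtain ⟨u, hu1, hu2⟩ := exists_between ht
    set η := u / H - 1 with hη
    have hη0 : 0 < η := sub_pos.2 ((one_lt_div hHpos).2 hu1)
    have huη : (1 + η) * H = u := by rw [hη]; field_simp; ring
    -- The minimiser from `rvMin_eq` with `K = A k`.
    set X : ℕ → ℝ := fun k => c * (A * k / (τ * c)) ^ γ with hX
    have hXtop : Tendsto X atTop atTop := by
      refine Tendsto.const_mul_atTop hc ((tendsto_rpow_atTop hγ0).comp ?_)
      exact (tendsto_natCast_atTop_atTop.const_mul_atTop hA).atTop_div_const (by positivity)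
    filter_upwards [hXtop.eventually hTpos, hXtop.eventually (htail.eventually (lt_mem_nhds
      (show -(1 + η) < -1 by linarith))), hXtop.eventually_ge_atTop (1 + 1 / η + 1),
      eventually_ge_atTop 1] with k h1 h2 h3 h4
    have hk0 : (0 : ℝ) < k := by exact_mod_cast h4
    have hkp : 0 < (k : ℝ) ^ (1 - γ) := Real.rpow_pos_of_pos hk0 _
    have hiη : 0 < 1 / η := by positivity
    have hX1 : 1 < X k := by linarith
    have hX0 : 0 < X k := by linarith
    have hXc : 0 < (X k / c) ^ τ := Real.rpow_pos_of_pos (by positivity) _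
    rw [lt_div_iff₀ hXc] at h2
    have hIci : ν.real (Set.Ioi (1 - 1 / X k)) ≤ ν.real (Set.Ici (1 - 1 / X k)) :=
      measureReal_mono Set.Ioi_subset_Ici_self
    have h5 := hν.defect_le k hX1 (h1.trans_le hIci)
    have h6 := Real.log_le_log h1 hIci
    -- Passing from `X - 1` to `X` costs a factor at most `1 + η` as soon as `X ≥ 1 + 1 / η`.
    have h7 : A * k / (X k - 1) ≤ (1 + η) * (A * k / X k) := by
      rw [← mul_div_assoc, div_le_div_iff₀ (by linarith) hX0]
      have h8 : X k ≤ (1 + η) * (X k - 1) := by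
        have h9 : 1 + 1 / η ≤ X k := by linarith
        have h10 := mul_le_mul_of_nonneg_left h9 hη0.le
        have h11 : η * (1 + 1 / η) = η + 1 := by field_simp
        linarith
      have := mul_le_mul_of_nonneg_left h8 (mul_pos hA hk0).le
      linarith
    have h8 := rvMin_eq hτ (mul_pos hA hk0) hc
    rw [rvMin_mul hA hc hk0.le, ← hγ, ← hH] at h8
    change A * k / X k + (X k / c) ^ τ = _ at h8
    refine lt_of_le_of_lt ?_ hu2
    rw [div_le_iff₀ hkp, ← huη, mul_assoc, ← h8]
    linarith

end WRT

/-! ### Gumbel-RaV case: effect of a bounded shift of the argument. -/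

namespace WRT

lemma hasDerivAt_rpow_one (p : ℝ) : HasDerivAt (fun t : ℝ => t ^ p) p 1 := by
  simpa using Real.hasDerivAt_rpow_const (x := 1) (p := p) (Or.inl one_ne_zero)

section Shift

variable {ι : Type*} {L : Filter ι} {u v : ι → ℝ} {κ : ℝ}

lemma tendsto_div_one_of_sub (hu : Tendsto u L atTop)
    (huv : Tendsto (fun i => v i - u i) L (𝓝 κ)) : Tendsto (fun i => v i / u i) L (𝓝 1) := by
  have h := (huv.div_atTop hu).add_const 1
  rw [zero_add] at h
  refine h.congr' ?_
  filter_upwards [hu.eventually_gt_atTop 0] with i hi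
  field_simp
  ring

/-- First-order expansion of `t ^ p` at `t = 1`, evaluated at `v / u = 1 + (v - u) / u`. -/
lemma tendsto_mul_div_rpow_sub_one (hu : Tendsto u L atTop)
    (huv : Tendsto (fun i => v i - u i) L (𝓝 κ)) (p : ℝ) :
    Tendsto (fun i => u i * ((v i / u i) ^ p - 1)) L (𝓝 (p * κ)) := by
  have hr := tendsto_div_one_of_sub hu huv
  have ho := (hasDerivAt_iff_isLittleO.1 (hasDerivAt_rpow_one p)).comp_tendsto hr
  have ho2 := (isBigO_refl u L).mul_isLittleO ho
  have hbd : (fun i => u i * (((fun x' : ℝ => x' - 1) ∘ fun i => v i / u i) i)) =O[L]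
      fun _ => (1 : ℝ) := by
    refine (huv.isBigO_one ℝ).congr' ?_ EventuallyEq.rfl
    filter_upwards [hu.eventually_gt_atTop 0] with i hi
    simp only [Function.comp]
    field_simp
  have h0 := (ho2.trans_isBigO hbd).tendsto_div_nhds_zero
  have h1 := h0.add (huv.const_mul p)
  rw [zero_add] at h1
  refine h1.congr' ?_
  filter_upwards [hu.eventually_gt_atTop 0] with i hi
  simp only [Function.comp, Real.one_rpow, smul_eq_mul, div_one]
  field_simp
  ring

/-- The function that describes the correction in the rapidly varying Gumbel case. -/
noncomputable def ravFun (τ H y : ℝ) : ℝ :=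
  y ^ τ - τ * (τ - 1) * (y ^ (τ - 1) * Real.log y) + H * y ^ (τ - 1)

/-- At order `u ^ (τ - 1)` a bounded shift is felt only by the leading term `y ^ τ`. Hence constant
factors inside the logarithm change only the coefficient `H`. -/
lemma tendsto_ravFun_sub (hu : Tendsto u L atTop)
    (huv : Tendsto (fun i => v i - u i) L (𝓝 κ)) (τ H : ℝ) :
    Tendsto (fun i => (ravFun τ H (v i) - ravFun τ H (u i)) / u i ^ (τ - 1)) L (𝓝 (τ * κ)) := by
  have hr := tendsto_div_one_of_sub hu huv
  have h1 := tendsto_mul_div_rpow_sub_one hu huv τ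
  have h2 := tendsto_mul_div_rpow_sub_one hu huv (τ - 1)
  have hlog : Tendsto (fun i => Real.log (u i) / u i) L (𝓝 0) :=
    (Real.isLittleO_log_id_atTop.tendsto_div_nhds_zero).comp hu
  have hrp : Tendsto (fun i => (v i / u i) ^ (τ - 1)) L (𝓝 1) := by
    have := hr.rpow_const (p := τ - 1) (Or.inl one_ne_zero)
    rwa [Real.one_rpow] at this
  have hlr : Tendsto (fun i => Real.log (v i / u i)) L (𝓝 0) := by
    have := (Real.continuousAt_log one_ne_zero).tendsto.comp hr
    rwa [Real.log_one] at this
  have h3 := (hrp.mul hlr).add (h2.mul hlog)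
  have h4 := (h1.sub (h3.const_mul (τ * (τ - 1)))).add ((hrp.sub_const 1).const_mul H)
  simp only [mul_zero, add_zero, sub_zero, sub_self] at h4
  refine h4.congr' ?_
  filter_upwards [hu.eventually_gt_atTop 0, hr.eventually (lt_mem_nhds one_pos)] with i hi hvi
  have hv : 0 < v i := (div_pos_iff_of_pos_right hi).1 hvi
  have hup : 0 < u i ^ (τ - 1) := Real.rpow_pos_of_pos hi _
  have e1 : ∀ t : ℝ, 0 < t → t ^ τ = t ^ (τ - 1) * t := fun t ht => by
    rw [← Real.rpow_add_one ht.ne']; congr 1; ring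
  rw [Real.div_rpow hv.le hi.le, Real.div_rpow hv.le hi.le, Real.log_div hv.ne' hi.ne']
  unfold ravFun
  rw [e1 _ hv, e1 _ hi]
  field_simp
  ring

end Shift

/-! ### Gumbel-RaV case: minimising `K / x + (log x / c) ^ τ`. -/

section Optimum

variable {τ c : ℝ}

/-- The derivative of `(y / c) ^ τ` with respect to `y`. -/
noncomputable def ravSlope (τ c y : ℝ) : ℝ := τ * c ^ (-τ) * y ^ (τ - 1)

/-- The value of the second-order coefficient of `ravFun` before shifting. -/
noncomputable def ravConst (τ c : ℝ) : ℝ := τ * (1 - Real.log (τ * c ^ (-τ)))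

lemma ravSlope_pos (hτ : 1 < τ) (hc : 0 < c) {y : ℝ} (hy : 0 < y) : 0 < ravSlope τ c y := by
  have h1 : 0 < c ^ (-τ) := Real.rpow_pos_of_pos hc _
  have h2 : 0 < y ^ (τ - 1) := Real.rpow_pos_of_pos hy _
  have : 0 < τ := by linarith
  unfold ravSlope
  positivity

lemma log_ravSlope (hτ : 1 < τ) (hc : 0 < c) {y : ℝ} (hy : 0 < y) :
    Real.log (ravSlope τ c y) = Real.log (τ * c ^ (-τ)) + (τ - 1) * Real.log y := by
  have h1 : 0 < c ^ (-τ) := Real.rpow_pos_of_pos hc _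
  have h2 : 0 < y ^ (τ - 1) := Real.rpow_pos_of_pos hy _
  have : 0 < τ := by linarith
  unfold ravSlope
  rw [Real.log_mul (by positivity) h2.ne', Real.log_rpow hy]

/-- With `y = log K` and `D` the slope at `y`, the right side is the objective at `log x = y - log
D`, where `K / x = D`, after linearising the power at `y`. -/
lemma ravFun_eq (hτ : 1 < τ) (hc : 0 < c) {y : ℝ} (hy : 0 < y) :
    c ^ (-τ) * ravFun τ (ravConst τ c) y
      = c ^ (-τ) * y ^ τ + ravSlope τ c y - ravSlope τ c y * Real.log (ravSlope τ c y) := by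
  rw [log_ravSlope hτ hc hy]
  unfold ravFun ravConst ravSlope
  ring

lemma div_rpow_eq (hc : 0 < c) {y : ℝ} (hy : 0 ≤ y) : (y / c) ^ τ = c ^ (-τ) * y ^ τ := by
  rw [Real.div_rpow hy hc.le, Real.rpow_neg hc.le, div_eq_inv_mul]

/-- Lower bound for `K / x + (log x / c) ^ τ`. -/
lemma ravFun_le (hτ : 1 < τ) (hc : 0 < c) {K x : ℝ} (hK : 1 < K) (hx : 1 ≤ x) :
    c ^ (-τ) * ravFun τ (ravConst τ c) (Real.log K) ≤ K / x + (Real.log x / c) ^ τ := by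
  have hl : 0 < Real.log K := Real.log_pos hK
  have hx0 : 0 < x := by linarith
  have hK0 : 0 < K := by linarith
  have hlx : 0 ≤ Real.log x := Real.log_nonneg hx
  have hcτ : 0 < c ^ (-τ) := Real.rpow_pos_of_pos hc _
  set y := Real.log K with hy
  have hD := ravSlope_pos hτ hc hl
  rw [ravFun_eq hτ hc hl, div_rpow_eq hc hlx]
  set D := ravSlope τ c y with hDdef
  -- The estimate `exp u ≥ 1 + u` for this exponent produces the linear term `-D log x`. It cancels
  -- against the tangent of `(log x / c) ^ τ` at `log x = y`, so the bound no longer depends on `x`.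
  have h1 : K / x = D * Real.exp (y - Real.log x - Real.log D) := by
    rw [Real.exp_sub, Real.exp_sub, Real.exp_log hD, Real.exp_log hx0, hy, Real.exp_log hK0]
    field_simp
  have h2 := mul_le_mul_of_nonneg_left (Real.add_one_le_exp (y - Real.log x - Real.log D)) hD.le
  rw [← h1] at h2
  have h3 := one_add_mul_self_le_rpow_one_add (s := Real.log x / y - 1) (by
    have : 0 ≤ Real.log x / y := by positivity
    linarith) hτ.le
  have e1 : 1 + (Real.log x / y - 1) = Real.log x / y := by ring
  have hyτ : 0 < y ^ τ := Real.rpow_pos_of_pos hl _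
  rw [e1, Real.div_rpow hlx hl.le, le_div_iff₀ hyτ] at h3
  have h4 := mul_le_mul_of_nonneg_left h3 hcτ.le
  have e2 : y ^ τ = y ^ (τ - 1) * y := by rw [← Real.rpow_add_one hl.ne']; congr 1; ring
  have e3 : c ^ (-τ) * ((1 + τ * (Real.log x / y - 1)) * y ^ τ)
      = c ^ (-τ) * y ^ τ + D * (Real.log x - y) := by
    rw [hDdef, ravSlope, e2]
    field_simp
  rw [e3] at h4
  linarith

/-- The power `y ^ τ` lies above its tangent at `y - v`. -/
lemma rpow_sub_le (hτ : 1 < τ) {y v : ℝ} (hy : 0 < y) (hv : 0 < y - v) :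
    (y - v) ^ τ ≤ y ^ τ - τ * (y - v) ^ (τ - 1) * v := by
  have h3 := one_add_mul_self_le_rpow_one_add (s := y / (y - v) - 1) (by
    have : 0 ≤ y / (y - v) := by positivity
    linarith) hτ.le
  have e1 : 1 + (y / (y - v) - 1) = y / (y - v) := by ring
  have hyτ : 0 < (y - v) ^ τ := Real.rpow_pos_of_pos hv _
  rw [e1, Real.div_rpow hy.le hv.le, le_div_iff₀ hyτ] at h3
  have e2 : (y - v) ^ τ = (y - v) ^ (τ - 1) * (y - v) := by
    rw [← Real.rpow_add_one hv.ne']; congr 1; ring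
  have e3 : (1 + τ * (y / (y - v) - 1)) * (y - v) ^ τ
      = (y - v) ^ τ + τ * (y - v) ^ (τ - 1) * v := by
    rw [e2]
    field_simp
    ring
  rw [e3] at h3
  linarith

lemma tendsto_log_ravSlope_sq_div (hτ : 1 < τ) (hc : 0 < c) :
    Tendsto (fun y => Real.log (ravSlope τ c y) ^ 2 / y) atTop (𝓝 0) := by
  set d := Real.log (τ * c ^ (-τ)) with hd
  have h0 : Tendsto (fun y : ℝ => d ^ 2 / y) atTop (𝓝 0) := tendsto_const_nhds.div_atTop tendsto_id
  have h1 : Tendsto (fun y : ℝ => Real.log y / y) atTop (𝓝 0) :=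
    Real.isLittleO_log_id_atTop.tendsto_div_nhds_zero
  have h2 : Tendsto (fun y : ℝ => Real.log y ^ 2 / y) atTop (𝓝 0) :=
    (Real.isLittleO_pow_log_id_atTop (n := 2)).tendsto_div_nhds_zero
  have h3 := (h0.add (h1.const_mul (2 * d * (τ - 1)))).add (h2.const_mul ((τ - 1) ^ 2))
  simp only [mul_zero, add_zero] at h3
  refine h3.congr' ?_
  filter_upwards [eventually_gt_atTop (0 : ℝ)] with y hy
  rw [log_ravSlope hτ hc hy, ← hd]
  ring

lemma tendsto_log_ravSlope (hτ : 1 < τ) (hc : 0 < c) :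
    Tendsto (fun y => Real.log (ravSlope τ c y)) atTop atTop := by
  have h : Tendsto (fun y : ℝ => Real.log (τ * c ^ (-τ)) + (τ - 1) * Real.log y) atTop atTop :=
    tendsto_atTop_add_const_left _ _ (Real.tendsto_log_atTop.const_mul_atTop (by linarith))
  refine h.congr' ?_
  filter_upwards [eventually_gt_atTop (0 : ℝ)] with y hy
  exact (log_ravSlope hτ hc hy).symm

lemma tendsto_log_ravSlope_div (hτ : 1 < τ) (hc : 0 < c) :
    Tendsto (fun y => Real.log (ravSlope τ c y) / y) atTop (𝓝 0) := by
  refine squeeze_zero' ?_ ?_ (tendsto_log_ravSlope_sq_div hτ hc)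
  · filter_upwards [eventually_gt_atTop (0 : ℝ),
      (tendsto_log_ravSlope hτ hc).eventually_ge_atTop 0] with y h1 h2
    positivity
  · filter_upwards [eventually_gt_atTop (0 : ℝ),
      (tendsto_log_ravSlope hτ hc).eventually_ge_atTop 1] with y h1 h2
    gcongr
    nlinarith

lemma tendsto_sub_log_ravSlope (hτ : 1 < τ) (hc : 0 < c) :
    Tendsto (fun y => y - Real.log (ravSlope τ c y)) atTop atTop := by
  have h := (tendsto_log_ravSlope_div hτ hc).const_sub 1
  rw [sub_zero] at h
  have h2 := h.pos_mul_atTop one_pos tendsto_id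
  refine h2.congr' ?_
  filter_upwards [eventually_gt_atTop (0 : ℝ)] with y hy
  simp only [id]
  field_simp

/-- With `v` the logarithm of the slope, `1 - (1 - v / y) ^ (τ - 1)` is `O(v / y)` and `v² / y → 0`.
This is the price of taking a tangent at `y - v` instead of `y`. -/
lemma tendsto_log_ravSlope_mul (hτ : 1 < τ) (hc : 0 < c) :
    Tendsto (fun y => Real.log (ravSlope τ c y)
      * (1 - ((y - Real.log (ravSlope τ c y)) / y) ^ (τ - 1))) atTop (𝓝 0) := by
  set v : ℝ → ℝ := fun y => Real.log (ravSlope τ c y) with hv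
  have hr : Tendsto (fun y => (y - v y) / y) atTop (𝓝 1) := by
    have h := (tendsto_log_ravSlope_div hτ hc).const_sub 1
    rw [sub_zero] at h
    refine h.congr' ?_
    filter_upwards [eventually_gt_atTop (0 : ℝ)] with y hy
    field_simp
    rfl
  have hO := ((hasDerivAt_rpow_one (τ - 1)).isBigO_sub.comp_tendsto hr)
  have hO2 := (isBigO_refl v atTop).mul hO
  have hlim : Tendsto (fun y => v y * ((fun x' : ℝ => x' - 1) ∘ fun y => (y - v y) / y) y) atTop
      (𝓝 0) := by
    have h := (tendsto_log_ravSlope_sq_div hτ hc).neg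
    rw [neg_zero] at h
    refine h.congr' ?_
    filter_upwards [eventually_gt_atTop (0 : ℝ)] with y hy
    simp only [Function.comp]
    field_simp
    ring
  have h0 := (hO2.trans_tendsto hlim).neg
  rw [neg_zero] at h0
  refine h0.congr fun y => ?_
  simp only [Function.comp, Real.one_rpow]
  ring

end Optimum

end WRT

/-! ### Gumbel-RaV case: the defect. -/

namespace WRT

variable {ν : Measure ℝ}

/-- The prefactor `a (log x) ^ b` contributes only `O(log log x)`; the extra `1` in the coefficient
absorbs `log a` and the error of the asymptotic equivalence. -/
lemma GumbelRaVCase.eventually_log_tail {a b c τ : ℝ} (h : GumbelRaVCase ν a b c τ) :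
    ∀ᶠ x : ℝ in atTop, 0 < ν.real (Set.Ioi (1 - 1 / x)) ∧
      |Real.log (ν.real (Set.Ioi (1 - 1 / x))) + (Real.log x / c) ^ τ|
        ≤ (|b| + 1) * Real.log (Real.log x) := by
  have ha := h.a_pos
  have hlog := Real.tendsto_log_atTop
  obtain ⟨hpos, hlim⟩ := tendsto_log_sub_log_of_isEquivalent h.tail (by
    filter_upwards [hlog.eventually_gt_atTop 0] with x hx
    exact mul_pos (mul_pos ha (Real.rpow_pos_of_pos hx _)) (Real.exp_pos _))
  have h1 := hlim.abs
  rw [abs_zero] at h1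
  filter_upwards [hpos, h1.eventually (ge_mem_nhds one_pos), hlog.eventually_gt_atTop 0,
    (hlog.comp hlog).eventually_ge_atTop (|Real.log a| + 1)] with x h2 h3 h4 h5
  refine ⟨h2, ?_⟩
  simp only [Function.comp] at h5
  rw [Real.log_mul (mul_pos ha (Real.rpow_pos_of_pos h4 _)).ne' (Real.exp_ne_zero _),
    Real.log_mul ha.ne' (Real.rpow_pos_of_pos h4 _).ne', Real.log_exp, Real.log_rpow h4] at h3
  set T := Real.log (ν.real (Set.Ioi (1 - 1 / x)))
  set l := Real.log (Real.log x)
  have hl0 : 0 ≤ l := by have := abs_nonneg (Real.log a); linarith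
  have e : T + (Real.log x / c) ^ τ
      = (T - (Real.log a + b * l + -(Real.log x / c) ^ τ)) + Real.log a + b * l := by ring
  rw [e]
  refine (abs_add_three _ _ _).trans ?_
  rw [abs_mul, abs_of_nonneg hl0]
  linarith

lemma tendsto_log_const_mul_sub {A : ℝ} (hA : 0 < A) :
    Tendsto (fun k : ℕ => Real.log (A * k) - Real.log k) atTop (𝓝 (Real.log A)) := by
  refine (tendsto_const_nhds (x := Real.log A)).congr' ?_
  filter_upwards [eventually_gt_atTop 0] with k hk
  have : (0 : ℝ) < k := by exact_mod_cast hk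
  rw [Real.log_mul hA.ne' this.ne']
  ring

lemma tendsto_log_const_mul {A : ℝ} (hA : 0 < A) :
    Tendsto (fun k : ℕ => Real.log (A * k)) atTop atTop :=
  Real.tendsto_log_atTop.comp (tendsto_natCast_atTop_atTop.const_mul_atTop hA)

lemma GumbelRaVCase.le_defect (hν : WeightLaw ν) {a b c τ : ℝ} (h : GumbelRaVCase ν a b c τ)
    {ε : ℝ} (hε : 0 < ε) (hε1 : ε < 1) :
    ∃ C : ℝ, ∀ᶠ k : ℕ in atTop,
      c ^ (-τ) * ravFun τ (ravConst τ c) (Real.log ((1 - ε) * decay ν * k)) - C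
        - (|b| + 1) * Real.log (Real.log (decay ν * k)) ≤ defect ν k := by
  have := hν.isProbabilityMeasure
  have hA := hν.decay_pos
  have hc := h.c_pos
  have hτ := h.one_lt_τ
  obtain ⟨x₀, hx₀⟩ := eventually_atTop.1 h.eventually_log_tail
  -- Beyond `e` the inner logarithm is at least one, so `log log x` is monotone and is bounded by
  -- its value at `A k`.
  set y := max x₀ (Real.exp 1) with hy
  have hye : Real.exp 1 ≤ y := le_max_right _ _
  have hy1 : 1 ≤ y := (Real.one_le_exp zero_le_one).trans hye
  set C := (Real.log y / c) ^ τ with hC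
  have hC0 : 0 ≤ C := Real.rpow_nonneg (div_nonneg (Real.log_nonneg hy1) hc.le) _
  set A := decay ν with hAdef
  refine ⟨C + 1 - Real.log ε, ?_⟩
  have hKA : 0 < (1 - ε) * A := mul_pos (by linarith) hA
  filter_upwards [(tendsto_log_const_mul hA).eventually_ge_atTop 1,
    (tendsto_natCast_atTop_atTop.const_mul_atTop hKA).eventually_gt_atTop 1,
    eventually_ge_atTop 1] with k hk1 hk2 hk3
  have hk0 : (0 : ℝ) < k := by exact_mod_cast hk3
  set b' := |b| + 1 with hb'
  have hb0 : 0 ≤ b' := by positivity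
  set m := Real.log (Real.log (A * k)) with hm
  have hm0 : 0 ≤ m := Real.log_nonneg hk1
  set K := (1 - ε) * A * k with hK
  have hKpos : 0 < K := by linarith
  set R := c ^ (-τ) * ravFun τ (ravConst τ c) (Real.log K) with hR
  have hmain := hν.le_defect hk3 hε (B := R - C - b' * m) fun x hx hxk => ?_
  · linarith
  have hKx : (1 - ε) * (A * k / x) = K / x := by rw [hK]; ring
  change ν.real (Set.Ioi (1 - 1 / x)) ≤ Real.exp ((1 - ε) * (A * k / x) - _)
  rw [hKx]
  -- Three ranges: the tail asymptotics for `x ≥ y`; the trivial bound with `(log x / c) ^ τ ≤ C`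
  -- for `1 ≤ x ≤ y`; and the trivial bound with `K / x ≥ K` for `x ≤ 1`.
  rcases le_total 1 x with hx1 | hx1
  · have h1 := ravFun_le hτ hc hk2 hx1
    have hlx : 0 ≤ Real.log x := Real.log_nonneg hx1
    rcases le_total y x with hxy | hxy
    · obtain ⟨h2, h3⟩ := hx₀ x ((le_max_left _ _).trans hxy)
      have h4 := (abs_le.1 h3).2
      have hlx1 : 1 ≤ Real.log x := by
        rw [Real.le_log_iff_exp_le hx]; exact hye.trans hxy
      have h5 : Real.log (Real.log x) ≤ m :=
        Real.log_le_log (by linarith) (Real.log_le_log hx hxk)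
      have h6 := mul_le_mul_of_nonneg_left h5 hb0
      rw [← Real.exp_log h2]
      exact Real.exp_le_exp.2 (by linarith)
    · refine measureReal_le_one.trans (Real.one_le_exp ?_)
      have h2 : (Real.log x / c) ^ τ ≤ C := by
        have := Real.log_le_log hx hxy
        exact Real.rpow_le_rpow (by positivity) (by gcongr) (by linarith)
      have h3 := mul_nonneg hb0 hm0
      linarith
  · refine measureReal_le_one.trans (Real.one_le_exp ?_)
    have h1 := ravFun_le hτ hc hk2 le_rfl
    rw [Real.log_one, zero_div, Real.zero_rpow (by linarith), div_one, add_zero] at h1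
    have h2 : K ≤ K / x := by
      rw [le_div_iff₀ hx]; nlinarith
    have h3 := mul_nonneg hb0 hm0
    linarith

lemma GumbelRaVCase.defect_le (hν : WeightLaw ν) {a b c τ : ℝ} (h : GumbelRaVCase ν a b c τ) :
    ∃ e : ℝ → ℝ, Tendsto e atTop (𝓝 0) ∧ ∀ᶠ k : ℕ in atTop,
      defect ν k ≤ c ^ (-τ) * ravFun τ (ravConst τ c) (Real.log (decay ν * k))
        + e (Real.log (decay ν * k)) * Real.log (decay ν * k) ^ (τ - 1) := by
  have := hν.isProbabilityMeasure
  have hA := hν.decay_pos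
  have hc := h.c_pos
  have hτ := h.one_lt_τ
  set v : ℝ → ℝ := fun y => Real.log (ravSlope τ c y) with hv
  -- The near-optimal test point: `A k / X` equals the slope at `y = log (A k)`.
  set X : ℝ → ℝ := fun y => Real.exp (y - v y) with hX
  have hXtop : Tendsto X atTop atTop :=
    Real.tendsto_exp_atTop.comp (tendsto_sub_log_ravSlope hτ hc)
  -- The three errors, relative to `y ^ (τ - 1)`: a tangent taken at `y - v` rather than at `y`, the
  -- denominator `X - 1` rather than `X`, and the `log log` term of the tail.
  set e : ℝ → ℝ := fun y => τ * c ^ (-τ) * (v y * (1 - ((y - v y) / y) ^ (τ - 1)))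
    + τ * c ^ (-τ) * (1 / (X y - 1)) + (|b| + 1) * (Real.log y / y ^ (τ - 1)) with he
  refine ⟨e, ?_, ?_⟩
  · have h1 := (tendsto_log_ravSlope_mul hτ hc).const_mul (τ * c ^ (-τ))
    have h2 : Tendsto (fun y => τ * c ^ (-τ) * (1 / (X y - 1))) atTop (𝓝 (τ * c ^ (-τ) * 0)) :=
      (tendsto_const_nhds.div_atTop (tendsto_atTop_add_const_right _ (-1) hXtop)).const_mul _
    have h3 := ((isLittleO_log_rpow_atTop
      (show 0 < τ - 1 by linarith)).tendsto_div_nhds_zero).const_mul (|b| + 1)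
    have h4 := (h1.add h2).add h3
    simpa only [mul_zero, add_zero] using h4
  have hl := tendsto_log_const_mul hA
  have hev : ∀ᶠ y : ℝ in atTop, 0 < y ∧ 0 < y - v y ∧ 0 ≤ v y ∧ 1 < X y ∧
      (0 < ν.real (Set.Ioi (1 - 1 / X y)) ∧
      |Real.log (ν.real (Set.Ioi (1 - 1 / X y))) + (Real.log (X y) / c) ^ τ|
        ≤ (|b| + 1) * Real.log (Real.log (X y))) := by
    filter_upwards [eventually_gt_atTop (0 : ℝ),
      (tendsto_sub_log_ravSlope hτ hc).eventually_gt_atTop 0,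
      (tendsto_log_ravSlope hτ hc).eventually_ge_atTop 0, hXtop.eventually_gt_atTop 1,
      hXtop.eventually h.eventually_log_tail] with y h1 h2 h3 h4 h5
    exact ⟨h1, h2, h3, h4, h5⟩
  filter_upwards [hl.eventually hev, eventually_ge_atTop 1] with k hk hk1
  have hk0 : (0 : ℝ) < k := by exact_mod_cast hk1
  set y := Real.log (decay ν * k) with hy
  obtain ⟨hy0, hyv, hv0, hX1, hT, hbd⟩ := hk
  have hIci : ν.real (Set.Ioi (1 - 1 / X y)) ≤ ν.real (Set.Ici (1 - 1 / X y)) :=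
    measureReal_mono Set.Ioi_subset_Ici_self
  have h1 := hν.defect_le k hX1 (hT.trans_le hIci)
  have h2 := Real.log_le_log hT hIci
  have hlX : Real.log (X y) = y - v y := Real.log_exp _
  rw [hlX] at hbd
  have h3 := (abs_le.1 hbd).1
  have h4 : Real.log (y - v y) ≤ Real.log y := Real.log_le_log hyv (by linarith)
  have h5 := mul_le_mul_of_nonneg_left h4 (show 0 ≤ |b| + 1 by positivity)
  have hD := ravSlope_pos hτ hc hy0
  have hX0 : 0 < X y := Real.exp_pos _
  have hKX : decay ν * k = ravSlope τ c y * X y := by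
    have hey : Real.exp y = decay ν * k := by rw [hy]; exact Real.exp_log (by positivity)
    simp only [hX, hv]
    rw [Real.exp_sub, Real.exp_log hD, hey]
    field_simp
  have hX10 : X y - 1 ≠ 0 := by linarith
  have h6 : decay ν * k / (X y - 1) = ravSlope τ c y + ravSlope τ c y * (1 / (X y - 1)) := by
    rw [hKX]
    field_simp
    ring
  have hcτ : 0 < c ^ (-τ) := Real.rpow_pos_of_pos hc _
  have h7 : ((y - v y) / c) ^ τ ≤ c ^ (-τ) * (y ^ τ - τ * (y - v y) ^ (τ - 1) * v y) := by
    rw [div_rpow_eq hc hyv.le]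
    exact mul_le_mul_of_nonneg_left (rpow_sub_le hτ hy0 hyv) hcτ.le
  rw [ravFun_eq hτ hc hy0]
  have hyp : 0 < y ^ (τ - 1) := Real.rpow_pos_of_pos hy0 _
  have h8 : e y * y ^ (τ - 1) = τ * c ^ (-τ) * v y * (y ^ (τ - 1) - (y - v y) ^ (τ - 1))
      + ravSlope τ c y * (1 / (X y - 1)) + (|b| + 1) * Real.log y := by
    simp only [he]
    rw [Real.div_rpow hyv.le hy0.le, ravSlope]
    field_simp
  rw [h8]
  have h9 : ravSlope τ c y * Real.log (ravSlope τ c y) = τ * c ^ (-τ) * v y * y ^ (τ - 1) := by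
    have h10 : ravSlope τ c y = τ * c ^ (-τ) * y ^ (τ - 1) := rfl
    change ravSlope τ c y * v y = _
    rw [h10]; ring
  rw [h9]
  rw [h6] at h1
  linarith

/-- As `log (A k) = log k + log A`, the shift lemma turns the factor `A` into the summand `τ log A`
of the coefficient. -/
lemma GumbelRaVCase.tendsto_defect (hν : WeightLaw ν) {a b c τ : ℝ}
    (h : GumbelRaVCase ν a b c τ) :
    Tendsto (fun k : ℕ => (defect ν k - c ^ (-τ) * ravFun τ
      (ravConst τ c + τ * Real.log (decay ν)) (Real.log k)) / Real.log k ^ (τ - 1)) atTop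
      (𝓝 0) := by
  have hA := hν.decay_pos
  have hc := h.c_pos
  have hτ := h.one_lt_τ
  have hcτ : 0 < c ^ (-τ) := Real.rpow_pos_of_pos hc _
  have hy := tendsto_log_natCast
  have hyp : Tendsto (fun k : ℕ => Real.log k ^ (τ - 1)) atTop atTop :=
    (tendsto_rpow_atTop (by linarith)).comp hy
  have hsplit : ∀ y : ℝ, ravFun τ (ravConst τ c + τ * Real.log (decay ν)) y
      = ravFun τ (ravConst τ c) y + τ * Real.log (decay ν) * y ^ (τ - 1) := fun y => by
    unfold ravFun; ring
  have hratio : Tendsto (fun k : ℕ => Real.log (decay ν * k) ^ (τ - 1) / Real.log k ^ (τ - 1))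
      atTop (𝓝 1) := by
    have h1 := (tendsto_div_one_of_sub hy (tendsto_log_const_mul_sub hA)).rpow_const
      (p := τ - 1) (Or.inl one_ne_zero)
    rw [Real.one_rpow] at h1
    refine h1.congr' ?_
    filter_upwards [hy.eventually_gt_atTop 0,
      (tendsto_log_const_mul hA).eventually_gt_atTop 0] with k h2 h3
    exact Real.div_rpow h3.le h2.le _
  rw [tendsto_order]
  constructor
  · intro t ht
    -- With `log (1 - ε) = q`, the shift by `log (1 - ε)` costs `c ^ (-τ) τ q = t / 2`, which
    -- exceeds the negative number `t`.
    set q := t / (2 * (c ^ (-τ) * τ)) with hq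
    have hq0 : q < 0 := div_neg_of_neg_of_pos ht (by positivity)
    set ε := 1 - Real.exp q with hε
    have hε0 : 0 < ε := by
      have : Real.exp q < 1 := by rw [← Real.exp_zero]; exact Real.exp_lt_exp.2 hq0
      linarith
    have hε1 : ε < 1 := by have := Real.exp_pos q; linarith
    have h1ε : 1 - ε = Real.exp q := by rw [hε]; ring
    obtain ⟨C, hC⟩ := h.le_defect hν hε0 hε1
    have hKA : 0 < (1 - ε) * decay ν := mul_pos (by linarith) hA
    have hsh := (tendsto_ravFun_sub hy (tendsto_log_const_mul_sub hKA) τ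
      (ravConst τ c)).const_mul (c ^ (-τ))
    have hconst : Tendsto (fun k : ℕ => C / Real.log k ^ (τ - 1)) atTop (𝓝 0) :=
      tendsto_const_nhds.div_atTop hyp
    have hll : Tendsto (fun k : ℕ => (|b| + 1) * (Real.log (Real.log (decay ν * k))
        / Real.log (decay ν * k) ^ (τ - 1) * (Real.log (decay ν * k) ^ (τ - 1)
        / Real.log k ^ (τ - 1)))) atTop (𝓝 ((|b| + 1) * (0 * 1))) :=
      ((((isLittleO_log_rpow_atTop (show 0 < τ - 1 by linarith)).tendsto_div_nhds_zero).comp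
        (tendsto_log_const_mul hA)).mul hratio).const_mul _
    have hlim := ((hsh.sub hconst).sub hll).sub_const (c ^ (-τ) * (τ * Real.log (decay ν)))
    have hval : c ^ (-τ) * (τ * Real.log ((1 - ε) * decay ν)) - 0 - (|b| + 1) * (0 * 1)
        - c ^ (-τ) * (τ * Real.log (decay ν)) = t / 2 := by
      rw [h1ε, Real.log_mul (Real.exp_ne_zero _) hA.ne', Real.log_exp, hq]
      field_simp
      ring
    rw [hval] at hlim
    filter_upwards [hlim.eventually (lt_mem_nhds (show t < t / 2 by linarith)), hC,
      hyp.eventually_gt_atTop 0, (tendsto_log_const_mul hA).eventually_gt_atTop 0]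
      with k h1 h2 h3 h4
    have h5 : 0 < Real.log (decay ν * k) ^ (τ - 1) := Real.rpow_pos_of_pos h4 _
    refine h1.trans_le ?_
    rw [hsplit, le_div_iff₀ h3]
    refine le_trans (le_of_eq ?_) (sub_le_sub_right h2 _)
    field_simp
    ring
  · intro t ht
    obtain ⟨e, he, hle⟩ := h.defect_le hν
    have hsh := (tendsto_ravFun_sub hy (tendsto_log_const_mul_sub hA) τ
      (ravConst τ c)).const_mul (c ^ (-τ))
    have hlim := (hsh.add ((he.comp (tendsto_log_const_mul hA)).mul hratio)).sub_const
      (c ^ (-τ) * (τ * Real.log (decay ν)))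
    have hval : c ^ (-τ) * (τ * Real.log (decay ν)) + 0 * 1
        - c ^ (-τ) * (τ * Real.log (decay ν)) = 0 := by ring
    rw [hval] at hlim
    filter_upwards [hlim.eventually (gt_mem_nhds ht), hle, hyp.eventually_gt_atTop 0]
      with k h1 h2 h3
    refine lt_of_le_of_lt ?_ h1
    rw [hsplit, div_le_iff₀ h3]
    refine (sub_le_sub_right h2 _).trans (le_of_eq ?_)
    simp only [Function.comp]
    field_simp
    ring

end WRT

/-! ### From `log k` to iterated logarithms of `n`, and the three limits. -/

namespace WRT

variable {ν : Measure ℝ}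

lemma WeightLaw.tendsto_logb (hν : WeightLaw ν) :
    Tendsto (fun n : ℕ => Real.logb (theta ν) n) atTop atTop :=
  (Real.tendsto_logb_atTop hν.one_lt_theta).comp tendsto_natCast_atTop_atTop

lemma WeightLaw.tendsto_logb_logb (hν : WeightLaw ν) :
    Tendsto (fun n : ℕ => Real.logb (theta ν) (Real.logb (theta ν) n)) atTop atTop :=
  (Real.tendsto_logb_atTop hν.one_lt_theta).comp hν.tendsto_logb

lemma WeightLaw.tendsto_comp_logb_div_log (hν : WeightLaw ν) {g : ℝ → ℝ}
    (hg : Tendsto (fun x => g x / x) atTop (𝓝 0)) :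
    Tendsto (fun n : ℕ => g (Real.logb (theta ν) n) / Real.log n) atTop (𝓝 0) := by
  have hl := hν.log_theta_pos
  have h := (hg.comp hν.tendsto_logb).div_const (Real.log (theta ν))
  rw [zero_div] at h
  refine h.congr fun n => ?_
  simp only [Function.comp]
  nth_rewrite 2 [Real.logb]
  rw [div_div, div_mul_cancel₀ _ hl.ne']

section Compare

variable {k : ℕ → ℕ}

lemma WeightLaw.tendsto_div_logb (hν : WeightLaw ν)
    (hk : Tendsto (fun n : ℕ => (k n : ℝ) / Real.log n) atTop (𝓝 (1 / Real.log (theta ν)))) :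
    Tendsto (fun n : ℕ => (k n : ℝ) / Real.logb (theta ν) n) atTop (𝓝 1) := by
  have hl := hν.log_theta_pos
  have h := hk.mul_const (Real.log (theta ν))
  rw [one_div, inv_mul_cancel₀ hl.ne'] at h
  refine h.congr fun n => ?_
  rw [Real.logb, div_div_eq_mul_div, div_mul_eq_mul_div]

lemma WeightLaw.tendsto_of_div_logb (hν : WeightLaw ν)
    (hk : Tendsto (fun n : ℕ => (k n : ℝ) / Real.logb (theta ν) n) atTop (𝓝 1)) :
    Tendsto k atTop atTop := by
  rw [← tendsto_natCast_atTop_iff (R := ℝ)]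
  refine (hk.pos_mul_atTop one_pos hν.tendsto_logb).congr' ?_
  filter_upwards [hν.tendsto_logb.eventually_gt_atTop 0] with n hn
  exact div_mul_cancel₀ _ hn.ne'

lemma WeightLaw.tendsto_log_sub (hν : WeightLaw ν)
    (hk : Tendsto (fun n : ℕ => (k n : ℝ) / Real.logb (theta ν) n) atTop (𝓝 1)) :
    Tendsto (fun n : ℕ => Real.log (k n) - Real.log (Real.logb (theta ν) n)) atTop (𝓝 0) := by
  have h := (Real.continuousAt_log one_ne_zero).tendsto.comp hk
  rw [Real.log_one] at h
  refine h.congr' ?_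
  filter_upwards [hν.tendsto_logb.eventually_gt_atTop 0,
    (hν.tendsto_of_div_logb hk).eventually_gt_atTop 0] with n h1 h2
  have h3 : (0 : ℝ) < k n := by exact_mod_cast h2
  exact Real.log_div h3.ne' h1.ne'

end Compare

lemma tendsto_logb_rpow_div {θ : ℝ} (hθ : 1 < θ) (p : ℝ) :
    Tendsto (fun x : ℝ => Real.logb θ x ^ p / x) atTop (𝓝 0) := by
  have hl : 0 < Real.log θ := Real.log_pos hθ
  have h := ((isLittleO_log_rpow_rpow_atTop p one_pos).tendsto_div_nhds_zero).div_const
    (Real.log θ ^ p)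
  rw [zero_div] at h
  refine h.congr' ?_
  filter_upwards [eventually_gt_atTop 1] with x hx
  rw [Real.logb, Real.div_rpow (Real.log_pos hx).le hl.le, Real.rpow_one, div_right_comm]

variable {Ω : Type*} [MeasurableSpace Ω] {μ : Measure Ω} {W : ℕ → Ω → ℝ} {parent : ℕ → Ω → ℕ}

lemma constRV_mul_log {θ τ c : ℝ} (hθ : 0 < Real.log θ) :
    constRV θ τ c * Real.log θ = rvMin τ (1 - θ⁻¹) c := by
  unfold constRV rvMin
  rw [← div_div]
  field_simp

theorem IsWRT.tendstoInMeasure_weibull [IsProbabilityMeasure μ] (hG : IsWRT μ ν W parent)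
    (hν : WeightLaw ν) {α : ℝ} {l : ℝ → ℝ} (h : WeibullCase ν α l) :
    TendstoInMeasure μ (fun (n : ℕ) ω => ((maxInDegree parent n ω : ℝ)
      - Real.logb (theta ν) n) / Real.logb (theta ν) (Real.logb (theta ν) n)) atTop
      (fun _ => -(α - 1)) := by
  have hl := hν.log_theta_pos
  have hB := hν.tendsto_logb_logb
  have hBl : Tendsto (fun n : ℕ => Real.logb (theta ν) (Real.logb (theta ν) n) / Real.log n)
      atTop (𝓝 0) :=
    hν.tendsto_comp_logb_div_log (g := Real.logb (theta ν)) (by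
      simpa using tendsto_logb_rpow_div hν.one_lt_theta 1)
  have hA := hBl.const_mul (α - 1)
  simp only [mul_zero, ← mul_div_assoc] at hA
  refine hG.tendstoInMeasure_of_defect hν hB hA hBl (fun k C hkC => ?_) ?_
  · have hk := hν.tendsto_div_logb (hν.tendsto_div_log hA hBl hkC)
    have hy := Real.tendsto_log_atTop.comp hν.tendsto_logb
    -- Since `k ~ log_θ n`, the logarithms of the two differ by `o(1)` and `log k` may be replaced
    -- by `log log_θ n`.
    have hr := tendsto_div_one_of_sub hy (hν.tendsto_log_sub hk)
    have hlim := (((h.tendsto_defect hν).comp (hν.tendsto_of_div_logb hk)).mul hr).sub_const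
      (α - 1)
    rw [mul_one, sub_self] at hlim
    refine hlim.congr' ?_
    filter_upwards [hy.eventually_gt_atTop 0,
      (tendsto_log_natCast.comp (hν.tendsto_of_div_logb hk)).eventually_gt_atTop 0] with n h1 h2
    simp only [Function.comp] at h1 h2 ⊢
    rw [Real.logb.eq_1 (theta ν) (Real.logb (theta ν) n)]
    field_simp
  · filter_upwards [hB.eventually_gt_atTop 0] with n hn ω
    field_simp
    ring

theorem IsWRT.tendstoInMeasure_gumbelRV [IsProbabilityMeasure μ] (hG : IsWRT μ ν W parent)
    (hν : WeightLaw ν) {a b c τ : ℝ} (h : GumbelRVCase ν a b c τ) :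
    TendstoInMeasure μ (fun (n : ℕ) ω => ((maxInDegree parent n ω : ℝ)
      - Real.logb (theta ν) n) / Real.logb (theta ν) n ^ (1 - 1 / (1 + τ))) atTop
      (fun _ => -constRV (theta ν) τ c) := by
  have hl := hν.log_theta_pos
  have hτ := h.τ_pos
  set p := 1 - 1 / (1 + τ) with hp
  have hp1 : p < 1 := by
    have : 0 < 1 / (1 + τ) := by positivity
    linarith
  have hp0 : 0 < p := by
    have : 1 / (1 + τ) < 1 := by rw [div_lt_one (by linarith)]; linarith
    linarith
  have hB : Tendsto (fun n : ℕ => Real.logb (theta ν) n ^ p) atTop atTop :=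
    (tendsto_rpow_atTop hp0).comp hν.tendsto_logb
  have hBl : Tendsto (fun n : ℕ => Real.logb (theta ν) n ^ p / Real.log n) atTop (𝓝 0) := by
    refine hν.tendsto_comp_logb_div_log (g := fun x => x ^ p) ?_
    refine (tendsto_rpow_neg_atTop (show 0 < 1 - p by linarith)).congr' ?_
    filter_upwards [eventually_gt_atTop 0] with x hx
    rw [neg_sub, Real.rpow_sub_one hx.ne']
  have hA := hBl.const_mul (constRV (theta ν) τ c)
  simp only [mul_zero, ← mul_div_assoc] at hA
  refine hG.tendstoInMeasure_of_defect hν hB hA hBl (fun k C hkC => ?_) ?_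
  · have hk := hν.tendsto_div_logb (hν.tendsto_div_log hA hBl hkC)
    have hr := hk.rpow_const (p := p) (Or.inl one_ne_zero)
    rw [Real.one_rpow] at hr
    have hlim := ((((h.tendsto_defect hν).comp (hν.tendsto_of_div_logb hk)).mul hr).div_const
      (Real.log (theta ν))).sub_const (constRV (theta ν) τ c)
    rw [mul_one, decay, ← constRV_mul_log hl, mul_div_cancel_right₀ _ hl.ne', sub_self] at hlim
    refine hlim.congr' ?_
    filter_upwards [hν.tendsto_logb.eventually_gt_atTop 0,
      (hν.tendsto_of_div_logb hk).eventually_gt_atTop 0] with n h1 h2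
    have h3 : (0 : ℝ) < k n := by exact_mod_cast h2
    have h4 : 0 < Real.logb (theta ν) n ^ p := Real.rpow_pos_of_pos h1 _
    have h5 : 0 < (k n : ℝ) ^ p := Real.rpow_pos_of_pos h3 _
    simp only [Function.comp]
    rw [Real.div_rpow h3.le h1.le, ← hp]
    field_simp
  · filter_upwards [hB.eventually_gt_atTop 0] with n hn ω
    field_simp
    ring

/-- With `L = log_θ log_θ n` one has `log log_θ n = (log θ) L`. Rewriting `ravFun` in terms of `L`
yields the three constants; splitting `log ((log θ) L)` is the origin of `log_θ (log θ)` in `C₃`. -/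
lemma log_mul_gumbelRaV_centring {θ τ c L : ℝ} (hθ : 1 < θ) (hτ : 1 < τ) (hc : 0 < c)
    (hL : 0 < L) :
    Real.log θ * (C₁ θ τ c * L ^ τ - C₂ θ τ c * L ^ (τ - 1) * Real.logb θ L
        - C₃ θ τ c * L ^ (τ - 1))
      = c ^ (-τ) * ravFun τ (ravConst τ c + τ * Real.log (1 - θ⁻¹)) (Real.log θ * L) := by
  have hl : 0 < Real.log θ := Real.log_pos hθ
  have hA : 0 < 1 - θ⁻¹ := sub_pos.2 (inv_lt_one_of_one_lt₀ hθ)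
  have hτ0 : 0 < τ := by linarith
  have hcτ : 0 < c ^ τ := Real.rpow_pos_of_pos hc _
  have hcτ' : 0 < c ^ (-τ) := Real.rpow_pos_of_pos hc _
  have e1 : ∀ t : ℝ, 0 < t → t ^ τ = t ^ (τ - 1) * t := fun t ht => by
    rw [← Real.rpow_add_one ht.ne']; congr 1; ring
  have e2 : Real.log θ ^ (τ - 2) = Real.log θ ^ (τ - 1) / Real.log θ := by
    rw [← Real.rpow_sub_one hl.ne']; congr 1; ring
  have e3 : Real.log (Real.exp 1 * c ^ τ * (1 - θ⁻¹) / τ)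
      = 1 + τ * Real.log c + Real.log (1 - θ⁻¹) - Real.log τ := by
    rw [Real.log_div (by positivity) hτ0.ne', Real.log_mul (by positivity) hA.ne',
      Real.log_mul (Real.exp_ne_zero _) hcτ.ne', Real.log_exp, Real.log_rpow hc]
  have e4 : Real.log (τ * c ^ (-τ)) = Real.log τ - τ * Real.log c := by
    rw [Real.log_mul hτ0.ne' hcτ'.ne', Real.log_rpow hc]; ring
  unfold C₁ C₂ C₃ ravFun ravConst
  rw [e2, e3, e4, Real.mul_rpow hl.le hL.le, Real.mul_rpow hl.le hL.le, e1 _ hl, e1 _ hL,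
    Real.log_mul hl.ne' hL.ne', Real.logb, Real.logb]
  field_simp
  ring

theorem IsWRT.tendstoInMeasure_gumbelRaV [IsProbabilityMeasure μ] (hG : IsWRT μ ν W parent)
    (hν : WeightLaw ν) {a b c τ : ℝ} (h : GumbelRaVCase ν a b c τ) :
    TendstoInMeasure μ (fun (n : ℕ) ω => ((maxInDegree parent n ω : ℝ) - Real.logb (theta ν) n
            + C₁ (theta ν) τ c * Real.logb (theta ν) (Real.logb (theta ν) n) ^ τ
            - C₂ (theta ν) τ c * Real.logb (theta ν) (Real.logb (theta ν) n) ^ (τ - 1)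
                * Real.logb (theta ν) (Real.logb (theta ν) (Real.logb (theta ν) n)))
          / Real.logb (theta ν) (Real.logb (theta ν) n) ^ (τ - 1))
        atTop (fun _ => C₃ (theta ν) τ c) := by
  have hθ := hν.one_lt_theta
  have hl := hν.log_theta_pos
  have hτ := h.one_lt_τ
  have hc := h.c_pos
  set θ := theta ν with hθdef
  have hL := hν.tendsto_logb_logb
  set L : ℕ → ℝ := fun n => Real.logb θ (Real.logb θ n) with hLdef
  have hB : Tendsto (fun n => L n ^ (τ - 1)) atTop atTop :=
    (tendsto_rpow_atTop (by linarith)).comp hL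
  have hpow : ∀ p : ℝ, Tendsto (fun n : ℕ => L n ^ p / Real.log n) atTop (𝓝 0) := fun p =>
    hν.tendsto_comp_logb_div_log (g := fun x => Real.logb θ x ^ p) (tendsto_logb_rpow_div hθ p)
  have hlogL : Tendsto (fun n => Real.logb θ (L n) / L n) atTop (𝓝 0) := by
    simpa [Function.comp_def] using (tendsto_logb_rpow_div hθ 1).comp hL
  have hBl := hpow (τ - 1)
  -- The `C₃` term belongs to the centring, so that the remaining deviation tends to zero in units
  -- of `L ^ (τ - 1)`.
  set A : ℕ → ℝ := fun n => C₁ θ τ c * L n ^ τ - C₂ θ τ c * L n ^ (τ - 1) * Real.logb θ (L n)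
        - C₃ θ τ c * L n ^ (τ - 1) with hAdef
  have hA : Tendsto (fun n : ℕ => A n / Real.log n) atTop (𝓝 0) := by
    have h1 := (((hpow τ).const_mul (C₁ θ τ c)).sub
      (((hpow τ).mul hlogL).const_mul (C₂ θ τ c))).sub (hBl.const_mul (C₃ θ τ c))
    simp only [mul_zero, sub_zero] at h1
    refine h1.congr' ?_
    filter_upwards [hL.eventually_gt_atTop 0] with n hn
    have e : L n ^ (τ - 1) = L n ^ τ / L n := Real.rpow_sub_one hn.ne' τ
    simp only [hAdef]
    rw [e]
    field_simp
  refine hG.tendstoInMeasure_of_defect hν hB hA hBl (fun k C hkC => ?_) ?_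
  · have hk := hν.tendsto_div_logb (hν.tendsto_div_log hA hBl hkC)
    have hkt := hν.tendsto_of_div_logb hk
    set y : ℕ → ℝ := fun n => Real.log (Real.logb θ n) with hydef
    have hy : Tendsto y atTop atTop := Real.tendsto_log_atTop.comp hν.tendsto_logb
    have hsub := hν.tendsto_log_sub hk
    have hr := (tendsto_div_one_of_sub hy hsub).rpow_const (p := τ - 1) (Or.inl one_ne_zero)
    rw [Real.one_rpow] at hr
    set H := ravConst τ c + τ * Real.log (decay ν) with hH
    -- Two errors are added: the defect against `ravFun` at `log k`, and `ravFun` at `log k` against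
    -- its value at `log log_θ n`, where the shift tends to zero.
    have hlim := (((((h.tendsto_defect hν).comp hkt).mul hr).add
      ((tendsto_ravFun_sub hy hsub τ H).const_mul (c ^ (-τ)))).mul_const
      (Real.log θ ^ (τ - 1))).div_const (Real.log θ)
    simp only [mul_zero, zero_mul, add_zero, zero_div] at hlim
    refine hlim.congr' ?_
    filter_upwards [hL.eventually_gt_atTop 0, hy.eventually_gt_atTop 0,
      (tendsto_log_natCast.comp hkt).eventually_gt_atTop 0] with n h1 h2 h3
    simp only [Function.comp] at h3 ⊢
    have hyL : y n = Real.log θ * L n := by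
      simp only [hydef, hLdef]
      rw [Real.logb.eq_1 θ (Real.logb θ n)]
      field_simp
    have h4 : A n = c ^ (-τ) * ravFun τ H (y n) / Real.log θ := by
      rw [hyL, eq_div_iff hl.ne', mul_comm (A n)]
      exact log_mul_gumbelRaV_centring hθ hτ hc h1
    have h5 : y n ^ (τ - 1) = Real.log θ ^ (τ - 1) * L n ^ (τ - 1) := by
      rw [hyL, Real.mul_rpow hl.le h1.le]
    have h6 : 0 < L n ^ (τ - 1) := Real.rpow_pos_of_pos h1 _
    have h7 : 0 < Real.log θ ^ (τ - 1) := Real.rpow_pos_of_pos hl _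
    have h8 : 0 < Real.log (k n) ^ (τ - 1) := Real.rpow_pos_of_pos h3 _
    rw [h4, Real.div_rpow h3.le h2.le, h5, ← hH, ← hθdef]
    field_simp
    ring
  · filter_upwards [hB.eventually_gt_atTop 0] with n hn ω
    simp only [hAdef]
    change _ / L n ^ (τ - 1) - _ = _
    rw [eq_div_iff hn.ne', sub_mul, div_mul_cancel₀ _ hn.ne']
    ring

end WRT

theorem mainTheorem4 {Ω : Type*} [MeasurableSpace Ω] (μ : Measure Ω) [IsProbabilityMeasure μ]
    (ν : Measure ℝ) (hν : WRT.WeightLaw ν) (θ : ℝ) (hθ : θ = WRT.theta ν)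
    (W : ℕ → Ω → ℝ) (parent : ℕ → Ω → ℕ) (hG : WRT.IsWRT μ ν W parent) :
    -- Weibull case
    (∀ (α : ℝ) (l : ℝ → ℝ), WRT.WeibullCase ν α l →
      TendstoInMeasure μ
        (fun (n : ℕ) ω => ((WRT.maxInDegree parent n ω : ℝ) - Real.logb θ n)
          / Real.logb θ (Real.logb θ n))
        atTop (fun _ => -(α - 1))) ∧
    -- Gumbel-RV case
    (∀ a b c τ γ : ℝ, WRT.GumbelRVCase ν a b c τ → γ = 1 / (1 + τ) →
      TendstoInMeasure μ
        (fun (n : ℕ) ω => ((WRT.maxInDegree parent n ω : ℝ) - Real.logb θ n)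
          / Real.logb θ n ^ (1 - γ))
        atTop (fun _ => -WRT.constRV θ τ c)) ∧
    -- Gumbel-RaV case
    (∀ a b c τ : ℝ, WRT.GumbelRaVCase ν a b c τ →
      TendstoInMeasure μ
        (fun (n : ℕ) ω => ((WRT.maxInDegree parent n ω : ℝ) - Real.logb θ n
            + WRT.C₁ θ τ c * Real.logb θ (Real.logb θ n) ^ τ
            - WRT.C₂ θ τ c * Real.logb θ (Real.logb θ n) ^ (τ - 1)
                * Real.logb θ (Real.logb θ (Real.logb θ n)))
          / Real.logb θ (Real.logb θ n) ^ (τ - 1))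
        atTop (fun _ => WRT.C₃ θ τ c)) := by
  subst hθ
  refine ⟨fun α l h => hG.tendstoInMeasure_weibull hν h, fun a b c τ γ h hγ => ?_,
    fun a b c τ h => hG.tendstoInMeasure_gumbelRaV hν h⟩
  subst hγ
  exact hG.tendstoInMeasure_gumbelRV hν h
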